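/- Let $n\ge 2$. Let $\mathbb R^{1,n+1}=\mathbb R\times\mathbb R^{n+1}$ carry $\langle u,v\rangle=-u_0v_0+\sum_{i=1}^{n+1}u_iv_i$, let $\mathbb H^{n+1}=\{u:\langle u,u\rangle=-1,\ u_0>0\}$, and identify its ideal boundary with the round unit sphere $(\mathbb S^n,g_{\mathbb S^n})\subset\mathbb R^{n+1}$, a sequence $u_k\in\mathbb H^{n+1}$ converging to $y\in\mathbb S^n$ when $\frac{1}{1+(u_k)_0}((u_k)_1,\dots,(u_k)_{n+1})\to y$ in $\mathbb R^{n+1}$. For a map $\phi:M\to\mathbb H^{n+1}$ let $\partial_\infty\phi(M)\subset\mathbb S^n$ be the set of limits at the ideal boundary of sequences in $\phi(M)$. Let $M$ be a connected smooth $n$-manifold without boundary and $\phi:M\to\mathbb H^{n+1}$ a smooth immersion, oriented by a smooth unit normal field $\eta$ (so $\langle\eta,\eta\rangle=1$, $\langle\eta,\phi\rangle=0$, $\langle\eta,d\phi\rangle=0$). Its principal curvatures at $p$ are the numbers $\kappa$ with $d\eta_p(e)=-\kappa\,d\phi_p(e)$ for some $e\ne0$ in $T_pM$. Its light cone map is $\psi=\phi-\eta$;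 its hyperbolic Gauss map $G:M\to\mathbb S^n$ and its horospherical support function $\tilde\rho:M\to\mathbb R$ are defined by $\psi=e^{\tilde\rho}(1,G)$; its geodesic normal flow is $\phi^t=\phi\cosh t-\eta\sinh t$. Suppose that the metric induced by $\phi$ on $M$ is complete, that $\phi$ is uniformly weakly horospherically convex, i.e. there is a constant $\kappa_0>-1$ such that all principal curvatures at all points of $M$ are $\ge\kappa_0$, and that $\partial_\infty\phi(M)=\{x\}$ is a single point. Then: 1. $G$ is injective, $G(M)$ is open in $\mathbb S^n$, and the horospherical support function $\rho=\tilde\rho\circ G^{-1}$ is smooth on $G(M)$. The conformal metric $\hat g=e^{2\rho}g_{\mathbb S^n}$ on $G(M)$ satisfies $G^*\hat g=\psi^*\langle\,,\rangle$ and is complete, and the $2$-tensor $$P=-\nabla^2_{g_{\mathbb S^n}}\rho+d\rho\otimes d\rho-\tfrac12\left(|\nabla^{g_{\mathbb S^n}}\rho|^2_{g_{\mathbb S^n}}-1\right)g_{\mathbb S^n}$$ is bounded with respect to $\hat g$ on $G(M)$. 2. $\partial_\infty\phi(M)=\partial G(M)$, the topological boundary of $G(M)$ in $\mathbb S^n$.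 3. $\phi$ unfolds into an embedded hypersurface along its geodesic normal flow: $\phi^t$ is an immersion for every $t\ge0$, and there is $t_0$ such that $\phi^t$ is an embedding for all $t\ge t_0$. -/

import Mathlib

open Set Filter Topology Metric
open scoped Manifold ContDiff ENNReal

namespace HypSurf

/-- The Euclidean space `ℝⁿ⁺¹`. -/
abbrev Euc (n : ℕ) : Type := EuclideanSpace ℝ (Fin (n + 1))

/-- The round unit sphere `𝕊ⁿ ⊂ ℝⁿ⁺¹`, with Mathlib's smooth structure. It is identified with the
ideal boundary of `ℍⁿ⁺¹` through `y ↦ (1, y)`. -/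
abbrev Sph (n : ℕ) : Type := sphere (0 : Euc n) 1

/-- The vector space `ℝ¹'ⁿ⁺¹`; a vector is written `(x₀, (x₁, …, xₙ₊₁))`. -/
abbrev Mink (n : ℕ) : Type := ℝ × Euc n

/-- The Minkowski product `-x₀ y₀ + ∑ xᵢ yᵢ`. -/
noncomputable def mink {n : ℕ} (u v : Mink n) : ℝ := -(u.1 * v.1) + inner ℝ u.2 v.2

/-- Hyperbolic space `ℍⁿ⁺¹`, in the hyperboloid model. -/
def hyperboloid (n : ℕ) : Set (Mink n) := {u | mink u u = -1 ∧ 0 < u.1}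

/-- The map from the hyperboloid to the open unit ball of `ℝⁿ⁺¹` (Poincaré ball model). -/
noncomputable def toBall {n : ℕ} (u : Mink n) : Euc n := (1 + u.1)⁻¹ • u.2

section Metric

variable {E : Type*} [NormedAddCommGroup E] [NormedSpace ℝ E] {H : Type*} [TopologicalSpace H]
  (I : ModelWithCorners ℝ E H) {N : Type*} [TopologicalSpace N] [ChartedSpace H N]

/-- The length of the path `γ : [0, 1] → N`, where `nrm` measures tangent vectors. -/
noncomputable def pathLength (nrm : ∀ x : N, TangentSpace I x → ℝ≥0∞) (γ : ℝ → N) : ℝ≥0∞ :=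
  letI : ∀ x : N, ENorm (TangentSpace I x) := fun x => ⟨nrm x⟩
  Manifold.pathELength I γ 0 1

/-- The length distance of the open set `Ω ⊆ N`: the infimum of the lengths of the `C¹` paths
*inside `Ω`* from `x` to `y`. -/
noncomputable def lengthDist (Ω : Set N) (nrm : ∀ x : N, TangentSpace I x → ℝ≥0∞) (x y : N) :
    ℝ≥0∞ :=
  ⨅ (γ : ℝ → N) (_ : ContMDiffOn 𝓘(ℝ, ℝ) I 1 γ (Icc 0 1)) (_ : MapsTo γ (Icc 0 1) Ω)
    (_ : γ 0 = x) (_ : γ 1 = y), pathLength I nrm γ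

/-- The Riemannian metric with norm `nrm` on the open set `Ω` is complete: every sequence of `Ω`
that is Cauchy for its length distance converges to a point of `Ω`. -/
def IsCompleteMetricOn (Ω : Set N) (nrm : ∀ x : N, TangentSpace I x → ℝ≥0∞) : Prop :=
  ∀ u : ℕ → N, (∀ k, u k ∈ Ω) →
    (∀ ε : ℝ≥0∞, 0 < ε → ∃ K : ℕ, ∀ i ≥ K, ∀ j ≥ K, lengthDist I Ω nrm (u i) (u j) < ε) →
    ∃ y ∈ Ω, Tendsto u atTop (𝓝 y)

end Metric

section Conformal

variable {n : ℕ}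

/-- The extension of a function on `𝕊ⁿ` to `ℝⁿ⁺¹ ∖ {0}` that is constant on rays. -/
noncomputable def radialExt (ρ : Sph n → ℝ) (y : Euc n) : ℝ :=
  if h : y = 0 then 0 else ρ ⟨‖y‖⁻¹ • y, by simp [norm_smul, h]⟩

/-- The gradient of `ρ` for the round metric. The radial derivative of `radialExt ρ` vanishes, so
its Euclidean gradient at a point of `𝕊ⁿ` is tangent to `𝕊ⁿ`. -/
noncomputable def sphGrad (ρ : Sph n → ℝ) (x : Sph n) : Euc n :=
  gradient (radialExt ρ) (x : Euc n)

/-- The Hessian of `ρ` for the round metric, on vectors `v, w` orthogonal to `x`. In general the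
spherical Hessian of `F|_{𝕊ⁿ}` is `D²F(v, w) - (∂F/∂r) ⟨v, w⟩`; here `∂F/∂r = 0`. -/
noncomputable def sphHess (ρ : Sph n → ℝ) (x : Sph n) (v w : Euc n) : ℝ :=
  fderiv ℝ (fun y => fderiv ℝ (radialExt ρ) y) (x : Euc n) v w

/-- The `2`-tensor `P = -∇²ρ + dρ ⊗ dρ - ½ (|∇ρ|² - 1) g` of the metric `e^{2ρ} g`, where `g` is the
round metric and all the operations are those of `g`. -/
noncomputable def tensorP (ρ : Sph n → ℝ) (x : Sph n) (v w : Euc n) : ℝ :=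
  -sphHess ρ x v w + inner ℝ (sphGrad ρ x) v * inner ℝ (sphGrad ρ x) w
    - 1 / 2 * (‖sphGrad ρ x‖ ^ 2 - 1) * inner ℝ v w

/-- `P` is bounded on `Ω`, with respect to the metric `e^{2ρ} g`. -/
def BoundedP (Ω : Set (Sph n)) (ρ : Sph n → ℝ) : Prop :=
  ∃ C : ℝ, ∀ x ∈ Ω, ∀ v w : Euc n, inner ℝ (x : Euc n) v = 0 → inner ℝ (x : Euc n) w = 0 →
    |tensorP ρ x v w| ≤ C * (Real.exp (ρ x) * ‖v‖) * (Real.exp (ρ x) * ‖w‖)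

/-- The norm of a tangent vector of `𝕊ⁿ` in the conformal metric `e^{2ρ} g`. -/
noncomputable def conformalNorm (ρ : Sph n → ℝ) (x : Sph n) (v : TangentSpace (𝓡 n) x) : ℝ≥0∞ :=
  let w : Euc n := mfderiv (𝓡 n) 𝓘(ℝ, Euc n) (fun y : Sph n => (y : Euc n)) x v
  ENNReal.ofReal (Real.exp (ρ x) * ‖w‖)

end Conformal

section Hypersurface

variable {n : ℕ} {M : Type*} [TopologicalSpace M] [ChartedSpace (EuclideanSpace ℝ (Fin n)) M]

/-- The differential at `p` of a map from `M` to a vector space. -/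
noncomputable def dmap {F : Type*} [NormedAddCommGroup F] [NormedSpace ℝ F] (f : M → F) (p : M)
    (v : TangentSpace (𝓡 n) p) : F :=
  mfderiv (𝓡 n) 𝓘(ℝ, F) f p v

/-- A smooth map to a vector space whose differential is injective at every point. -/
def IsImmersed {F : Type*} [NormedAddCommGroup F] [NormedSpace ℝ F] (f : M → F) : Prop :=
  ContMDiff (𝓡 n) 𝓘(ℝ, F) ∞ f ∧ ∀ p : M, Function.Injective (dmap (n := n) f p)

variable (n M) in
/-- An immersed, oriented hypersurface `φ : Mⁿ → ℍⁿ⁺¹`, the orientation being given by a unit normal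
field `η : M → 𝕊¹'ⁿ` (normal to `φ` and tangent to `ℍⁿ⁺¹`). -/
structure OrientedHypersurface where
  /-- the immersion -/
  φ : M → Mink n
  /-- the unit normal field -/
  η : M → Mink n
  φ_mem : ∀ p, φ p ∈ hyperboloid n
  φ_immersed : IsImmersed (n := n) φ
  η_smooth : ContMDiff (𝓡 n) 𝓘(ℝ, Mink n) ∞ η
  η_unit : ∀ p, mink (η p) (η p) = 1
  η_tangent : ∀ p, mink (η p) (φ p) = 0
  η_normal : ∀ p (v : TangentSpace (𝓡 n) p), mink (η p) (dmap φ p v) = 0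

namespace OrientedHypersurface

variable (S : OrientedHypersurface n M)

/-- The norm of a tangent vector of `M` in the metric induced by `φ`. -/
noncomputable def inducedNorm (p : M) (v : TangentSpace (𝓡 n) p) : ℝ≥0∞ :=
  ENNReal.ofReal (Real.sqrt (mink (dmap S.φ p v) (dmap S.φ p v)))

/-- The metric induced by `φ` on `M` is complete. -/
def IsComplete : Prop := IsCompleteMetricOn (𝓡 n) (univ : Set M) S.inducedNorm

/-- `κ` is a principal curvature at `p`, that is, an eigenvalue of the shape operator, with the sign
convention `dη(e) = -κ dφ(e)`. -/
def IsPrincipalCurvature (p : M) (κ : ℝ) : Prop :=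
  ∃ e : TangentSpace (𝓡 n) p, e ≠ 0 ∧ dmap S.η p e = -κ • dmap S.φ p e

/-- Uniform weak horospherical convexity. -/
def UniformlyWeaklyHorosphericallyConvex : Prop :=
  ∃ κ₀ : ℝ, -1 < κ₀ ∧ ∀ (p : M) (κ : ℝ), S.IsPrincipalCurvature p κ → κ₀ ≤ κ

/-- The light cone map `ψ = φ - η`. -/
def lightCone (p : M) : Mink n := S.φ p - S.η p

theorem lightCone_null (p : M) : mink (S.lightCone p) (S.lightCone p) = 0 := by
  have h1 := (S.φ_mem p).1
  have h2 := S.η_unit p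
  have h3 := S.η_tangent p
  simp only [mink, lightCone, Prod.fst_sub, Prod.snd_sub, inner_sub_left, inner_sub_right]
    at h1 h2 h3 ⊢
  rw [real_inner_comm (S.η p).2 (S.φ p).2]
  rw [real_inner_comm] at h3
  linarith [real_inner_comm (S.η p).2 (S.φ p).2]

theorem norm_lightCone (p : M) : ‖(S.lightCone p).2‖ ^ 2 = (S.lightCone p).1 ^ 2 := by
  have h := S.lightCone_null p
  simp only [mink, real_inner_self_eq_norm_sq] at h
  linarith

theorem lightCone_pos (p : M) : 0 < (S.lightCone p).1 := by
  have hn := S.norm_lightCone p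
  have h1 := (S.φ_mem p).1
  have h0 := (S.φ_mem p).2
  have h3 := S.η_tangent p
  have h4 : mink (S.φ p) (S.lightCone p) = -1 := by
    simp only [mink, lightCone, Prod.fst_sub, Prod.snd_sub, inner_sub_right] at h1 h3 ⊢
    rw [real_inner_comm] at h3
    linarith
  by_contra! hneg
  have hn' : ‖(S.lightCone p).2‖ = -(S.lightCone p).1 := by
    have := abs_eq_abs.2 (sq_eq_sq_iff_eq_or_eq_neg.1 hn)
    rwa [abs_of_nonneg (norm_nonneg _), abs_of_nonpos hneg] at this
  have hφ : ‖(S.φ p).2‖ ≤ (S.φ p).1 := by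
    simp only [mink, real_inner_self_eq_norm_sq] at h1
    exact abs_le_of_sq_le_sq' (by linarith) h0.le |>.2
  have hcs := neg_le_of_abs_le (abs_real_inner_le_norm (S.φ p).2 (S.lightCone p).2)
  have hmul : ‖(S.φ p).2‖ * ‖(S.lightCone p).2‖ ≤ (S.φ p).1 * ‖(S.lightCone p).2‖ :=
    mul_le_mul_of_nonneg_right hφ (norm_nonneg _)
  simp only [mink] at h4
  rw [hn'] at hcs hmul
  linarith

/-- The hyperbolic Gauss map `G`, determined by `ψ = ψ₀ (1, G)`. The horosphere through `φ(p)` with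
point at infinity `y` is the set of `u ∈ ℍⁿ⁺¹` with `⟨u, r (1, y)⟩ = -1`, for the `r > 0` for which
`φ(p)` solves this equation; its outward unit normal at `φ(p)` is `φ(p) - r (1, y)`, and this equals
`η(p)` exactly when `r (1, y) = ψ(p)`. So `G(p)` is the point at infinity of the horosphere through
`φ(p)` with outward unit normal `η(p)`. -/
noncomputable def gauss (p : M) : Sph n :=
  ⟨(S.lightCone p).1⁻¹ • (S.lightCone p).2, by
    have h0 := S.lightCone_pos p
    have h : ‖(S.lightCone p).2‖ = (S.lightCone p).1 :=
      (sq_eq_sq₀ (norm_nonneg _) h0.le).1 (S.norm_lightCone p)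
    rw [mem_sphere_zero_iff_norm, norm_smul, norm_inv, h, Real.norm_of_nonneg h0.le,
      inv_mul_cancel₀ h0.ne']⟩

/-- The horospherical support function `ρ̃ = log ψ₀` on `M`. -/
noncomputable def support (p : M) : ℝ := Real.log (S.lightCone p).1

/-- The horospherical metric `g_h = ψ^*⟨ , ⟩` on `M`. -/
noncomputable def horosphericalMetric (p : M) (v w : TangentSpace (𝓡 n) p) : ℝ :=
  mink (dmap S.lightCone p v) (dmap S.lightCone p w)

/-- The boundary at infinity `∂_∞ φ(M)`: the points of `𝕊ⁿ` that are limits of points of `φ(M)` in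
the compactified ball model. -/
def idealBoundary : Set (Sph n) :=
  {y | (y : Euc n) ∈ closure (range fun p => toBall (S.φ p))}

/-- The geodesic normal flow `φᵗ = exp_φ(-tη) = φ cosh t - η sinh t`. -/
noncomputable def flow (t : ℝ) (p : M) : Mink n := Real.cosh t • S.φ p - Real.sinh t • S.η p

end OrientedHypersurface

end Hypersurface

end HypSurf

/-! One inequality carries the proof. Along a principal direction dψ = (1 + κ) dφ, so κ ≥ κ₀ > -1
gives |dφ| ≤ (1 + κ₀)⁻¹ |dψ| (`norm_dφ_le`), and |dψ| = ψ₀ |dG| because ψ = ψ₀ (1, G) is null. Hence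
G is a local diffeomorphism, and a lift through G of a path of finite length has finite length as
long as ψ₀ stays bounded.

If ψ₀ → ∞ while G → y, then φ also tends to y in the ball (`norm_toBall_sub_gauss_sq_le`), so y = x.
Thus ψ₀ is bounded over compact sets that miss x, and completeness lifts every C¹ path that avoids x
(`exists_lift`). Stereographic projection turns 𝕊ⁿ ∖ {x} into a Euclidean space; lifting its
segments gives a continuous section σ of G. The set where σ ∘ G = id is open, and it is dense
because for n ≥ 2 a point of M over x does not disconnect its small neighbourhoods. A point over x
would moreover make M compact, which is impossible since the ideal boundary is nonempty. So G is a
diffeomorphism onto 𝕊ⁿ ∖ {x} (`exists_inverse`), whose frontier is {x}, and ρ = ρ̃ ∘ σ. The basic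
inequality transfers completeness from φ to ĝ, and bounds P because P = ½ ĝ - ⟨dφ, dψ⟩
(`IsGaussInverse.tensorP_eq`).

For the flow, write 2φᵗ = eᵗψ + D with D = e⁻ᵗ(φ + η) null. If φᵗ(p) is the origin (1, 0), then D(p)
= (1, -G(p)). Along an arc of Gauss images starting at G(p), a bootstrap shows that D moves at a
speed of order e⁻²ᵗ times the length of the arc (`IsGaussInverse.dualCone_drift`). If G(p) were not
close to -x, the arc to x would keep ψ₀ bounded up to x, and completeness would produce a point of M
over x. So two points sent to the origin have Gauss images near -x, joined by an arc that avoids x;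
D would have to change by the full distance of these images, which the drift bound forbids for large
t. A point reflection of ℍⁿ⁺¹ moves any double point to the origin. Properness of φᵗ, from a lower
bound of φ₀ by a multiple of 1/|G - x| near x (`IsGaussInverse.one_le_mul_φ_fst`), upgrades
injectivity to embeddedness. -/

namespace HypSurf

/-! ### Minkowski algebra: spacelike complements and point reflections -/

section MinkowskiAlgebra

variable {n : ℕ}

theorem mink_comm (a b : Mink n) : mink a b = mink b a := by
  simp only [mink, real_inner_comm b.2 a.2]; ring

theorem mink_add_left (a b c : Mink n) : mink (a + b) c = mink a c + mink b c := by
  simp only [mink, Prod.fst_add, Prod.snd_add, inner_add_left]; ring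

theorem mink_add_right (a b c : Mink n) : mink a (b + c) = mink a b + mink a c := by
  simp only [mink, Prod.fst_add, Prod.snd_add, inner_add_right]; ring

theorem mink_smul_left (r : ℝ) (a b : Mink n) : mink (r • a) b = r * mink a b := by
  simp only [mink, Prod.smul_fst, Prod.smul_snd, real_inner_smul_left, smul_eq_mul]; ring

theorem mink_smul_right (r : ℝ) (a b : Mink n) : mink a (r • b) = r * mink a b := by
  simp only [mink, Prod.smul_fst, Prod.smul_snd, real_inner_smul_right, smul_eq_mul]; ring

theorem mink_neg_left (a b : Mink n) : mink (-a) b = -mink a b := by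
  rw [← neg_one_smul ℝ a, mink_smul_left, neg_one_mul]

theorem mink_neg_right (a b : Mink n) : mink a (-b) = -mink a b := by
  rw [mink_comm, mink_neg_left, mink_comm]

theorem mink_sub_left (a b c : Mink n) : mink (a - b) c = mink a c - mink b c := by
  rw [sub_eq_add_neg, mink_add_left, mink_neg_left, sub_eq_add_neg]

theorem mink_sub_right (a b c : Mink n) : mink a (b - c) = mink a b - mink a c := by
  rw [sub_eq_add_neg, mink_add_right, mink_neg_right, sub_eq_add_neg]

theorem mink_zero_left (a : Mink n) : mink 0 a = 0 := by simp [mink]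

theorem eq_zero_of_mink_eq_zero {a : Mink n} (h : ∀ b, mink a b = 0) : a = 0 := by
  have h1 := h (1, 0)
  have h2 := h (0, a.2)
  simp only [mink, mul_one, inner_zero_right, add_zero, mul_zero, neg_zero, zero_add] at h1 h2
  exact Prod.ext (by simpa using h1) (inner_self_eq_zero.1 h2)

theorem norm_snd_sq_of_mem_hyperboloid {b : Mink n} (hb : b ∈ hyperboloid n) :
    ‖b.2‖ ^ 2 = b.1 ^ 2 - 1 := by
  have := hb.1
  simp only [mink, real_inner_self_eq_norm_sq] at this
  linarith

theorem norm_snd_lt_of_mem_hyperboloid {b : Mink n} (hb : b ∈ hyperboloid n) : ‖b.2‖ < b.1 := by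
  have := norm_snd_sq_of_mem_hyperboloid hb
  exact lt_of_pow_lt_pow_left₀ 2 hb.2.le (by linarith)

theorem one_le_of_mem_hyperboloid {b : Mink n} (hb : b ∈ hyperboloid n) : 1 ≤ b.1 := by
  have := norm_snd_sq_of_mem_hyperboloid hb
  nlinarith [sq_nonneg ‖b.2‖, hb.2]

section Spacelike

variable {a a' b : Mink n} (hb : b ∈ hyperboloid n)

theorem abs_fst_mul_le_of_orthogonal (h : mink a b = 0) : |a.1| * b.1 ≤ ‖a.2‖ * ‖b.2‖ := by
  have h' : a.1 * b.1 = inner ℝ a.2 b.2 := by simp only [mink] at h; linarith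
  calc |a.1| * b.1 ≤ |a.1| * |b.1| := by gcongr; exact le_abs_self _
    _ = |inner ℝ a.2 b.2| := by rw [← abs_mul, h']
    _ ≤ _ := abs_real_inner_le_norm _ _

include hb

theorem abs_fst_le_of_orthogonal (h : mink a b = 0) : |a.1| ≤ ‖a.2‖ := by
  have h1 := abs_fst_mul_le_of_orthogonal h
  have h2 := norm_snd_lt_of_mem_hyperboloid hb
  refine le_of_mul_le_mul_right (h1.trans ?_) hb.2
  gcongr

/-- Orthogonality gives a₀² b₀² ≤ |a'|² |b'|², and |b'|² = b₀² - 1 on the hyperboloid. This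
quantifies that the complement of a timelike vector is spacelike. -/
theorem norm_snd_sq_le_of_orthogonal (h : mink a b = 0) :
    ‖a.2‖ ^ 2 ≤ b.1 ^ 2 * mink a a := by
  have h1 := abs_fst_mul_le_of_orthogonal h
  have h2 := norm_snd_sq_of_mem_hyperboloid hb
  have h3 : (|a.1| * b.1) ^ 2 ≤ (‖a.2‖ * ‖b.2‖) ^ 2 :=
    pow_le_pow_left₀ (mul_nonneg (abs_nonneg _) hb.2.le) h1 2
  rw [mul_pow, mul_pow, sq_abs, h2] at h3
  simp only [mink, real_inner_self_eq_norm_sq]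
  nlinarith

theorem mink_self_nonneg_of_orthogonal (h : mink a b = 0) : 0 ≤ mink a a := by
  have h1 := norm_snd_sq_le_of_orthogonal hb h
  have h2 : 0 < b.1 ^ 2 := pow_pos hb.2 2
  by_contra! h3
  nlinarith [sq_nonneg ‖a.2‖]

/-- The bridge from the induced Riemannian norm at b to the norm of the ambient vector space, at the
price of the factor b₀. -/
theorem norm_le_of_orthogonal (h : mink a b = 0) : ‖a‖ ≤ b.1 * √(mink a a) := by
  have h1 := norm_snd_sq_le_of_orthogonal hb h
  have h2 := mink_self_nonneg_of_orthogonal hb h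
  have h3 : ‖a.2‖ ≤ b.1 * √(mink a a) := by
    refine abs_le_of_sq_le_sq' ?_ (by have := hb.2; positivity) |>.2
    rwa [mul_pow, Real.sq_sqrt h2]
  refine max_le ?_ h3
  rw [Real.norm_eq_abs]
  exact (abs_fst_le_of_orthogonal hb h).trans h3

theorem eq_zero_of_mink_self_eq_zero (h : mink a b = 0) (h0 : mink a a = 0) : a = 0 := by
  have := norm_le_of_orthogonal hb h
  rw [h0, Real.sqrt_zero, mul_zero] at this
  exact norm_le_zero_iff.1 this

theorem mink_self_pos_of_orthogonal (h : mink a b = 0) (h0 : a ≠ 0) : 0 < mink a a :=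
  lt_of_le_of_ne (mink_self_nonneg_of_orthogonal hb h)
    fun h1 => h0 (eq_zero_of_mink_self_eq_zero hb h h1.symm)

/-- Cauchy–Schwarz for the positive definite form on the complement of b, from the usual projection
of a along a'. -/
theorem mink_sq_le_of_orthogonal (h : mink a b = 0) (h' : mink a' b = 0) :
    mink a a' ^ 2 ≤ mink a a * mink a' a' := by
  rcases eq_or_ne a' 0 with rfl | h0
  · simp [mink]
  have hpos := mink_self_pos_of_orthogonal hb h' h0
  have h1 : mink (mink a' a' • a - mink a a' • a') b = 0 := by
    rw [mink_sub_left, mink_smul_left, mink_smul_left, h, h']; ring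
  have h2 := mink_self_nonneg_of_orthogonal hb h1
  simp only [mink_sub_left, mink_smul_left, mink_sub_right, mink_smul_right] at h2
  rw [mink_comm a' a] at h2
  have h3 : 0 ≤ mink a' a' * (mink a a * mink a' a' - mink a a' ^ 2) := by linarith
  linarith [nonneg_of_mul_nonneg_right h3 hpos]

theorem abs_mink_le_of_orthogonal (h : mink a b = 0) (h' : mink a' b = 0) :
    |mink a a'| ≤ √(mink a a) * √(mink a' a') := by
  rw [← Real.sqrt_mul (mink_self_nonneg_of_orthogonal hb h)]
  exact Real.abs_le_sqrt (mink_sq_le_of_orthogonal hb h h')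

theorem sqrt_mink_add_le (h : mink a b = 0) (h' : mink a' b = 0) :
    √(mink (a + a') (a + a')) ≤ √(mink a a) + √(mink a' a') := by
  have h1 := (abs_le.1 (abs_mink_le_of_orthogonal hb h h')).2
  refine Real.sqrt_le_iff.2 ⟨by positivity, ?_⟩
  have e1 := Real.sq_sqrt (mink_self_nonneg_of_orthogonal hb h)
  have e2 := Real.sq_sqrt (mink_self_nonneg_of_orthogonal hb h')
  simp only [mink_add_left, mink_add_right]
  rw [mink_comm a' a]
  nlinarith

end Spacelike

theorem sqrt_mink_smul (r : ℝ) (a : Mink n) :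
    √(mink (r • a) (r • a)) = |r| * √(mink a a) := by
  rw [mink_smul_left, mink_smul_right, ← mul_assoc, Real.sqrt_mul (mul_self_nonneg r),
    Real.sqrt_mul_self_eq_abs]

theorem hasDerivAt_mink {f g : ℝ → Mink n} {f' g' : Mink n} {t : ℝ} (hf : HasDerivAt f f' t)
    (hg : HasDerivAt g g' t) :
    HasDerivAt (fun s => mink (f s) (g s)) (mink f' (g t) + mink (f t) g') t := by
  have h1 : HasDerivAt (fun s => (f s).1) f'.1 t := hf.fst
  have h2 : HasDerivAt (fun s => (g s).1) g'.1 t := hg.fst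
  have h3 : HasDerivAt (fun s => (f s).2) f'.2 t := hf.snd
  have h4 : HasDerivAt (fun s => (g s).2) g'.2 t := hg.snd
  refine ((h1.mul h2).neg.add (h3.inner ℝ h4)).congr_deriv ?_
  simp only [HypSurf.mink]
  ring

/-- The basepoint `(1, 0)` of the hyperboloid. -/
def origin (n : ℕ) : Mink n := (1, 0)

theorem mink_origin_right (a : Mink n) : mink a (origin n) = -a.1 := by simp [mink, origin]

/-- The point reflection of Minkowski space in the midpoint of `b ∈ ℍⁿ⁺¹` and the origin. -/
noncomputable def pointReflection (b : Mink n) : Mink n →L[ℝ] Mink n :=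
  -ContinuousLinearMap.id ℝ (Mink n) -
    ((1 + b.1)⁻¹ • (-((b.1 + 1) • ContinuousLinearMap.fst ℝ ℝ (Euc n)) +
      (innerSL ℝ b.2).comp (ContinuousLinearMap.snd ℝ ℝ (Euc n)))).smulRight (b + origin n)

theorem pointReflection_apply (b a : Mink n) :
    pointReflection b a = -a - ((1 + b.1)⁻¹ * mink a (b + origin n)) • (b + origin n) := by
  simp only [pointReflection, mink, origin, _root_.sub_apply,
    _root_.neg_apply, ContinuousLinearMap.id_apply,
    ContinuousLinearMap.smulRight_apply, _root_.smul_apply,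
    _root_.add_apply, ContinuousLinearMap.comp_apply, innerSL_apply_apply,
    ContinuousLinearMap.coe_fst',
    ContinuousLinearMap.coe_snd', Prod.fst_add, Prod.snd_add, add_zero, smul_eq_mul]
  rw [real_inner_comm a.2 b.2, mul_comm (b.1 + 1)]

section PointReflection

variable {b : Mink n} (hb : b ∈ hyperboloid n)
include hb

theorem mink_add_origin : mink (b + origin n) (b + origin n) = -2 * (1 + b.1) := by
  have := hb.1
  rw [mink_add_left, mink_add_right, mink_comm (origin n), mink_origin_right, mink_origin_right,
    this]
  simp [origin]; ring

theorem mink_pointReflection (a a' : Mink n) :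
    mink (pointReflection b a) (pointReflection b a') = mink a a' := by
  have h := mink_add_origin hb
  have hne : 1 + b.1 ≠ 0 := by have := hb.2; positivity
  simp only [pointReflection_apply, mink_sub_left, mink_sub_right, mink_neg_left, mink_neg_right,
    mink_smul_left, mink_smul_right, h]
  rw [mink_comm (b + origin n) a']
  field_simp
  ring

theorem pointReflection_pointReflection (a : Mink n) :
    pointReflection b (pointReflection b a) = a := by
  have h := mink_add_origin hb
  have hne : 1 + b.1 ≠ 0 := by have := hb.2; positivity
  rw [pointReflection_apply b (pointReflection b a), pointReflection_apply b a]
  simp only [mink_sub_left, mink_neg_left, mink_smul_left, h]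
  have : (1 + b.1)⁻¹ * (-mink a (b + origin n) -
      (1 + b.1)⁻¹ * mink a (b + origin n) * (-2 * (1 + b.1))) =
      (1 + b.1)⁻¹ * mink a (b + origin n) := by field_simp; ring
  rw [this]
  abel

theorem pointReflection_self : pointReflection b b = origin n := by
  have hne : 1 + b.1 ≠ 0 := by have := hb.2; positivity
  rw [pointReflection_apply, mink_add_right, mink_origin_right, hb.1]
  have : (1 + b.1)⁻¹ * (-1 + -b.1) = -1 := by field_simp; ring
  rw [this]
  simp

theorem pointReflection_fst (a : Mink n) : (pointReflection b a).1 = -mink a b := by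
  have h := mink_pointReflection hb a b
  rw [pointReflection_self hb, mink_origin_right] at h
  linarith

end PointReflection

end MinkowskiAlgebra

end HypSurf

namespace HypSurf

/-! ### Differentials of vector-valued maps along chart lines -/

section Calculus

variable {n : ℕ} {M : Type*} [TopologicalSpace M] [ChartedSpace (EuclideanSpace ℝ (Fin n)) M]
  {F : Type*} [NormedAddCommGroup F] [NormedSpace ℝ F]

/-- The curve through `p` that is a straight line in the preferred chart at `p`. -/
noncomputable def chartCurve (p : M) (v : EuclideanSpace ℝ (Fin n)) (s : ℝ) : M :=
  (extChartAt (𝓡 n) p).symm (extChartAt (𝓡 n) p p + s • v)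

theorem chartCurve_zero (p : M) (v : EuclideanSpace ℝ (Fin n)) : chartCurve p v 0 = p := by
  simp [chartCurve]

theorem dmap_eq_fderiv {f : M → F} {p : M} (hf : MDifferentiableAt (𝓡 n) 𝓘(ℝ, F) f p)
    (v : TangentSpace (𝓡 n) p) :
    dmap f p v = fderiv ℝ (f ∘ (extChartAt (𝓡 n) p).symm) (extChartAt (𝓡 n) p p) v := by
  simp only [dmap, mfderiv, hf, writtenInExtChartAt, ModelWithCorners.range_eq_univ,
    fderivWithin_univ]
  rfl

theorem differentiableAt_comp_chart {f : M → F} {p : M}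
    (hf : MDifferentiableAt (𝓡 n) 𝓘(ℝ, F) f p) :
    DifferentiableAt ℝ (f ∘ (extChartAt (𝓡 n) p).symm) (extChartAt (𝓡 n) p p) := by
  have := hf.differentiableWithinAt_writtenInExtChartAt
  rw [ModelWithCorners.range_eq_univ, differentiableWithinAt_univ] at this
  exact this

theorem hasDerivAt_chartCurve {f : M → F} {p : M} (hf : MDifferentiableAt (𝓡 n) 𝓘(ℝ, F) f p)
    (v : TangentSpace (𝓡 n) p) :
    HasDerivAt (fun s => f (chartCurve p v s)) (dmap f p v) 0 := by
  rw [dmap_eq_fderiv hf]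
  have h1 := (differentiableAt_comp_chart hf).hasFDerivAt
  let w : EuclideanSpace ℝ (Fin n) := v
  have h2 : HasDerivAt (fun s : ℝ => extChartAt (𝓡 n) p p + s • w) w 0 := by
    simpa using ((hasDerivAt_id (0 : ℝ)).smul_const w).const_add (extChartAt (𝓡 n) p p)
  have h3 : extChartAt (𝓡 n) p p = extChartAt (𝓡 n) p p + (0 : ℝ) • w := by simp
  rw [h3] at h1
  have := h1.comp_hasDerivAt (0 : ℝ) h2
  rw [← h3] at this
  exact this

theorem dmap_eq_of_hasDerivAt {f : M → F} {p : M} (hf : MDifferentiableAt (𝓡 n) 𝓘(ℝ, F) f p)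
    {v : TangentSpace (𝓡 n) p} {w : F}
    (h : HasDerivAt (fun s => f (chartCurve p v s)) w 0) : dmap f p v = w :=
  (hasDerivAt_chartCurve hf v).unique h

theorem dmap_add (f : M → F) (p : M) (v w : TangentSpace (𝓡 n) p) :
    dmap f p (v + w) = dmap f p v + dmap f p w :=
  map_add (mfderiv (𝓡 n) 𝓘(ℝ, F) f p) v w

theorem dmap_smul (f : M → F) (p : M) (r : ℝ) (v : TangentSpace (𝓡 n) p) :
    dmap f p (r • v) = r • dmap f p v :=
  map_smul (mfderiv (𝓡 n) 𝓘(ℝ, F) f p) r v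

theorem dmap_zero (f : M → F) (p : M) : dmap (n := n) f p 0 = 0 :=
  map_zero (mfderiv (𝓡 n) 𝓘(ℝ, F) f p)

/-- The differential as a linear map on the model space. -/
noncomputable def dmapLinear (f : M → F) (p : M) : EuclideanSpace ℝ (Fin n) →ₗ[ℝ] F where
  toFun v := dmap (n := n) f p v
  map_add' := dmap_add f p
  map_smul' := dmap_smul f p

theorem continuous_dmapLinear (f : M → F) (p : M) : Continuous (dmapLinear (n := n) f p) :=
  (mfderiv (𝓡 n) 𝓘(ℝ, F) f p).continuous

end Calculus

/-! ### The moving frame, the second fundamental form and the convexity inequality -/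

namespace OrientedHypersurface

variable {n : ℕ} {M : Type*} [TopologicalSpace M] [ChartedSpace (EuclideanSpace ℝ (Fin n)) M]
  (S : OrientedHypersurface n M)

theorem φ_smooth : ContMDiff (𝓡 n) 𝓘(ℝ, Mink n) ∞ S.φ := S.φ_immersed.1

theorem φ_mdiff (p : M) : MDifferentiableAt (𝓡 n) 𝓘(ℝ, Mink n) S.φ p :=
  S.φ_smooth.mdifferentiable (by simp) p

theorem η_mdiff (p : M) : MDifferentiableAt (𝓡 n) 𝓘(ℝ, Mink n) S.η p :=
  S.η_smooth.mdifferentiable (by simp) p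

theorem lightCone_smooth : ContMDiff (𝓡 n) 𝓘(ℝ, Mink n) ∞ S.lightCone :=
  S.φ_smooth.sub S.η_smooth

theorem lightCone_mdiff (p : M) : MDifferentiableAt (𝓡 n) 𝓘(ℝ, Mink n) S.lightCone p :=
  S.lightCone_smooth.mdifferentiable (by simp) p

theorem dmap_lightCone (p : M) (v : TangentSpace (𝓡 n) p) :
    dmap S.lightCone p v = dmap S.φ p v - dmap S.η p v :=
  dmap_eq_of_hasDerivAt (S.lightCone_mdiff p)
    ((hasDerivAt_chartCurve (S.φ_mdiff p) v).sub (hasDerivAt_chartCurve (S.η_mdiff p) v))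

theorem mink_dmap_add_eq_zero {f g : M → Mink n} {p : M}
    (hf : MDifferentiableAt (𝓡 n) 𝓘(ℝ, Mink n) f p)
    (hg : MDifferentiableAt (𝓡 n) 𝓘(ℝ, Mink n) g p) {r : ℝ}
    (h : ∀ q, mink (f q) (g q) = r) (v : TangentSpace (𝓡 n) p) :
    mink (dmap f p v) (g p) + mink (f p) (dmap g p v) = 0 := by
  have h1 := hasDerivAt_mink (hasDerivAt_chartCurve hf v) (hasDerivAt_chartCurve hg v)
  simp only [h] at h1
  have h2 := h1.unique (hasDerivAt_const _ _)
  have e : chartCurve p v 0 = p := chartCurve_zero p v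
  rwa [e] at h2

theorem mink_dφ_φ (p : M) (v : TangentSpace (𝓡 n) p) : mink (dmap S.φ p v) (S.φ p) = 0 := by
  have := mink_dmap_add_eq_zero (S.φ_mdiff p) (S.φ_mdiff p) (fun q => (S.φ_mem q).1) v
  rw [mink_comm (S.φ p)] at this
  linarith

theorem mink_dη_η (p : M) (v : TangentSpace (𝓡 n) p) : mink (dmap S.η p v) (S.η p) = 0 := by
  have := mink_dmap_add_eq_zero (S.η_mdiff p) (S.η_mdiff p) (fun q => (S.η_unit q)) v
  rw [mink_comm (S.η p)] at this
  linarith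

theorem mink_dφ_η (p : M) (v : TangentSpace (𝓡 n) p) : mink (dmap S.φ p v) (S.η p) = 0 := by
  rw [mink_comm, S.η_normal]

theorem mink_dη_φ (p : M) (v : TangentSpace (𝓡 n) p) : mink (dmap S.η p v) (S.φ p) = 0 := by
  have := mink_dmap_add_eq_zero (S.η_mdiff p) (S.φ_mdiff p) (fun q => (S.η_tangent q)) v
  rwa [S.η_normal, add_zero] at this

theorem mink_dlightCone_φ (p : M) (v : TangentSpace (𝓡 n) p) :
    mink (dmap S.lightCone p v) (S.φ p) = 0 := by
  rw [dmap_lightCone, mink_sub_left, mink_dφ_φ, mink_dη_φ, sub_zero]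

theorem mink_φ_η (p : M) : mink (S.φ p) (S.η p) = 0 := by rw [mink_comm, S.η_tangent]

theorem mink_φ_lightCone (p : M) : mink (S.φ p) (S.lightCone p) = -1 := by
  rw [lightCone, mink_sub_right, (S.φ_mem p).1, mink_φ_η, sub_zero]

theorem mink_dφ_self_pos (p : M) {v : TangentSpace (𝓡 n) p} (hv : v ≠ 0) :
    0 < mink (dmap S.φ p v) (dmap S.φ p v) := by
  refine mink_self_pos_of_orthogonal (S.φ_mem p) (S.mink_dφ_φ p v) fun h => hv ?_
  exact S.φ_immersed.2 p (h.trans (dmap_zero S.φ p).symm)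

/-- A vector orthogonal to the frame `φ`, `η`, `dφ` vanishes. -/
theorem eq_zero_of_orthogonal_frame (p : M) {a : Mink n} (h1 : mink a (S.φ p) = 0)
    (h2 : mink a (S.η p) = 0) (h3 : ∀ w : TangentSpace (𝓡 n) p, mink a (dmap S.φ p w) = 0) :
    a = 0 := by
  let L : (ℝ × ℝ) × EuclideanSpace ℝ (Fin n) →ₗ[ℝ] Mink n :=
    LinearMap.coprod (LinearMap.coprod (LinearMap.toSpanSingleton ℝ _ (S.φ p))
      (LinearMap.toSpanSingleton ℝ _ (S.η p))) (dmapLinear S.φ p)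
  have hL : ∀ r s w, L ((r, s), w) = r • S.φ p + s • S.η p + dmapLinear S.φ p w := by
    intro r s w
    simp [L]
  have hφ : ∀ w, mink (dmapLinear S.φ p w) (S.φ p) = 0 := S.mink_dφ_φ p
  have hη : ∀ w, mink (dmapLinear S.φ p w) (S.η p) = 0 := S.mink_dφ_η p
  have hinj : Function.Injective L := by
    rw [injective_iff_map_eq_zero]
    rintro ⟨⟨r, s⟩, w⟩ h
    rw [hL] at h
    have e1 := congrArg (fun u => mink u (S.φ p)) h
    have e2 := congrArg (fun u => mink u (S.η p)) h
    simp only [mink_add_left, mink_smul_left, (S.φ_mem p).1, S.η_tangent, hφ, mink_φ_η,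
      S.η_unit, hη, mink_zero_left] at e1 e2
    have hr : r = 0 := by linarith
    have hs : s = 0 := by linarith
    subst hr hs
    rw [zero_smul, zero_smul, zero_add, zero_add] at h
    have hw : w = 0 := S.φ_immersed.2 p (Eq.trans h (dmap_zero S.φ p).symm)
    simp [hw]
  -- Source and target both have dimension n + 2, so the independent frame spans and nondegeneracy
  -- applies.
  have hsurj : Function.Surjective L := by
    refine (LinearMap.injective_iff_surjective_of_finrank_eq_finrank ?_).1 hinj
    simp [Module.finrank_prod]
    ring
  refine eq_zero_of_mink_eq_zero fun u => ?_
  obtain ⟨⟨⟨r, s⟩, w⟩, rfl⟩ := hsurj u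
  rw [hL, mink_add_right, mink_add_right, mink_smul_right, mink_smul_right, h1, h2]
  simp only [mul_zero, zero_add]
  exact h3 w

section SecondFundamentalForm

variable [IsManifold (𝓡 n) ∞ M]

/-- The second fundamental form is symmetric. -/
theorem mink_dη_dφ_symm (p : M) (v w : TangentSpace (𝓡 n) p) :
    mink (dmap S.η p v) (dmap S.φ p w) = mink (dmap S.η p w) (dmap S.φ p v) := by
  set x₀ := extChartAt (𝓡 n) p p with hx₀
  let f : EuclideanSpace ℝ (Fin n) → Mink n := S.φ ∘ (extChartAt (𝓡 n) p).symm
  let g : EuclideanSpace ℝ (Fin n) → Mink n := S.η ∘ (extChartAt (𝓡 n) p).symm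
  have hopen : (extChartAt (𝓡 n) p).target ∈ 𝓝 x₀ := extChartAt_target_mem_nhds p
  have hsymm : ContMDiffOn 𝓘(ℝ, EuclideanSpace ℝ (Fin n)) (𝓡 n) ∞ (extChartAt (𝓡 n) p).symm
      (extChartAt (𝓡 n) p).target := contMDiffOn_extChartAt_symm p
  have hf : ContDiffAt ℝ ∞ f x₀ :=
    ((S.φ_smooth.comp_contMDiffOn hsymm).contDiffOn).contDiffAt hopen
  have key : ∀ᶠ x in 𝓝 x₀, ∀ u, mink (g x) (fderiv ℝ f x u) = 0 := by
    filter_upwards [(isOpen_extChartAt_target p).mem_nhds (mem_extChartAt_target p)] with x hx u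
    have h1 : MDifferentiableAt 𝓘(ℝ, EuclideanSpace ℝ (Fin n)) (𝓡 n)
        (extChartAt (𝓡 n) p).symm x :=
      (hsymm.mdifferentiableOn (by simp) x hx).mdifferentiableAt
        ((isOpen_extChartAt_target p).mem_nhds hx)
    have h2 := mfderiv_comp x (S.φ_mdiff ((extChartAt (𝓡 n) p).symm x)) h1
    rw [← mfderiv_eq_fderiv, show f = S.φ ∘ (extChartAt (𝓡 n) p).symm from rfl, h2]
    exact S.η_normal _ _
  have hg : DifferentiableAt ℝ g x₀ := differentiableAt_comp_chart (S.η_mdiff p)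
  have hf' : DifferentiableAt ℝ (fderiv ℝ f) x₀ :=
    (hf.fderiv_right (m := 1) (by norm_cast)).differentiableAt (by simp)
  have hdf : DifferentiableAt ℝ f x₀ := hf.differentiableAt (by simp)
  -- Differentiating ⟨η, ∂_b φ⟩ = 0 in the direction a turns the form into a second derivative of φ,
  -- which is symmetric.
  have main : ∀ a b : EuclideanSpace ℝ (Fin n), mink (fderiv ℝ g x₀ a) (fderiv ℝ f x₀ b) =
      -mink (g x₀) (fderiv ℝ (fderiv ℝ f) x₀ a b) := by
    intro a b
    have hl : HasDerivAt (fun s : ℝ => x₀ + s • a) a 0 := by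
      simpa using ((hasDerivAt_id (0 : ℝ)).smul_const a).const_add x₀
    have e0 : x₀ + (0 : ℝ) • a = x₀ := by simp
    have d1 : HasDerivAt (fun s : ℝ => g (x₀ + s • a)) (fderiv ℝ g x₀ a) 0 :=
      HasFDerivAt.comp_hasDerivAt (0 : ℝ) (by rw [e0]; exact hg.hasFDerivAt) hl
    have d2 : HasDerivAt (fun s : ℝ => fderiv ℝ f (x₀ + s • a)) (fderiv ℝ (fderiv ℝ f) x₀ a) 0 :=
      HasFDerivAt.comp_hasDerivAt (0 : ℝ) (by rw [e0]; exact hf'.hasFDerivAt) hl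
    have d3 := hasDerivAt_mink d1 (d2.clm_apply (hasDerivAt_const 0 b))
    have hev : (fun s : ℝ => mink (g (x₀ + s • a)) (fderiv ℝ f (x₀ + s • a) b)) =ᶠ[𝓝 0]
        fun _ => 0 := by
      have ht : Tendsto (fun s : ℝ => x₀ + s • a) (𝓝 0) (𝓝 x₀) := by
        simpa [e0] using hl.continuousAt.tendsto
      filter_upwards [ht.eventually key] with s hs using hs b
    have := (d3.congr_of_eventuallyEq hev.symm).unique (hasDerivAt_const 0 0)
    simp only [e0, map_zero, add_zero] at this
    linarith
  have hs : IsSymmSndFDerivAt ℝ f x₀ := hf.isSymmSndFDerivAt (by simp; norm_cast)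
  rw [dmap_eq_fderiv (S.η_mdiff p), dmap_eq_fderiv (S.φ_mdiff p), dmap_eq_fderiv (S.η_mdiff p),
    dmap_eq_fderiv (S.φ_mdiff p)]
  refine (main v w).trans (Eq.trans ?_ (main w v).symm)
  exact congrArg (fun u => -mink (g x₀) u) (hs.eq _ _).symm

/-- The second fundamental form is bounded below by any lower bound of the principal
curvatures. -/
theorem le_neg_mink_dη_dφ {κ₀ : ℝ} (p : M) (hκ : ∀ κ, S.IsPrincipalCurvature p κ → κ₀ ≤ κ)
    (v : TangentSpace (𝓡 n) p) :
    κ₀ * mink (dmap S.φ p v) (dmap S.φ p v) ≤ -mink (dmap S.η p v) (dmap S.φ p v) := by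
  let D := dmapLinear (n := n) S.φ p
  let N := dmapLinear (n := n) S.η p
  let g : EuclideanSpace ℝ (Fin n) → ℝ := fun u => mink (D u) (D u)
  let h : EuclideanSpace ℝ (Fin n) → ℝ := fun u => -mink (N u) (D u)
  have hc1 : Continuous D := continuous_dmapLinear S.φ p
  have hc2 : Continuous N := continuous_dmapLinear S.η p
  have hg : Continuous g := by
    simp only [g, mink]
    fun_prop
  have hh : Continuous h := by
    simp only [h, mink]
    fun_prop
  have hgpos : ∀ u, u ≠ 0 → 0 < g u := fun u hu => S.mink_dφ_self_pos p hu
  rcases eq_or_ne v 0 with rfl | hv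
  · change κ₀ * mink (D 0) (D 0) ≤ -mink (N 0) (D 0)
    simp [mink]
  have hcont : ContinuousOn (fun u => h u / g u) (sphere 0 1) :=
    hh.continuousOn.div hg.continuousOn fun u hu => (hgpos u (ne_zero_of_mem_unit_sphere ⟨u, hu⟩)).ne'
  let v' : EuclideanSpace ℝ (Fin n) := v
  have hv' : v' ≠ 0 := hv
  -- Minimise the Rayleigh quotient over the coordinate unit sphere. By homogeneity the minimum μ is
  -- global; it will be a principal curvature, hence at least κ₀.
  obtain ⟨e, he, hmin⟩ := (isCompact_sphere (0 : EuclideanSpace ℝ (Fin n)) 1).exists_isMinOn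
    ⟨‖v'‖⁻¹ • v', by simp [norm_smul, hv']⟩ hcont
  have he0 : e ≠ 0 := ne_zero_of_mem_unit_sphere ⟨e, he⟩
  set μ := h e / g e with hμ
  have hsc : ∀ (r : ℝ) u, g (r • u) = r ^ 2 * g u ∧ h (r • u) = r ^ 2 * h u := by
    intro r u
    have e1 : D (r • u) = r • D u := map_smul _ _ _
    have e2 : N (r • u) = r • N u := map_smul _ _ _
    simp only [g, h, e1, e2, mink_smul_left, mink_smul_right]
    constructor <;> ring
  have hall : ∀ u, μ * g u ≤ h u := by
    intro u
    rcases eq_or_ne u 0 with rfl | hu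
    · have := hsc 0 (0 : EuclideanSpace ℝ (Fin n))
      simp only [smul_zero] at this
      rw [this.1, this.2]; simp
    · have h1 := hmin (show ‖u‖⁻¹ • u ∈ sphere (0 : EuclideanSpace ℝ (Fin n)) 1 by
        simp [norm_smul, hu])
      have hr : (‖u‖⁻¹ : ℝ) ^ 2 ≠ 0 := by positivity
      change h e / g e ≤ h (‖u‖⁻¹ • u) / g (‖u‖⁻¹ • u) at h1
      rw [(hsc _ _).1, (hsc _ _).2, mul_div_mul_left _ _ hr, le_div_iff₀ (hgpos u hu)] at h1
      exact h1
  have heq : h e = μ * g e := by rw [hμ, div_mul_cancel₀ _ (hgpos e he0).ne']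
  -- the minimiser is an eigenvector
  have hDφ : ∀ u, mink (D u) (S.φ p) = 0 := S.mink_dφ_φ p
  have hDη : ∀ u, mink (D u) (S.η p) = 0 := S.mink_dφ_η p
  have hNφ : ∀ u, mink (N u) (S.φ p) = 0 := S.mink_dη_φ p
  have hNη : ∀ u, mink (N u) (S.η p) = 0 := S.mink_dη_η p
  have horth : ∀ w : EuclideanSpace ℝ (Fin n),
      mink (N e + μ • D e) (D w) = 0 := by
    intro w
    set B := mink (N e + μ • D e) (D w)
      with hB
    have hexp : ∀ t : ℝ, 0 ≤ t ^ 2 * (h w - μ * g w) - 2 * t * B := by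
      intro t
      have h1 := hall (e + t • w)
      have e1 : D (e + t • w) =
          D e + t • D w :=
        by rw [map_add, map_smul]
      have e2 : N (e + t • w) =
          N e + t • N w :=
        by rw [map_add, map_smul]
      have hsym : mink (N w) (D e) = mink (N e) (D w) := S.mink_dη_dφ_symm p w e
      simp only [g, h, e1, e2, mink_add_left, mink_add_right, mink_smul_left, mink_smul_right]
        at h1 heq hB ⊢
      rw [mink_comm (D w) (D e), hsym] at h1
      rw [hB]
      linarith
    by_contra hne
    set A := h w - μ * g w
    have hA : 0 ≤ A := sub_nonneg.2 (hall w)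
    -- A nonnegative quadratic in t vanishing at 0 has no linear term. The + 1 in the test value
    -- keeps the denominator positive when A = 0.
    have h1 := hexp (B / (A + 1))
    have h2 : 0 < B ^ 2 := by positivity
    have h3 : (B / (A + 1)) ^ 2 * A - 2 * (B / (A + 1)) * B =
        -(B ^ 2 * (A + 2) / (A + 1) ^ 2) := by field_simp; ring
    rw [h3] at h1
    have : 0 < B ^ 2 * (A + 2) / (A + 1) ^ 2 := by positivity
    linarith
  have hzero := S.eq_zero_of_orthogonal_frame p (a := N e + μ • D e)
    (by rw [mink_add_left, mink_smul_left, hNφ, hDφ]; simp)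
    (by rw [mink_add_left, mink_smul_left, hNη, hDη]; simp) horth
  have hle : κ₀ ≤ μ := hκ μ ⟨e, he0, by rw [neg_smul]; exact eq_neg_of_add_eq_zero_left hzero⟩
  calc κ₀ * g v ≤ μ * g v := by have := hgpos v hv; gcongr
    _ ≤ h v := hall v

variable {κ₀ : ℝ} (hκ₀ : -1 < κ₀) (hκ : ∀ (p : M) (κ : ℝ), S.IsPrincipalCurvature p κ → κ₀ ≤ κ)
include hκ₀ hκ

/-- Pairing dψ with dφ gives ⟨dψ, dφ⟩ = |dφ|² - ⟨dη, dφ⟩ ≥ (1 + κ₀) |dφ|²; Cauchy–Schwarz does the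
rest. No upper curvature bound is needed. -/
theorem norm_dφ_le (p : M) (v : TangentSpace (𝓡 n) p) :
    √(mink (dmap S.φ p v) (dmap S.φ p v)) ≤
      (1 + κ₀)⁻¹ * √(mink (dmap S.lightCone p v) (dmap S.lightCone p v)) := by
  have h1 := S.le_neg_mink_dη_dφ p (hκ p) v
  have h2 := (abs_le.1 (abs_mink_le_of_orthogonal (S.φ_mem p) (S.mink_dlightCone_φ p v)
    (S.mink_dφ_φ p v))).2
  have h3 : mink (dmap S.lightCone p v) (dmap S.φ p v) =
      mink (dmap S.φ p v) (dmap S.φ p v) - mink (dmap S.η p v) (dmap S.φ p v) := by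
    rw [dmap_lightCone, mink_sub_left]
  have h4 := Real.sq_sqrt (mink_self_nonneg_of_orthogonal (S.φ_mem p) (S.mink_dφ_φ p v))
  have hpos : 0 < 1 + κ₀ := by linarith
  rw [inv_mul_eq_div, le_div_iff₀ hpos]
  set a := √(mink (dmap S.φ p v) (dmap S.φ p v))
  set b := √(mink (dmap S.lightCone p v) (dmap S.lightCone p v))
  rcases (Real.sqrt_nonneg _ : 0 ≤ a).eq_or_lt with h0 | h0
  · have hb : 0 ≤ b := Real.sqrt_nonneg _
    have ha : a = 0 := h0.symm
    rw [ha, zero_mul]; exact hb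
  · refine le_of_mul_le_mul_right ?_ h0
    nlinarith

/-- Follows from φ + η = 2φ - ψ: the opposite light cone map is controlled by ψ as well, which is
what the drift estimate uses. -/
theorem norm_dφ_add_dη_le (p : M) (v : TangentSpace (𝓡 n) p) :
    √(mink (dmap S.φ p v + dmap S.η p v) (dmap S.φ p v + dmap S.η p v)) ≤
      (2 * (1 + κ₀)⁻¹ + 1) * √(mink (dmap S.lightCone p v) (dmap S.lightCone p v)) := by
  have e : dmap S.φ p v + dmap S.η p v = (2 : ℝ) • dmap S.φ p v + (-1 : ℝ) • dmap S.lightCone p v := by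
    rw [dmap_lightCone, two_smul, neg_one_smul]; abel
  have h := sqrt_mink_add_le (S.φ_mem p) (a := (2 : ℝ) • dmap S.φ p v)
    (a' := (-1 : ℝ) • dmap S.lightCone p v)
    (by rw [mink_smul_left, mink_dφ_φ, mul_zero])
    (by rw [mink_smul_left, mink_dlightCone_φ, mul_zero])
  rw [← e, sqrt_mink_smul, sqrt_mink_smul] at h
  have h2 := S.norm_dφ_le hκ₀ hκ p v
  norm_num at h
  linarith

end SecondFundamentalForm

end OrientedHypersurface

end HypSurf

/-! ### The inverse function theorem and the local geometry of the Gauss map -/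

namespace HypSurf

/-- The inverse function theorem on manifolds. -/
theorem exists_openPartialHomeomorph_of_injective_mfderiv {n : ℕ} {M N : Type*}
    [TopologicalSpace M] [ChartedSpace (EuclideanSpace ℝ (Fin n)) M] [IsManifold (𝓡 n) ∞ M]
    [TopologicalSpace N] [ChartedSpace (EuclideanSpace ℝ (Fin n)) N] [IsManifold (𝓡 n) ∞ N]
    {f : M → N} (hf : ContMDiff (𝓡 n) (𝓡 n) ∞ f) (p : M)
    (hinj : Function.Injective (mfderiv (𝓡 n) (𝓡 n) f p)) :
    ∃ e : OpenPartialHomeomorph M N, p ∈ e.source ∧ EqOn e f e.source ∧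
      ContMDiffAt (𝓡 n) (𝓡 n) ∞ e.symm (f p) := by
  set F := extChartAt (𝓡 n) (f p) ∘ f ∘ (extChartAt (𝓡 n) p).symm with hF
  set x₀ := extChartAt (𝓡 n) p p with hx₀
  have hFs : ContDiffAt ℝ ∞ F x₀ := by
    have := (contMDiffAt_iff.1 (hf p)).2
    rwa [ModelWithCorners.range_eq_univ, contDiffWithinAt_univ] at this
  have hmd : MDifferentiableAt (𝓡 n) (𝓡 n) f p := hf.mdifferentiable (by simp) p
  have hfd : fderiv ℝ F x₀ = mfderiv (𝓡 n) (𝓡 n) f p := by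
    simp only [mfderiv, hmd, writtenInExtChartAt, ModelWithCorners.range_eq_univ,
      fderivWithin_univ]
    rfl
  let A : EuclideanSpace ℝ (Fin n) →L[ℝ] EuclideanSpace ℝ (Fin n) := fderiv ℝ F x₀
  have hA : Function.Injective A.toLinearMap := by
    intro v w h
    exact hinj (by rw [← hfd]; exact h)
  let A' : EuclideanSpace ℝ (Fin n) ≃L[ℝ] EuclideanSpace ℝ (Fin n) :=
    (LinearEquiv.ofInjectiveEndo A.toLinearMap hA).toContinuousLinearEquiv
  have hA' : HasFDerivAt F (A' : EuclideanSpace ℝ (Fin n) →L[ℝ] EuclideanSpace ℝ (Fin n)) x₀ := by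
    have h1 : (A' : EuclideanSpace ℝ (Fin n) →L[ℝ] EuclideanSpace ℝ (Fin n)) = A := by
      ext v
      rfl
    rw [h1]
    exact (hFs.differentiableAt (by simp)).hasFDerivAt
  have hn0 : (∞ : WithTop ℕ∞) ≠ 0 := by simp
  let Φ := hFs.toOpenPartialHomeomorph F hA' hn0
  let E := EuclideanSpace ℝ (Fin n)
  let e₁ := chartAt E p
  let e₂ := chartAt E (f p)
  have hopen : IsOpen (f ⁻¹' e₂.source) := e₂.open_source.preimage hf.continuous
  have hFx : F x₀ = e₂ (f p) := by
    simp [F, x₀, e₂]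
  -- The coordinate expression represents f only where f lands in the chart at f(p), hence the
  -- restriction to that preimage.
  refine ⟨(e₁.trans (Φ.trans e₂.symm)).restrOpen _ hopen, ?_, ?_, ?_⟩
  · refine ⟨⟨mem_chart_source E p, ?_, ?_⟩, mem_chart_source E (f p)⟩
    · exact hFs.mem_toOpenPartialHomeomorph_source hA' hn0
    · change F x₀ ∈ e₂.target
      rw [hFx]
      exact e₂.map_source (mem_chart_source E (f p))
  · rintro q ⟨⟨hq1, hq2⟩, hq3⟩
    change e₂.symm (F (e₁ q)) = f q
    have h1 : F (e₁ q) = e₂ (f q) := by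
      have : e₁.symm (e₁ q) = q := e₁.left_inv hq1
      change e₂ (f (e₁.symm (e₁ q))) = _
      rw [this]
    rw [h1]
    exact e₂.left_inv hq3
  · change ContMDiffAt (𝓡 n) (𝓡 n) ∞ (fun y => e₁.symm (Φ.symm (e₂ y))) (f p)
    have h1 : ContMDiffAt (𝓡 n) (𝓡 n) ∞ e₂ (f p) :=
      (contMDiffOn_chart (f p) (mem_chart_source E (f p))).contMDiffAt
        (e₂.open_source.mem_nhds (mem_chart_source E (f p)))
    have h2 : ContDiffAt ℝ ∞ Φ.symm (e₂ (f p)) := by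
      rw [← hFx]
      exact hFs.to_localInverse hA' hn0
    have h3 : Φ.symm (e₂ (f p)) = e₁ p := by
      rw [← hFx]
      exact Φ.left_inv (hFs.mem_toOpenPartialHomeomorph_source hA' hn0)
    have h4 : ContMDiffAt (𝓡 n) (𝓡 n) ∞ e₁.symm (Φ.symm (e₂ (f p))) := by
      rw [h3]
      exact (contMDiffOn_chart_symm (e₁ p) (e₁.map_source (mem_chart_source E p))).contMDiffAt
        (e₁.open_target.mem_nhds (e₁.map_source (mem_chart_source E p)))
    exact h4.comp (f p) (h2.contMDiffAt.comp (f p) h1)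

namespace OrientedHypersurface

variable {n : ℕ} {M : Type*} [TopologicalSpace M] [ChartedSpace (EuclideanSpace ℝ (Fin n)) M]
  (S : OrientedHypersurface n M)

/-- The Gauss map as a map to `ℝⁿ⁺¹`. -/
noncomputable abbrev gaussVec (p : M) : Euc n := (S.gauss p : Euc n)

theorem gaussVec_eq (p : M) : S.gaussVec p = (S.lightCone p).1⁻¹ • (S.lightCone p).2 := rfl

theorem norm_gaussVec (p : M) : ‖S.gaussVec p‖ = 1 := norm_eq_of_mem_sphere (S.gauss p)

theorem lightCone_eq (p : M) : S.lightCone p = (S.lightCone p).1 • ((1 : ℝ), S.gaussVec p) := by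
  refine Prod.ext (by simp) ?_
  rw [gaussVec_eq, Prod.smul_snd, smul_inv_smul₀ (S.lightCone_pos p).ne']

theorem exp_support (p : M) : Real.exp (S.support p) = (S.lightCone p).1 :=
  Real.exp_log (S.lightCone_pos p)

theorem lightCone_fst_smooth : ContMDiff (𝓡 n) 𝓘(ℝ, ℝ) ∞ fun p => (S.lightCone p).1 :=
  (contDiff_fst (𝕜 := ℝ)).contMDiff.comp S.lightCone_smooth

theorem gaussVec_smooth : ContMDiff (𝓡 n) 𝓘(ℝ, Euc n) ∞ S.gaussVec := by
  have h1 : ContMDiff (𝓡 n) 𝓘(ℝ, ℝ) ∞ fun p => (S.lightCone p).1⁻¹ :=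
    fun p => ((contDiffAt_inv ℝ (S.lightCone_pos p).ne').contMDiffAt).comp p
      (S.lightCone_fst_smooth p)
  exact h1.smul ((contDiff_snd (𝕜 := ℝ)).contMDiff.comp S.lightCone_smooth)

theorem support_smooth : ContMDiff (𝓡 n) 𝓘(ℝ, ℝ) ∞ S.support :=
  fun p => ((Real.contDiffAt_log.2 (S.lightCone_pos p).ne').contMDiffAt).comp p
    (S.lightCone_fst_smooth p)

theorem gaussVec_mdiff (p : M) : MDifferentiableAt (𝓡 n) 𝓘(ℝ, Euc n) S.gaussVec p :=
  S.gaussVec_smooth.mdifferentiable (by simp) p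

theorem support_mdiff (p : M) : MDifferentiableAt (𝓡 n) 𝓘(ℝ, ℝ) S.support p :=
  S.support_smooth.mdifferentiable (by simp) p

/-- The product rule for ψ = e^ρ̃ (1, G): a multiple of the null vector ψ plus a purely spatial
part. -/
theorem dmap_lightCone_eq (p : M) (v : TangentSpace (𝓡 n) p) :
    dmap S.lightCone p v = dmap S.support p v • S.lightCone p +
      (S.lightCone p).1 • ((0 : ℝ), dmap S.gaussVec p v) := by
  have h1 : HasDerivAt (fun s => (S.lightCone (chartCurve p v s)).1)
      (Real.exp (S.support (chartCurve p v 0)) * dmap S.support p v) 0 := by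
    simpa only [exp_support] using (hasDerivAt_chartCurve (S.support_mdiff p) v).exp
  have h2 := hasDerivAt_chartCurve (S.gaussVec_mdiff p) v
  have h3 := h1.smul ((hasDerivAt_const (0 : ℝ) (1 : ℝ)).prodMk h2)
  have e : chartCurve p v 0 = p := chartCurve_zero p v
  refine (dmap_eq_of_hasDerivAt (S.lightCone_mdiff p) (h3.congr_of_eventuallyEq
    (Eventually.of_forall fun s => S.lightCone_eq _))).trans ?_
  rw [e, add_comm, exp_support, mul_comm, mul_smul]
  congr 2
  exact (S.lightCone_eq p).symm

/-- From ⟨φ, dψ⟩ = 0 and ⟨φ, ψ⟩ = -1. It recovers the component of φ tangent to the sphere from the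
gradient of the support function. -/
theorem mink_φ_dmap_gaussVec (p : M) (v : TangentSpace (𝓡 n) p) :
    (S.lightCone p).1 * inner ℝ (S.φ p).2 (dmap S.gaussVec p v) = dmap S.support p v := by
  have h := S.mink_dlightCone_φ p v
  rw [mink_comm, dmap_lightCone_eq, mink_add_right, mink_smul_right, mink_smul_right,
    mink_φ_lightCone] at h
  simp only [mink] at h
  linarith

theorem inner_gaussVec_dmap (p : M) (v : TangentSpace (𝓡 n) p) :
    inner ℝ (S.gaussVec p) (dmap S.gaussVec p v) = 0 := by
  have h2 := hasDerivAt_chartCurve (S.gaussVec_mdiff p) v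
  have h3 := h2.inner ℝ h2
  have e : chartCurve p v 0 = p := chartCurve_zero p v
  simp only [real_inner_self_eq_norm_sq, norm_gaussVec] at h3
  have := h3.unique (hasDerivAt_const _ _)
  rw [e, real_inner_comm (S.gaussVec p)] at this
  linarith

/-- The horospherical metric is the pullback of `e^{2ρ} g` under the Gauss map. -/
theorem mink_dlightCone (p : M) (v w : TangentSpace (𝓡 n) p) :
    mink (dmap S.lightCone p v) (dmap S.lightCone p w) =
      (S.lightCone p).1 ^ 2 * inner ℝ (dmap S.gaussVec p v) (dmap S.gaussVec p w) := by
  have h1 : ∀ u : TangentSpace (𝓡 n) p,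
      mink (S.lightCone p) ((0 : ℝ), dmap S.gaussVec p u) = 0 := by
    intro u
    rw [lightCone_eq, mink_smul_left]
    simp only [mink, inner_gaussVec_dmap]
    simp
  rw [dmap_lightCone_eq, dmap_lightCone_eq]
  simp only [mink_add_left, mink_add_right, mink_smul_left, mink_smul_right, S.lightCone_null,
    h1, mink_comm _ (S.lightCone p)]
  simp only [mink]
  ring

theorem sqrt_mink_dlightCone (p : M) (v : TangentSpace (𝓡 n) p) :
    √(mink (dmap S.lightCone p v) (dmap S.lightCone p v)) =
      (S.lightCone p).1 * ‖dmap S.gaussVec p v‖ := by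
  rw [mink_dlightCone, real_inner_self_eq_norm_sq, ← mul_pow,
    Real.sqrt_sq (mul_nonneg (S.lightCone_pos p).le (norm_nonneg _))]

theorem one_le_φ_fst (p : M) : 1 ≤ (S.φ p).1 := one_le_of_mem_hyperboloid (S.φ_mem p)

/-- `e^{ρ} (φ₀ - ⟨φ', G⟩) = 1`. -/
theorem lightCone_fst_mul (p : M) :
    (S.lightCone p).1 * ((S.φ p).1 - inner ℝ (S.φ p).2 (S.gaussVec p)) = 1 := by
  have h := S.mink_φ_lightCone p
  rw [lightCone_eq, mink_smul_right] at h
  simp only [mink] at h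
  linarith

/-- By `lightCone_fst_mul` and |G| = 1, ψ₀⁻¹ ≥ φ₀ - |φ'|, and this is (φ₀ + |φ'|)⁻¹ ≥ (2φ₀)⁻¹. -/
theorem lightCone_fst_le (p : M) : (S.lightCone p).1 ≤ 2 * (S.φ p).1 := by
  have h := S.lightCone_fst_mul p
  have h1 := norm_snd_sq_of_mem_hyperboloid (S.φ_mem p)
  have h2 := norm_snd_lt_of_mem_hyperboloid (S.φ_mem p)
  have h3 := (abs_le.1 (abs_real_inner_le_norm (S.φ p).2 (S.gaussVec p))).2
  rw [norm_gaussVec, mul_one] at h3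
  have h4 := S.lightCone_pos p
  set a := (S.lightCone p).1
  set b := (S.φ p).1
  set c := ‖(S.φ p).2‖
  have hc : 0 ≤ c := norm_nonneg _
  have h5 : a * (b - c) ≤ 1 := by rw [← h]; gcongr
  have h6 : (b - c) * (b + c) = 1 := by linarith
  nlinarith

/-- The Euclidean distance between the image in the ball and the Gauss map. -/
theorem norm_toBall_sub_gauss_sq_le (p : M) :
    ‖toBall (S.φ p) - S.gaussVec p‖ ^ 2 ≤ 2 * (S.lightCone p).1⁻¹ := by
  have h := S.lightCone_fst_mul p
  have h1 := norm_snd_sq_of_mem_hyperboloid (S.φ_mem p)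
  have h0 := S.one_le_φ_fst p
  have h4 := S.lightCone_pos p
  have h5 : inner ℝ (S.φ p).2 (S.gaussVec p) = (S.φ p).1 - (S.lightCone p).1⁻¹ := by
    field_simp
    linarith
  have h6 : toBall (S.φ p) - S.gaussVec p =
      (1 + (S.φ p).1)⁻¹ • ((S.φ p).2 - (1 + (S.φ p).1) • S.gaussVec p) := by
    rw [smul_sub, inv_smul_smul₀ (by positivity)]
    rfl
  rw [h6, norm_smul, mul_pow, norm_sub_sq_real, norm_smul, norm_gaussVec, real_inner_smul_right,
    h5, h1, norm_inv, Real.norm_of_nonneg (by positivity)]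
  have hb : 0 < 1 + (S.φ p).1 := by positivity
  -- The squared distance is exactly 2ψ₀⁻¹ / (1 + φ₀); the stated bound drops the denominator.
  have e : ((1 + (S.φ p).1)⁻¹) ^ 2 * ((S.φ p).1 ^ 2 - 1 -
      2 * ((1 + (S.φ p).1) * ((S.φ p).1 - (S.lightCone p).1⁻¹)) + ((1 + (S.φ p).1) * 1) ^ 2) =
      (2 * (S.lightCone p).1⁻¹) / (1 + (S.φ p).1) := by
    field_simp
    ring
  rw [e]
  exact div_le_self (by positivity) (by linarith)

variable [IsManifold (𝓡 n) ∞ M]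

theorem gauss_smooth : ContMDiff (𝓡 n) (𝓡 n) ∞ S.gauss :=
  haveI := Fact.mk (@finrank_euclideanSpace_fin ℝ _ (n + 1))
  S.gaussVec_smooth.codRestrict_sphere fun p => (S.gauss p).2

theorem gauss_continuous : Continuous S.gauss := S.gauss_smooth.continuous

theorem dmap_gaussVec (p : M) (v : TangentSpace (𝓡 n) p) : dmap S.gaussVec p v =
    mfderiv (𝓡 n) 𝓘(ℝ, Euc n) (fun y : Sph n => (y : Euc n)) (S.gauss p)
      (mfderiv (𝓡 n) (𝓡 n) S.gauss p v) := by
  have h1 : MDifferentiableAt (𝓡 n) 𝓘(ℝ, Euc n) (fun y : Sph n => (y : Euc n)) (S.gauss p) :=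
    haveI := Fact.mk (@finrank_euclideanSpace_fin ℝ _ (n + 1))
    (contMDiff_coe_sphere (m := 1) _).mdifferentiableAt (by simp)
  have h2 : MDifferentiableAt (𝓡 n) (𝓡 n) S.gauss p := S.gauss_smooth.mdifferentiable (by simp) p
  exact congrArg (fun L => L v) (mfderiv_comp p h1 h2)

section Convex

variable {κ₀ : ℝ} (hκ₀ : -1 < κ₀) (hκ : ∀ (p : M) (κ : ℝ), S.IsPrincipalCurvature p κ → κ₀ ≤ κ)
include hκ₀ hκ

theorem norm_dφ_le_gauss (p : M) (v : TangentSpace (𝓡 n) p) :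
    √(mink (dmap S.φ p v) (dmap S.φ p v)) ≤
      (1 + κ₀)⁻¹ * ((S.lightCone p).1 * ‖dmap S.gaussVec p v‖) := by
  rw [← sqrt_mink_dlightCone]
  exact S.norm_dφ_le hκ₀ hκ p v

/-- If dG(v) = 0, the basic inequality forces dφ(v) = 0, against the immersion property. -/
theorem dmap_gaussVec_injective (p : M) : Function.Injective (dmapLinear (n := n) S.gaussVec p) := by
  rw [injective_iff_map_eq_zero]
  intro v hv
  have h1 : dmap (n := n) S.gaussVec p v = 0 := hv
  have h2 := S.norm_dφ_le_gauss hκ₀ hκ p v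
  rw [h1, norm_zero, mul_zero, mul_zero] at h2
  by_contra hne
  exact absurd (Real.sqrt_pos.2 (S.mink_dφ_self_pos p hne)) (not_lt.2 h2)

theorem exists_local_inverse (p : M) :
    ∃ e : OpenPartialHomeomorph M (Sph n), p ∈ e.source ∧ EqOn e S.gauss e.source ∧
      ContMDiffAt (𝓡 n) (𝓡 n) ∞ e.symm (S.gauss p) := by
  refine exists_openPartialHomeomorph_of_injective_mfderiv S.gauss_smooth p fun v w h => ?_
  refine S.dmap_gaussVec_injective hκ₀ hκ p ?_
  change dmap S.gaussVec p v = dmap S.gaussVec p w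
  rw [dmap_gaussVec, dmap_gaussVec, h]

theorem gauss_isLocalHomeomorph : IsLocalHomeomorph S.gauss :=
  IsLocalHomeomorph.mk _ fun p => by
    obtain ⟨e, h1, h2, -⟩ := S.exists_local_inverse hκ₀ hκ p
    exact ⟨e, h1, h2.symm⟩

/-- A continuous lift of a smooth map through the Gauss map is smooth. -/
theorem contMDiffAt_lift {E' H' N : Type*} [NormedAddCommGroup E'] [NormedSpace ℝ E']
    [TopologicalSpace H'] {I' : ModelWithCorners ℝ E' H'} [TopologicalSpace N] [ChartedSpace H' N]
    {k : WithTop ℕ∞} (hk : k ≤ (∞ : WithTop ℕ∞)) {γ : N → M} {t : N} (hγ : ContinuousAt γ t)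
    (h : ContMDiffAt I' (𝓡 n) k (fun s => S.gauss (γ s)) t) : ContMDiffAt I' (𝓡 n) k γ t := by
  obtain ⟨e, h1, h2, h3⟩ := S.exists_local_inverse hκ₀ hκ (γ t)
  refine ((h3.of_le hk).comp t h).congr_of_eventuallyEq ?_
  filter_upwards [hγ.eventually (e.open_source.mem_nhds h1)] with s hs
  simp only [Function.comp_apply]
  rw [← h2 hs, e.left_inv hs]

end Convex

end OrientedHypersurface

end HypSurf

/-! ### Lifting paths through the Gauss map -/

namespace HypSurf
namespace OrientedHypersurface

variable {n : ℕ} {M : Type*} [TopologicalSpace M] [ChartedSpace (EuclideanSpace ℝ (Fin n)) M]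
  (S : OrientedHypersurface n M)

/-- A limit of the Gauss map along which the support function blows up is an ideal boundary
point. -/
theorem mem_idealBoundary_of_tendsto {u : ℕ → M} {y : Sph n}
    (h1 : Tendsto (fun k => (S.lightCone (u k)).1) atTop atTop)
    (h2 : Tendsto (fun k => S.gauss (u k)) atTop (𝓝 y)) : y ∈ S.idealBoundary := by
  have h3 : Tendsto (fun k => S.gaussVec (u k)) atTop (𝓝 (y : Euc n)) :=
    (continuous_subtype_val.tendsto y).comp h2
  have h4 : Tendsto (fun k => toBall (S.φ (u k)) - S.gaussVec (u k)) atTop (𝓝 0) := by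
    rw [tendsto_zero_iff_norm_tendsto_zero]
    have h5 : Tendsto (fun k => √(2 * (S.lightCone (u k)).1⁻¹)) atTop (𝓝 0) := by
      have := (tendsto_inv_atTop_zero.comp h1).const_mul 2
      rw [mul_zero] at this
      simpa using this.sqrt
    refine squeeze_zero (fun _ => norm_nonneg _) (fun k => ?_) h5
    exact Real.le_sqrt_of_sq_le (S.norm_toBall_sub_gauss_sq_le (u k))
  have h6 := h4.add h3
  simp only [sub_add_cancel, zero_add] at h6
  exact mem_closure_of_tendsto h6 (Eventually.of_forall fun k => ⟨u k, rfl⟩)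

/-- The support function is bounded over compact sets that miss the ideal boundary. -/
theorem exists_lightCone_fst_le {x : Sph n} (hx : S.idealBoundary = {x}) {K : Set (Sph n)}
    (hK : IsCompact K) (hxK : x ∉ K) : ∃ B : ℝ, ∀ p, S.gauss p ∈ K → (S.lightCone p).1 ≤ B := by
  by_contra! h
  choose u hu hu' using fun k : ℕ => h k
  obtain ⟨y, hy, σ, hσ, hlim⟩ := hK.tendsto_subseq hu
  have h1 : Tendsto (fun k => (S.lightCone (u (σ k))).1) atTop atTop :=
    tendsto_atTop_mono (fun k => (hu' (σ k)).le) (tendsto_natCast_atTop_atTop.comp hσ.tendsto_atTop)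
  have h2 := S.mem_idealBoundary_of_tendsto h1 hlim
  rw [hx, mem_singleton_iff] at h2
  exact hxK (h2 ▸ hy)

theorem hasDerivAt_comp_curve {F : Type*} [NormedAddCommGroup F] [NormedSpace ℝ F] {f : M → F}
    {γ : ℝ → M} {t : ℝ} (hf : MDifferentiableAt (𝓡 n) 𝓘(ℝ, F) f (γ t))
    (hγ : MDifferentiableAt 𝓘(ℝ, ℝ) (𝓡 n) γ t) :
    HasDerivAt (fun s => f (γ s)) (dmap f (γ t) (mfderiv 𝓘(ℝ, ℝ) (𝓡 n) γ t (1 : ℝ))) t := by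
  have h := hf.hasMFDerivAt.comp t hγ.hasMFDerivAt
  let L : ℝ →L[ℝ] F := (mfderiv (𝓡 n) 𝓘(ℝ, F) f (γ t)).comp (mfderiv 𝓘(ℝ, ℝ) (𝓡 n) γ t)
  have h1 : HasFDerivAt (fun s => f (γ s)) L t := hasMFDerivAt_iff_hasFDerivAt.1 h
  exact h1.hasDerivAt

section Length

/-- Reparametrise affinely to [0, 1]. The unordered interval covers both orders of s and t, as the
Cauchy criterion requires. -/
theorem lengthDist_le {γ : ℝ → M} {s t K : ℝ}
    (hγ : ∀ τ ∈ uIcc s t, ContMDiffAt 𝓘(ℝ, ℝ) (𝓡 n) 1 γ τ)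
    (hK : ∀ τ ∈ uIcc s t, √(mink (dmap S.φ (γ τ) (mfderiv 𝓘(ℝ, ℝ) (𝓡 n) γ τ (1 : ℝ)))
      (dmap S.φ (γ τ) (mfderiv 𝓘(ℝ, ℝ) (𝓡 n) γ τ (1 : ℝ)))) ≤ K) :
    lengthDist (𝓡 n) univ S.inducedNorm (γ s) (γ t) ≤ ENNReal.ofReal (|t - s| * K) := by
  let σ : ℝ → ℝ := fun τ => s + τ * (t - s)
  have hσ : ∀ τ, HasDerivAt σ (t - s) τ := fun τ =>
    (((hasDerivAt_id τ).mul_const (t - s)).const_add s).congr_deriv (by simp)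
  have hσm : ∀ τ ∈ Icc (0 : ℝ) 1, σ τ ∈ uIcc s t := by
    intro τ hτ
    rw [mem_uIcc]
    simp only [σ]
    rcases le_total s t with h | h
    · left; constructor <;> nlinarith [hτ.1, hτ.2]
    · right; constructor <;> nlinarith [hτ.1, hτ.2]
  have hσs : ∀ τ, ContMDiffAt 𝓘(ℝ, ℝ) 𝓘(ℝ, ℝ) 1 σ τ := fun τ => by
    have : ContDiff ℝ 1 σ := by fun_prop
    exact this.contMDiff τ
  have hcomp : ∀ τ ∈ Icc (0 : ℝ) 1, ContMDiffAt 𝓘(ℝ, ℝ) (𝓡 n) 1 (γ ∘ σ) τ :=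
    fun τ hτ => (hγ _ (hσm τ hτ)).comp τ (hσs τ)
  have h0 : (γ ∘ σ) 0 = γ s := by simp [σ]
  have h1 : (γ ∘ σ) 1 = γ t := by simp [σ]
  refine (iInf₂_le_of_le (γ ∘ σ) (fun τ hτ => (hcomp τ hτ).contMDiffWithinAt) <|
    iInf₂_le_of_le (fun _ _ => mem_univ _) h0 <| iInf_le_of_le h1 le_rfl).trans ?_
  let _ : ∀ p : M, ENorm (TangentSpace (𝓡 n) p) := fun p => ⟨S.inducedNorm p⟩
  change Manifold.pathELength (𝓡 n) (γ ∘ σ) 0 1 ≤ _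
  rw [Manifold.pathELength_eq_lintegral_mfderiv_Icc]
  have hbound : ∀ τ ∈ Icc (0 : ℝ) 1,
      S.inducedNorm ((γ ∘ σ) τ) (mfderiv 𝓘(ℝ, ℝ) (𝓡 n) (γ ∘ σ) τ (1 : ℝ)) ≤
        ENNReal.ofReal (|t - s| * K) := by
    intro τ hτ
    refine ENNReal.ofReal_le_ofReal ?_
    have d1 := hasDerivAt_comp_curve (S.φ_mdiff _) ((hcomp τ hτ).mdifferentiableAt (by simp))
    have d2 := (hasDerivAt_comp_curve (S.φ_mdiff _)
      ((hγ _ (hσm τ hτ)).mdifferentiableAt (by simp))).scomp τ (hσ τ)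
    rw [d1.unique d2, sqrt_mink_smul]
    exact mul_le_mul_of_nonneg_left (hK _ (hσm τ hτ)) (abs_nonneg _)
  refine (MeasureTheory.setLIntegral_mono measurable_const hbound).trans ?_
  simp

variable [IsManifold (𝓡 n) ∞ M] {κ₀ : ℝ} (hκ₀ : -1 < κ₀) (hκ : ∀ (p : M) (κ : ℝ), S.IsPrincipalCurvature p κ → κ₀ ≤ κ)
include hκ₀ hκ

/-- In a complete hypersurface, a curve over a path of finite length along which the support
function is bounded converges. -/
theorem exists_tendsto_of_lift (hcomplete : S.IsComplete) {a b : ℝ} (hab : a < b) {γ : ℝ → M}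
    {c : ℝ → Sph n} (hγ : ∀ s ∈ Ioo a b, ContinuousAt γ s)
    (hc : ∀ s ∈ Ioo a b, ContMDiffAt 𝓘(ℝ, ℝ) (𝓡 n) 1 c s) (hcb : ContinuousAt c b)
    (hlift : ∀ s ∈ Ioo a b, S.gauss (γ s) = c s) {K B : ℝ}
    (hK : ∀ s ∈ Ioo a b, ‖deriv (fun τ => (c τ : Euc n)) s‖ ≤ K)
    (hB : ∀ s ∈ Ioo a b, (S.lightCone (γ s)).1 ≤ B) :
    ∃ (p : M) (u : ℕ → ℝ), (∀ k, u k ∈ Ioo a b) ∧ Tendsto u atTop (𝓝 b) ∧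
      Tendsto (fun k => γ (u k)) atTop (𝓝 p) ∧ S.gauss p = c b := by
  let u : ℕ → ℝ := fun k => b - (b - a) * ((1 / 2) ^ (k + 1))
  have hba : 0 < b - a := sub_pos.2 hab
  have hu : ∀ k, u k ∈ Ioo a b := by
    intro k
    have h1 : ((1 : ℝ) / 2) ^ (k + 1) < 1 := pow_lt_one₀ (by norm_num) (by norm_num) (by simp)
    have h2 : (0 : ℝ) < (1 / 2) ^ (k + 1) := by positivity
    constructor <;> simp only [u] <;> nlinarith
  have hulim : Tendsto u atTop (𝓝 b) := by
    have h1 : Tendsto (fun k : ℕ => ((1 : ℝ) / 2) ^ (k + 1)) atTop (𝓝 0) :=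
      (tendsto_pow_atTop_nhds_zero_of_lt_one (by norm_num) (by norm_num)).comp
        (tendsto_add_atTop_nat 1)
    simpa [u] using (h1.const_mul (b - a)).const_sub b
  have hev : ∀ s ∈ Ioo a b, (fun τ => S.gauss (γ τ)) =ᶠ[𝓝 s] c := fun s hs => by
    filter_upwards [isOpen_Ioo.mem_nhds hs] with τ hτ using hlift τ hτ
  have hsm : ∀ s ∈ Ioo a b, ContMDiffAt 𝓘(ℝ, ℝ) (𝓡 n) 1 γ s := fun s hs =>
    S.contMDiffAt_lift hκ₀ hκ (by norm_cast) (hγ s hs)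
      ((hc s hs).congr_of_eventuallyEq (hev s hs))
  have hC : 0 ≤ (1 + κ₀)⁻¹ := inv_nonneg.2 (by linarith)
  set L := (1 + κ₀)⁻¹ * (B * K)
  -- The lift has speed at most (1 + κ₀)⁻¹ ψ₀ |c'| ≤ L, so it is Lipschitz for the induced distance
  -- and its values along any sequence tending to b are Cauchy.
  have hspeed : ∀ s ∈ Ioo a b, √(mink (dmap S.φ (γ s) (mfderiv 𝓘(ℝ, ℝ) (𝓡 n) γ s (1 : ℝ)))
      (dmap S.φ (γ s) (mfderiv 𝓘(ℝ, ℝ) (𝓡 n) γ s (1 : ℝ)))) ≤ L := by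
    intro s hs
    refine (S.norm_dφ_le_gauss hκ₀ hκ _ _).trans ?_
    have h1 := hasDerivAt_comp_curve (S.gaussVec_mdiff (γ s))
      ((hsm s hs).mdifferentiableAt (by simp))
    have h2 : (fun τ => (c τ : Euc n)) =ᶠ[𝓝 s] fun τ => S.gaussVec (γ τ) :=
      (hev s hs).symm.fun_comp Subtype.val
    have h3 := hK s hs
    rw [h2.deriv_eq, h1.deriv] at h3
    have h4 := hB s hs
    have h5 := (S.lightCone_pos (γ s)).le
    exact mul_le_mul_of_nonneg_left (mul_le_mul h4 h3 (norm_nonneg _) (h5.trans h4)) hC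
  have hdist : ∀ i j, lengthDist (𝓡 n) univ S.inducedNorm (γ (u i)) (γ (u j)) ≤
      ENNReal.ofReal (|u j - u i| * L) := fun i j =>
    S.lengthDist_le (fun τ hτ => hsm τ (ordConnected_Ioo.uIcc_subset (hu i) (hu j) hτ))
      (fun τ hτ => hspeed τ (ordConnected_Ioo.uIcc_subset (hu i) (hu j) hτ))
  obtain ⟨p, -, hp⟩ := hcomplete (fun k => γ (u k)) (fun _ => mem_univ _) (by
    intro ε hε
    have h1 : Tendsto (fun q : ℕ × ℕ => ENNReal.ofReal (|u q.2 - u q.1| * L))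
        (atTop ×ˢ atTop) (𝓝 (ENNReal.ofReal (|b - b| * L))) :=
      ENNReal.tendsto_ofReal ((((hulim.comp tendsto_snd).sub (hulim.comp tendsto_fst)).abs).mul_const L)
    have h2 := h1.eventually (gt_mem_nhds (by simpa using hε))
    rw [prod_atTop_atTop_eq, eventually_atTop] at h2
    obtain ⟨⟨k1, k2⟩, hk⟩ := h2
    refine ⟨max k1 k2, fun i hi j hj => (hdist i j).trans_lt (hk (i, j) ⟨?_, ?_⟩)⟩
    · exact (le_max_left _ _).trans hi
    · exact (le_max_right _ _).trans hj)
  refine ⟨p, u, hu, hulim, hp, ?_⟩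
  have h1 : Tendsto (fun k => S.gauss (γ (u k))) atTop (𝓝 (S.gauss p)) :=
    (S.gauss_continuous.tendsto p).comp hp
  have h2 : Tendsto (fun k => S.gauss (γ (u k))) atTop (𝓝 (c b)) := by
    simp only [hlift _ (hu _)]
    exact hcb.tendsto.comp hulim
  exact tendsto_nhds_unique h1 h2

/-- Two lifts through a local homeomorphism from a Hausdorff space that agree at one point of an
interval agree on all of it. -/
theorem lift_unique [T2Space M] {t : ℝ} {γ₁ γ₂ : ℝ → M}
    (h1 : ContinuousOn γ₁ (Icc 0 t)) (h2 : ContinuousOn γ₂ (Icc 0 t)) (h0 : γ₁ 0 = γ₂ 0)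
    (h : ∀ s ∈ Icc 0 t, S.gauss (γ₁ s) = S.gauss (γ₂ s)) : EqOn γ₁ γ₂ (Icc 0 t) := by
  intro s hs
  exact (T2Space.isSeparatedMap S.gauss).eqOn_of_comp_eqOn
    (S.gauss_isLocalHomeomorph hκ₀ hκ).isLocallyInjective isPreconnected_Icc h1 h2 h
    (left_mem_Icc.2 (hs.1.trans hs.2)) h0 hs

/-- Paths that avoid the ideal boundary lift through the Gauss map. -/
theorem exists_lift [T2Space M] (hcomplete : S.IsComplete) {x : Sph n}
    (hx : S.idealBoundary = {x}) {c : ℝ → Sph n}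
    (hc : ∀ s ∈ Icc (0 : ℝ) 1, ContMDiffAt 𝓘(ℝ, ℝ) (𝓡 n) 1 c s) (hcx : ∀ s ∈ Icc (0 : ℝ) 1, c s ≠ x)
    {p₀ : M} (hp₀ : S.gauss p₀ = c 0) :
    ∃ γ : ℝ → M, ContinuousOn γ (Icc 0 1) ∧ γ 0 = p₀ ∧ ∀ s ∈ Icc (0 : ℝ) 1, S.gauss (γ s) = c s := by
  let Lift : ℝ → Prop := fun t =>
    ∃ γ : ℝ → M, ContinuousOn γ (Icc 0 t) ∧ γ 0 = p₀ ∧ ∀ s ∈ Icc (0 : ℝ) t, S.gauss (γ s) = c s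
  have hcont : ContinuousOn c (Icc 0 1) := fun s hs => (hc s hs).continuousAt.continuousWithinAt
  have hderiv : ContinuousOn (deriv fun τ => (c τ : Euc n)) (Icc 0 1) := by
    intro s hs
    have := Fact.mk (@finrank_euclideanSpace_fin ℝ _ (n + 1))
    have h1 : ContMDiffAt 𝓘(ℝ, ℝ) 𝓘(ℝ, Euc n) 1 (fun τ => (c τ : Euc n)) s :=
      ContMDiffAt.comp s (contMDiff_coe_sphere (m := 1) (c s)) (hc s hs)
    have h2 := ((contMDiffAt_iff_contDiffAt.1 h1).fderiv_right (m := 0) (by simp)).continuousAt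
    exact (h2.clm_apply continuousAt_const).continuousWithinAt
  obtain ⟨K, hK⟩ := isCompact_Icc.exists_bound_of_continuousOn hderiv
  obtain ⟨B, hB⟩ := S.exists_lightCone_fst_le hx (isCompact_Icc.image_of_continuousOn hcont)
    (fun ⟨s, hs, h⟩ => hcx s hs h)
  have hmono : ∀ {s t}, s ≤ t → Lift t → Lift s := fun hst ⟨γ, h1, h2, h3⟩ =>
    ⟨γ, h1.mono (Icc_subset_Icc_right hst), h2, fun τ hτ => h3 τ ⟨hτ.1, hτ.2.trans hst⟩⟩
  have hzero : Lift 0 := ⟨fun _ => p₀, continuousOn_const, rfl, fun s hs => by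
    rw [Icc_self, mem_singleton_iff] at hs; rw [hs, hp₀]⟩
  -- Extension step: a lift up to s whose endpoint lies in the domain of a local inverse continues
  -- as long as c stays in the target.
  have hglue : ∀ (e : OpenPartialHomeomorph M (Sph n)), EqOn e S.gauss e.source → ∀ (s t : ℝ)
      (γ : ℝ → M), 0 ≤ s → s ≤ t → t ≤ 1 → ContinuousOn γ (Icc 0 s) → γ 0 = p₀ →
      (∀ τ ∈ Icc (0 : ℝ) s, S.gauss (γ τ) = c τ) → γ s ∈ e.source →
      (∀ τ ∈ Icc s t, c τ ∈ e.target) → Lift t := by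
    intro e he s t γ h0s hst ht1 hγ hγ0 hγl hγs hct
    have hes : e.symm (c s) = γ s := by
      rw [← hγl s ⟨h0s, le_rfl⟩, ← he hγs, e.left_inv hγs]
    let γ' : ℝ → M := fun τ => if τ ≤ s then γ τ else e.symm (c τ)
    have e1 : EqOn γ' γ (Icc 0 s) := fun τ hτ => if_pos hτ.2
    have e2 : EqOn γ' (fun τ => e.symm (c τ)) (Icc s t) := by
      intro τ hτ
      rcases hτ.1.eq_or_lt with rfl | h
      · simp only [γ', le_refl, if_true, hes]
      · simp only [γ', not_le.2 h, if_false]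
    refine ⟨γ', ?_, ?_, ?_⟩
    · rw [← Icc_union_Icc_eq_Icc h0s hst]
      refine ContinuousOn.union_of_isClosed (hγ.congr e1) (ContinuousOn.congr ?_ e2) isClosed_Icc
        isClosed_Icc
      exact e.continuousOn_symm.comp (hcont.mono (Icc_subset_Icc h0s ht1)) hct
    · rw [e1 ⟨le_rfl, h0s⟩, hγ0]
    · intro τ hτ
      rcases le_total τ s with h | h
      · rw [e1 ⟨hτ.1, h⟩, hγl τ ⟨hτ.1, h⟩]
      · have hm := hct τ ⟨h, hτ.2⟩
        rw [e2 ⟨h, hτ.2⟩, ← he (e.map_target hm), e.right_inv hm]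
  let T : Set ℝ := {t | t ∈ Icc (0 : ℝ) 1 ∧ Lift t}
  have hT0 : (0 : ℝ) ∈ T := ⟨⟨le_rfl, zero_le_one⟩, hzero⟩
  have hTbdd : BddAbove T := ⟨1, fun t ht => ht.1.2⟩
  set b := sSup T with hb
  have hb0 : 0 ≤ b := le_csSup hTbdd hT0
  have hb1 : b ≤ 1 := csSup_le ⟨0, hT0⟩ fun t ht => ht.1.2
  have hbelow : ∀ t < b, Lift t := by
    intro t ht
    obtain ⟨t', ht', htt'⟩ := exists_lt_of_lt_csSup ⟨0, hT0⟩ ht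
    exact hmono htt'.le ht'.2
  -- a lift that ends, shortly before `b`, in the domain of a local inverse at `c b`
  have hnear : ∃ e : OpenPartialHomeomorph M (Sph n), EqOn e S.gauss e.source ∧
      c b ∈ e.target ∧ ∀ δ > 0, ∃ (s : ℝ) (γ : ℝ → M), 0 ≤ s ∧ s ≤ b ∧ b - δ < s ∧
        ContinuousOn γ (Icc 0 s) ∧ γ 0 = p₀ ∧ (∀ τ ∈ Icc (0 : ℝ) s, S.gauss (γ τ) = c τ) ∧
        γ s ∈ e.source := by
    rcases hb0.eq_or_lt with h | hbpos
    · obtain ⟨e, he1, he2, -⟩ := S.exists_local_inverse hκ₀ hκ p₀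
      obtain ⟨γ, g1, g2, g3⟩ := hzero
      refine ⟨e, he2, ?_, fun δ hδ => ⟨0, γ, le_rfl, hb0, by linarith, g1, g2, g3, g2 ▸ he1⟩⟩
      rw [← h, ← hp₀, ← he2 he1]
      exact e.map_source he1
    · have : Nonempty M := ⟨p₀⟩
      choose! Γ G1 G2 G3 using hbelow
      -- By uniqueness the chosen lifts agree on overlaps, so this diagonal is one lift on [0, b).
      let γ : ℝ → M := fun t => Γ t t
      have hΓ : ∀ t < b, EqOn γ (Γ t) (Icc 0 t) := by
        intro t ht s hs
        have hsb := hs.2.trans_lt ht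
        refine S.lift_unique hκ₀ hκ (t := s) (G1 s hsb) ((G1 t ht).mono (Icc_subset_Icc_right hs.2))
          ((G2 s hsb).trans (G2 t ht).symm) (fun τ hτ => ?_) ⟨hs.1, le_rfl⟩
        rw [G3 s hsb τ hτ, G3 t ht τ ⟨hτ.1, hτ.2.trans hs.2⟩]
      obtain ⟨p, u, hu, hub, hup, hpc⟩ := S.exists_tendsto_of_lift hκ₀ hκ hcomplete hbpos
        (γ := γ) (c := c) (K := K) (B := B) (fun s hs => by
          have ht : (s + b) / 2 < b := by linarith [hs.2]
          refine ((G1 _ ht).congr (hΓ _ ht)).continuousAt (Icc_mem_nhds hs.1 ?_)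
          linarith [hs.2])
        (fun s hs => hc s ⟨hs.1.le, hs.2.le.trans hb1⟩) (hc b ⟨hb0, hb1⟩).continuousAt
        (fun s hs => G3 s hs.2 s ⟨hs.1.le, le_rfl⟩)
        (fun s hs => hK s ⟨hs.1.le, hs.2.le.trans hb1⟩)
        (fun s hs => hB _ ⟨s, ⟨hs.1.le, hs.2.le.trans hb1⟩,
          (G3 s hs.2 s ⟨hs.1.le, le_rfl⟩).symm⟩)
      obtain ⟨e, he1, he2, -⟩ := S.exists_local_inverse hκ₀ hκ p
      refine ⟨e, he2, ?_, fun δ hδ => ?_⟩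
      · rw [← hpc, ← he2 he1]
        exact e.map_source he1
      · obtain ⟨k, hk1, hk2⟩ := ((hup.eventually (e.open_source.mem_nhds he1)).and
          (hub.eventually (lt_mem_nhds (show b - δ < b by linarith)))).exists
        exact ⟨u k, Γ (u k), (hu k).1.le, (hu k).2.le, hk2, G1 _ (hu k).2, G2 _ (hu k).2,
          G3 _ (hu k).2, hk1⟩
  obtain ⟨e, he, hce, hδ⟩ := hnear
  obtain ⟨δ, hδ0, hball⟩ := Metric.mem_nhds_iff.1
    ((hc b ⟨hb0, hb1⟩).continuousAt.preimage_mem_nhds (e.open_target.mem_nhds hce))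
  obtain ⟨s, γ, hs0, hsb, hsδ, g1, g2, g3, g4⟩ := hδ δ hδ0
  -- Extending past b inside the δ-neighbourhood contradicts the supremum unless b has reached 1.
  have hLift : Lift (min 1 (b + δ / 2)) := by
    have hbm : b ≤ min 1 (b + δ / 2) := le_min hb1 (by linarith)
    refine hglue e he s _ γ hs0 (hsb.trans hbm) (min_le_left _ _) g1 g2 g3 g4 fun τ hτ => ?_
    refine hball ?_
    have := hτ.2.trans (min_le_right _ _)
    rw [Metric.mem_ball, Real.dist_eq, abs_lt]
    constructor <;> linarith [hτ.1]
  have hle : min 1 (b + δ / 2) ≤ b :=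
    le_csSup hTbdd ⟨⟨le_min zero_le_one (by linarith), min_le_left _ _⟩, hLift⟩
  have h1 : min 1 (b + δ / 2) = 1 := by
    rcases min_choice 1 (b + δ / 2) with h | h
    · exact h
    · rw [h] at hle; linarith
  rwa [h1] at hLift

end Length

end OrientedHypersurface

end HypSurf

/-! ### The Gauss map is a homeomorphism onto the complement of x -/

namespace HypSurf

theorem isPreconnected_ball_diff_center {n : ℕ} (hn : 2 ≤ n) (c : EuclideanSpace ℝ (Fin n)) {r : ℝ}
    (hr : 0 < r) : IsPreconnected (ball c r \ {c}) := by
  have h1 : IsPreconnected ({0}ᶜ : Set (EuclideanSpace ℝ (Fin n))) := by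
    refine (isConnected_compl_singleton_of_one_lt_rank ?_ 0).isPreconnected
    rw [← Module.finrank_eq_rank, finrank_euclideanSpace_fin]
    exact_mod_cast hn
  have h2 : ball c r \ {c} = OpenPartialHomeomorph.univBall c r '' {0}ᶜ := by
    set e := OpenPartialHomeomorph.univBall c r
    have hs : e.source = univ := OpenPartialHomeomorph.univBall_source c r
    have ht : e.target = ball c r := OpenPartialHomeomorph.univBall_target c hr
    have h0 : e 0 = c := OpenPartialHomeomorph.univBall_apply_zero c r
    ext y
    constructor
    · rintro ⟨hy, hyc⟩
      rw [← ht] at hy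
      refine ⟨e.symm y, fun h => hyc ?_, e.right_inv hy⟩
      rw [mem_singleton_iff] at h ⊢
      rw [← e.right_inv hy, h, h0]
    · rintro ⟨z, hz, rfl⟩
      refine ⟨ht ▸ e.map_source (hs ▸ mem_univ z), fun h => hz ?_⟩
      rw [mem_singleton_iff, ← h0] at h
      exact e.injOn (hs ▸ mem_univ z) (hs ▸ mem_univ _) h
  rw [h2]
  exact h1.image _ (OpenPartialHomeomorph.continuous_univBall c r).continuousOn

/-- Small punctured neighbourhoods in a manifold of dimension at least two are connected. -/
theorem exists_open_preconnected_diff_singleton {n : ℕ} (hn : 2 ≤ n) {M : Type*}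
    [TopologicalSpace M] [ChartedSpace (EuclideanSpace ℝ (Fin n)) M] (p : M) {U : Set M}
    (hU : U ∈ 𝓝 p) : ∃ V ⊆ U, IsOpen V ∧ p ∈ V ∧ IsPreconnected (V \ {p}) := by
  set e := chartAt (EuclideanSpace ℝ (Fin n)) p
  have hp : p ∈ e.source := mem_chart_source _ p
  have h1 : e.target ∩ e.symm ⁻¹' U ∈ 𝓝 (e p) := by
    refine inter_mem (e.open_target.mem_nhds (e.map_source hp)) ?_
    refine (e.continuousAt_symm (e.map_source hp)).preimage_mem_nhds ?_
    rwa [e.left_inv hp]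
  obtain ⟨r, hr, hball⟩ := Metric.mem_nhds_iff.1 h1
  have ht : ball (e p) r ⊆ e.target := fun y hy => (hball hy).1
  refine ⟨e.symm '' ball (e p) r, ?_, e.isOpen_image_symm_of_subset_target isOpen_ball ht,
    ⟨e p, mem_ball_self hr, e.left_inv hp⟩, ?_⟩
  · rintro _ ⟨y, hy, rfl⟩
    exact (hball hy).2
  · have h2 : e.symm '' ball (e p) r \ {p} = e.symm '' (ball (e p) r \ {e p}) := by
      ext q
      constructor
      · rintro ⟨⟨y, hy, rfl⟩, hq⟩
        refine ⟨y, ⟨hy, fun h => hq ?_⟩, rfl⟩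
        rw [mem_singleton_iff] at h ⊢
        rw [h, e.left_inv hp]
      · rintro ⟨y, ⟨hy, hye⟩, rfl⟩
        refine ⟨⟨y, hy, rfl⟩, fun h => hye ?_⟩
        rw [mem_singleton_iff] at h ⊢
        rw [← h, e.right_inv (ht hy)]
    rw [h2]
    exact (isPreconnected_ball_diff_center hn _ hr).image _
      (e.continuousOn_symm.mono (sdiff_subset.trans ht))

namespace OrientedHypersurface

variable {n : ℕ} {M : Type*} [TopologicalSpace M] [ChartedSpace (EuclideanSpace ℝ (Fin n)) M]
  (S : OrientedHypersurface n M)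

theorem norm_toBall_lt_one (p : M) : ‖toBall (S.φ p)‖ < 1 := by
  have h1 := norm_snd_lt_of_mem_hyperboloid (S.φ_mem p)
  have h2 := S.one_le_φ_fst p
  rw [toBall, norm_smul, norm_inv, Real.norm_of_nonneg (by linarith), inv_mul_lt_one₀ (by linarith)]
  linarith

/-- A compact image in the ball is closed and stays in the open ball, so it cannot accumulate on the
sphere. -/
theorem idealBoundary_eq_empty [CompactSpace M] : S.idealBoundary = ∅ := by
  rw [eq_empty_iff_forall_notMem]
  intro y hy
  have hc : Continuous fun p => toBall (S.φ p) := by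
    have h1 : Continuous S.φ := S.φ_smooth.continuous
    have h2 : Continuous fun p => (1 + (S.φ p).1)⁻¹ :=
      (continuous_const.add h1.fst).inv₀ fun p => by
        have := S.one_le_φ_fst p
        exact (by linarith : (0 : ℝ) < 1 + (S.φ p).1).ne'
    exact h2.smul h1.snd
  have h3 : (y : Euc n) ∈ range fun p => toBall (S.φ p) := by
    rw [← (isCompact_range hc).isClosed.closure_eq]
    exact hy
  obtain ⟨p, hp⟩ := h3
  have := S.norm_toBall_lt_one p
  simp only at hp
  rw [hp, norm_eq_of_mem_sphere] at this
  exact lt_irrefl _ this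

variable [IsManifold (𝓡 n) ∞ M] [T2Space M] {κ₀ : ℝ} (hκ₀ : -1 < κ₀)
  (hκ : ∀ (p : M) (κ : ℝ), S.IsPrincipalCurvature p κ → κ₀ ≤ κ)
include hκ₀ hκ

/-- The Gauss map has a continuous section over the complement of the ideal boundary point. -/
theorem exists_section [Nonempty M] (hn : 2 ≤ n) (hcomplete : S.IsComplete) {x : Sph n}
    (hx : S.idealBoundary = {x}) :
    ∃ σ : Sph n → M, ∀ y, y ≠ x → ContinuousAt σ y ∧ S.gauss (σ y) = y := by
  obtain ⟨p₀, hp₀⟩ : ∃ p₀ : M, S.gauss p₀ ≠ x := by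
    by_contra! h
    have p := Classical.arbitrary M
    have : Nontrivial (Fin n) := Fin.nontrivial_iff_two_le.2 hn
    obtain ⟨v, hv⟩ := exists_ne (0 : EuclideanSpace ℝ (Fin n))
    refine hv (S.dmap_gaussVec_injective hκ₀ hκ p ?_)
    have h1 : S.gaussVec = fun _ => (x : Euc n) := funext fun q => by rw [gaussVec, h q]
    have h2 : ∀ w : EuclideanSpace ℝ (Fin n), dmapLinear (n := n) S.gaussVec p w = 0 := by
      intro w
      rw [h1]
      have h3 : mfderiv (𝓡 n) 𝓘(ℝ, Euc n) (fun _ : M => (x : Euc n)) p = 0 := mfderiv_const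
      exact congrArg (fun L => L w) h3
    rw [h2, h2]
  -- The sphere chart centred at -x is stereographic projection from x: its source is exactly the
  -- complement of x and its target is the whole space.
  set e := chartAt (EuclideanSpace ℝ (Fin n)) (-x) with he
  have hsource : e.source = {x}ᶜ := by
    have : Fact (Module.finrank ℝ (Euc n) = n + 1) := ⟨finrank_euclideanSpace_fin⟩
    change (stereographic' n (- -x)).source = _
    rw [stereographic'_source, neg_neg]
  have htarget : e.target = univ := by
    have : Fact (Module.finrank ℝ (Euc n) = n + 1) := ⟨finrank_euclideanSpace_fin⟩
    exact stereographic'_target _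
  have hsymm : ContMDiff (𝓡 n) (𝓡 n) 1 e.symm := by
    rw [← contMDiffOn_univ, ← htarget]
    exact contMDiffOn_chart_symm
  have hne : ∀ a, e.symm a ≠ x := fun a => by
    have := e.map_target (htarget ▸ mem_univ a)
    rwa [hsource] at this
  set a₀ := e (S.gauss p₀)
  have hc : ∀ a : EuclideanSpace ℝ (Fin n), ContMDiff 𝓘(ℝ, ℝ) (𝓡 n) 1
      fun s : ℝ => e.symm (a₀ + s • (a - a₀)) := by
    intro a
    have : ContDiff ℝ 1 fun s : ℝ => a₀ + s • (a - a₀) := by fun_prop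
    exact hsymm.comp this.contMDiff
  choose Γ G1 G2 G3 using fun a : EuclideanSpace ℝ (Fin n) =>
    S.exists_lift hκ₀ hκ hcomplete hx (c := fun s : ℝ => e.symm (a₀ + s • (a - a₀)))
      (fun s _ => hc a s) (fun s _ => hne _) (p₀ := p₀) (by
        simp only [zero_smul, add_zero]
        exact (e.left_inv (by rw [hsource]; exact hp₀)).symm)
  let f : C(unitInterval × EuclideanSpace ℝ (Fin n), Sph n) :=
    ⟨fun q => e.symm (a₀ + (q.1 : ℝ) • (q.2 - a₀)), hsymm.continuous.comp (by fun_prop)⟩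
  let g : unitInterval × EuclideanSpace ℝ (Fin n) → M := fun q => Γ q.2 q.1
  -- The lifts of the individual segments depend continuously on the endpoint, by the homotopy
  -- lifting property of local homeomorphisms.
  have hg : Continuous g := by
    refine (S.gauss_isLocalHomeomorph hκ₀ hκ).continuous_lift (T2Space.isSeparatedMap _) f
      (funext fun q => G3 q.2 q.1 q.1.2) ?_ fun a => ?_
    · simp only [g, Set.Icc.coe_zero, G2]
      exact continuous_const
    · exact (G1 a).comp_continuous continuous_subtype_val fun t => t.2
  refine ⟨fun y => g (1, e y), fun y hy => ⟨?_, ?_⟩⟩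
  · have hy' : y ∈ e.source := by rw [hsource]; exact hy
    have h1 : Continuous fun a => g (1, a) := hg.comp (by fun_prop)
    exact h1.continuousAt.comp (e.continuousAt hy')
  · have hy' : y ∈ e.source := by rw [hsource]; exact hy
    refine (G3 (e y) 1 ⟨zero_le_one, le_rfl⟩).trans ?_
    simp only [one_smul, add_sub_cancel]
    exact e.left_inv hy'

/-- The Gauss map is a bijection onto the complement of the ideal boundary point, with continuous
inverse. -/
theorem exists_inverse [ConnectedSpace M] (hn : 2 ≤ n) (hcomplete : S.IsComplete) {x : Sph n}
    (hx : S.idealBoundary = {x}) :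
    ∃ σ : Sph n → M, (∀ y, y ≠ x → ContinuousAt σ y ∧ S.gauss (σ y) = y) ∧
      ∀ q, S.gauss q ≠ x ∧ σ (S.gauss q) = q := by
  obtain ⟨σ, hσ⟩ := S.exists_section hκ₀ hκ hn hcomplete hx
  refine ⟨σ, hσ, ?_⟩
  -- R is open since G is locally injective, and its complement within {G ≠ x} is open since M is
  -- Hausdorff. Only points over x can obstruct R = M.
  let R : Set M := {q | S.gauss q ≠ x ∧ σ (S.gauss q) = q}
  have hG := S.gauss_continuous
  have hopen : IsOpen {q | S.gauss q ≠ x} := isOpen_ne.preimage hG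
  have hcomp : ∀ q, S.gauss q ≠ x → ContinuousAt (fun q => σ (S.gauss q)) q := fun q hq =>
    ContinuousAt.comp (hσ _ hq).1 hG.continuousAt
  have hR : IsOpen R := by
    rw [isOpen_iff_mem_nhds]
    rintro q ⟨hq1, hq2⟩
    obtain ⟨e, he1, he2, -⟩ := S.exists_local_inverse hκ₀ hκ q
    have h1 := (hcomp q hq1).preimage_mem_nhds (hq2.symm ▸ e.open_source.mem_nhds he1)
    filter_upwards [h1, e.open_source.mem_nhds he1, hopen.mem_nhds hq1] with q' h1 h2 h3
    refine ⟨h3, e.injOn h1 h2 ?_⟩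
    rw [he2 h1, he2 h2, (hσ _ h3).2]
  have hRc : IsOpen {q | S.gauss q ≠ x ∧ σ (S.gauss q) ≠ q} := by
    rw [isOpen_iff_mem_nhds]
    rintro q ⟨hq1, hq2⟩
    have h3 : ∀ᶠ q' in 𝓝 q, (σ (S.gauss q'), q') ∈ (diagonal M)ᶜ :=
      ((hcomp q hq1).prodMk continuousAt_id).eventually
        (isClosed_diagonal.isOpen_compl.mem_nhds hq2)
    filter_upwards [hopen.mem_nhds hq1, h3] with q' h1 h2
    exact ⟨h1, h2⟩
  have hRclosure : ∀ p ∈ closure R, S.gauss p ≠ x → p ∈ R := by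
    intro p hp hpx
    by_contra hpR
    obtain ⟨q, hq1, hq2⟩ := mem_closure_iff.1 hp _ hRc ⟨hpx, fun h => hpR ⟨hpx, h⟩⟩
    exact hq1.2 hq2.2
  -- A small punctured neighbourhood of p is connected (here n ≥ 2 enters) and has no point over x,
  -- so it is covered by the two disjoint open sets; meeting R, it lies in R.
  have hpunct : ∀ p ∈ closure R, S.gauss p = x → ∃ V, IsOpen V ∧ p ∈ V ∧ V \ {p} ⊆ R := by
    intro p hp hpx
    obtain ⟨e, he1, he2, -⟩ := S.exists_local_inverse hκ₀ hκ p
    obtain ⟨V, hVU, hVo, hpV, hVc⟩ :=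
      exists_open_preconnected_diff_singleton hn p (e.open_source.mem_nhds he1)
    refine ⟨V, hVo, hpV, hVc.subset_left_of_subset_union hR hRc ?_ ?_ ?_⟩
    · rw [disjoint_left]
      exact fun q h1 h2 => h2.2 h1.2
    · rintro q ⟨hq1, hq2⟩
      have hqx : S.gauss q ≠ x := by
        intro h
        refine hq2 (e.injOn (hVU hq1) he1 ?_)
        rw [he2 (hVU hq1), he2 he1, h, hpx]
      by_cases h : σ (S.gauss q) = q
      · exact Or.inl ⟨hqx, h⟩
      · exact Or.inr ⟨hqx, h⟩
    · obtain ⟨q, hq1, hq2⟩ := mem_closure_iff.1 hp V hVo hpV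
      refine ⟨q, ⟨hq1, fun h => hq2.1 ?_⟩, hq2⟩
      rw [mem_singleton_iff] at h
      rw [h, hpx]
  have hne : R.Nonempty := by
    obtain ⟨y, hy⟩ : ∃ y : Sph n, y ≠ x := ⟨-x, (ne_neg_of_mem_unit_sphere ℝ x).symm⟩
    exact ⟨σ y, by rw [(hσ y hy).2]; exact hy, by rw [(hσ y hy).2]⟩
  have hdense : closure R = univ := by
    refine IsClopen.eq_univ ⟨isClosed_closure, ?_⟩ hne.closure
    rw [isOpen_iff_mem_nhds]
    intro p hp
    by_cases hpx : S.gauss p = x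
    · obtain ⟨V, hV, hpV, hVR⟩ := hpunct p hp hpx
      filter_upwards [hV.mem_nhds hpV] with q hq
      rcases eq_or_ne q p with rfl | h
      · exact hp
      · exact subset_closure (hVR ⟨hq, h⟩)
    · exact mem_of_superset (hR.mem_nhds (hRclosure p hp hpx)) subset_closure
  suffices h : ∀ q, S.gauss q ≠ x from fun q => hRclosure q (hdense ▸ mem_univ q) (h q)
  by_contra! h
  obtain ⟨p, hpx⟩ := h
  obtain ⟨V, hV, hpV, hVR⟩ := hpunct p (hdense ▸ mem_univ p) hpx
  have : LocallyCompactSpace M := ChartedSpace.locallyCompactSpace (EuclideanSpace ℝ (Fin n)) M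
  obtain ⟨K, hK, hpK, hKV⟩ := exists_compact_subset hV hpV
  have hO : IsOpen (S.gauss '' interior K) :=
    (S.gauss_isLocalHomeomorph hκ₀ hκ).isOpenMap _ isOpen_interior
  -- If G(p) = x, then G maps a neighbourhood of p onto a neighbourhood of x, whose complement is
  -- compact. Its image under σ together with K covers R, hence M, and M would be compact.
  have hK2 : IsCompact (σ '' (S.gauss '' interior K)ᶜ) := by
    refine hO.isClosed_compl.isCompact.image_of_continuousOn fun y hy => ?_
    refine (hσ y fun h => hy ⟨p, hpK, hpx.trans h.symm⟩).1.continuousWithinAt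
  have hcover : R ⊆ K ∪ σ '' (S.gauss '' interior K)ᶜ := by
    rintro q ⟨hq1, hq2⟩
    by_cases hq : S.gauss q ∈ S.gauss '' interior K
    · obtain ⟨q', hq', hqq'⟩ := hq
      have hq'p : q' ≠ p := by
        rintro rfl
        exact hq1 (hqq'.symm.trans hpx)
      have h1 := (hVR ⟨hKV (interior_subset hq'), hq'p⟩).2
      rw [hqq', hq2] at h1
      exact Or.inl (h1 ▸ interior_subset hq')
    · exact Or.inr ⟨_, hq, hq2⟩
  have hcompact : CompactSpace M := by
    refine ⟨(hK.union hK2).of_isClosed_subset isClosed_univ ?_⟩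
    rw [← hdense]
    exact closure_minimal hcover (hK.union hK2).isClosed
  have := S.idealBoundary_eq_empty
  rw [hx] at this
  exact singleton_ne_empty x this

end OrientedHypersurface

end HypSurf

/-! ### Smoothness of the inverse and completeness of the conformal metric -/

namespace HypSurf

/-- A map to the sphere is smooth if it is smooth as a map to the ambient space. -/
theorem contMDiffAt_sphere {n : ℕ} {E' H' N : Type*} [NormedAddCommGroup E'] [NormedSpace ℝ E']
    [TopologicalSpace H'] {I' : ModelWithCorners ℝ E' H'} [TopologicalSpace N] [ChartedSpace H' N]
    {k : WithTop ℕ∞} {f : N → Sph n} {t : N}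
    (hf : ContMDiffAt I' 𝓘(ℝ, Euc n) k (fun s => (f s : Euc n)) t) :
    ContMDiffAt I' (𝓡 n) k f t := by
  have : Fact (Module.finrank ℝ (Euc n) = n + 1) := ⟨finrank_euclideanSpace_fin⟩
  rw [contMDiffAt_iff_target]
  refine ⟨IsInducing.subtypeVal.continuousAt_iff.2 hf.continuousAt, ?_⟩
  set v : Euc n := ((-f t : Sph n) : Euc n) with hv
  let U := (OrthonormalBasis.fromOrthogonalSpanSingleton (𝕜 := ℝ)
    n (ne_zero_of_mem_unit_sphere (-f t))).repr
  have h1 : ContDiffAt ℝ k (stereoToFun v) (f t : Euc n) := by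
    refine (contDiffOn_stereoToFun.contDiffAt ?_)
    refine IsOpen.mem_nhds (isOpen_ne_fun (by fun_prop) continuous_const) ?_
    change inner ℝ v (f t : Euc n) ≠ 1
    have : inner ℝ v (f t : Euc n) = -1 := by
      rw [hv, coe_neg_sphere, inner_neg_left, real_inner_self_eq_norm_sq, norm_eq_of_mem_sphere]
      norm_num
    rw [this]; norm_num
  have h2 : ContDiffAt ℝ k (fun z => U (stereoToFun v z)) (f t : Euc n) :=
    U.contDiff.contDiffAt.comp _ h1
  exact ContMDiffAt.comp (f := fun s => (f s : Euc n)) t h2.contMDiffAt hf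

namespace OrientedHypersurface

variable {n : ℕ} {M : Type*} [TopologicalSpace M] [ChartedSpace (EuclideanSpace ℝ (Fin n)) M]
  (S : OrientedHypersurface n M)

/-- `σ` is a continuous inverse of the Gauss map, defined away from the point `x`. -/
structure IsGaussInverse (x : Sph n) (σ : Sph n → M) : Prop where
  continuousAt : ∀ y, y ≠ x → ContinuousAt σ y
  right_inv : ∀ y, y ≠ x → S.gauss (σ y) = y
  ne : ∀ q, S.gauss q ≠ x
  left_inv : ∀ q, σ (S.gauss q) = q

variable {S} {x : Sph n} {σ : Sph n → M} (hσ : S.IsGaussInverse x σ)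
include hσ

theorem IsGaussInverse.injective : Function.Injective S.gauss :=
  Function.LeftInverse.injective hσ.left_inv

theorem IsGaussInverse.range_eq : range S.gauss = {x}ᶜ := by
  ext y
  exact ⟨fun ⟨q, hq⟩ => hq ▸ hσ.ne q, fun hy => ⟨σ y, hσ.right_inv y hy⟩⟩

theorem IsGaussInverse.eventuallyEq {y : Sph n} (hy : y ≠ x) :
    (fun z => S.gauss (σ z)) =ᶠ[𝓝 y] id := by
  filter_upwards [isOpen_ne.mem_nhds hy] with z hz using hσ.right_inv z hz

variable [IsManifold (𝓡 n) ∞ M] {κ₀ : ℝ} (hκ₀ : -1 < κ₀)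
  (hκ : ∀ (p : M) (κ : ℝ), S.IsPrincipalCurvature p κ → κ₀ ≤ κ)
include hκ₀ hκ

theorem IsGaussInverse.contMDiffAt {y : Sph n} (hy : y ≠ x) :
    ContMDiffAt (𝓡 n) (𝓡 n) ∞ σ y :=
  S.contMDiffAt_lift hκ₀ hκ le_rfl (hσ.continuousAt y hy)
    (contMDiffAt_id.congr_of_eventuallyEq (hσ.eventuallyEq hy))

/-- The conformal metric `e^{2ρ} g` on the image of the Gauss map is complete. -/
theorem IsGaussInverse.isCompleteMetricOn (hcomplete : S.IsComplete) :
    IsCompleteMetricOn (𝓡 n) (range S.gauss) (conformalNorm fun y => S.support (σ y)) := by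
  intro u hu hcauchy
  have hux : ∀ k, u k ≠ x := fun k => by
    have := hu k
    rwa [hσ.range_eq] at this
  set C := (1 + κ₀)⁻¹
  have hC : 0 < C := inv_pos.2 (by linarith)
  -- By the basic inequality σ is Lipschitz from ĝ to the metric of φ with constant C. Paths inside
  -- G(M) avoid x, so they lift through σ.
  have key : ∀ (a b : Sph n) (ε : ℝ≥0∞),
      lengthDist (𝓡 n) (range S.gauss) (conformalNorm fun y => S.support (σ y)) a b < ε →
      lengthDist (𝓡 n) univ S.inducedNorm (σ a) (σ b) ≤ ENNReal.ofReal C * ε := by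
    intro a b ε h
    simp only [lengthDist, iInf_lt_iff] at h
    obtain ⟨γ, hγ, hγΩ, rfl, rfl, hlt⟩ := h
    have hγx : ∀ t ∈ Icc (0 : ℝ) 1, γ t ≠ x := fun t ht => by
      have := hγΩ ht
      rwa [hσ.range_eq] at this
    have hlift : ContMDiffOn 𝓘(ℝ, ℝ) (𝓡 n) 1 (σ ∘ γ) (Icc 0 1) := fun t ht =>
      ((hσ.contMDiffAt hκ₀ hκ (hγx t ht)).of_le (by norm_cast)).comp_contMDiffWithinAt t (hγ t ht)
    refine (iInf₂_le_of_le (σ ∘ γ) hlift <| iInf₂_le_of_le (mapsTo_univ _ _)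
      (show (σ ∘ γ) 0 = σ (γ 0) from rfl) <|
        iInf_le_of_le (show (σ ∘ γ) 1 = σ (γ 1) from rfl) le_rfl).trans ((?_ : _ ≤ _).trans (mul_le_mul_right hlt.le _))
    let _ : ∀ p : M, ENorm (TangentSpace (𝓡 n) p) := fun p => ⟨S.inducedNorm p⟩
    let _ : ∀ y : Sph n, ENorm (TangentSpace (𝓡 n) y) :=
      fun y => ⟨conformalNorm (fun y => S.support (σ y)) y⟩
    change Manifold.pathELength (𝓡 n) (σ ∘ γ) 0 1 ≤
      ENNReal.ofReal C * Manifold.pathELength (𝓡 n) γ 0 1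
    rw [Manifold.pathELength_eq_lintegral_mfderiv_Ioo, Manifold.pathELength_eq_lintegral_mfderiv_Ioo,
      ← MeasureTheory.lintegral_const_mul' _ _ ENNReal.ofReal_ne_top]
    refine MeasureTheory.setLIntegral_mono' measurableSet_Ioo fun t ht => ?_
    change S.inducedNorm (σ (γ t)) (mfderiv 𝓘(ℝ, ℝ) (𝓡 n) (fun s => σ (γ s)) t (1 : ℝ)) ≤
      ENNReal.ofReal C * conformalNorm (fun y => S.support (σ y)) (γ t)
        (mfderiv 𝓘(ℝ, ℝ) (𝓡 n) γ t (1 : ℝ))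
    have htI := Ioo_subset_Icc_self ht
    have d1 : MDifferentiableAt 𝓘(ℝ, ℝ) (𝓡 n) γ t :=
      ((hγ t htI).contMDiffAt (Icc_mem_nhds ht.1 ht.2)).mdifferentiableAt (by simp)
    have d2 : MDifferentiableAt 𝓘(ℝ, ℝ) (𝓡 n) (fun s => σ (γ s)) t :=
      ((hlift t htI).contMDiffAt (Icc_mem_nhds ht.1 ht.2)).mdifferentiableAt (by simp)
    have d3 := hasDerivAt_comp_curve (S.gaussVec_mdiff (σ (γ t))) d2
    have d4 : MDifferentiableAt (𝓡 n) 𝓘(ℝ, Euc n) (fun y : Sph n => (y : Euc n)) (γ t) :=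
      have := Fact.mk (@finrank_euclideanSpace_fin ℝ _ (n + 1))
      (contMDiff_coe_sphere (m := 1) _).mdifferentiableAt (by simp)
    have d5 := hasDerivAt_comp_curve d4 d1
    have hev : (fun s => S.gaussVec (σ (γ s))) =ᶠ[𝓝 t] fun s => (γ s : Euc n) := by
      filter_upwards [Icc_mem_nhds ht.1 ht.2] with s hs
      rw [gaussVec, hσ.right_inv _ (hγx s hs)]
    have d6 := d3.unique (d5.congr_of_eventuallyEq hev)
    have h1 := S.norm_dφ_le_gauss hκ₀ hκ _ (mfderiv 𝓘(ℝ, ℝ) (𝓡 n) (fun s => σ (γ s)) t (1 : ℝ))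
    rw [d6] at h1
    rw [inducedNorm, conformalNorm, ← ENNReal.ofReal_mul hC.le]
    refine ENNReal.ofReal_le_ofReal ?_
    rw [exp_support]
    exact h1
  obtain ⟨p, -, hp⟩ := hcomplete (fun k => σ (u k)) (fun _ => mem_univ _) (by
    intro ε hε
    rcases eq_or_ne ε ⊤ with rfl | hεt
    · obtain ⟨K, hK⟩ := hcauchy 1 one_pos
      refine ⟨K, fun i hi j hj => (key _ _ _ (hK i hi j hj)).trans_lt ?_⟩
      simp
    -- The factor 2 recovers a strict inequality, since `key` gives only a weak one.
    · have h2 : 0 < ε / (2 * ENNReal.ofReal C) := by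
        refine ENNReal.div_pos hε.ne' ?_
        exact ENNReal.mul_ne_top (by simp) ENNReal.ofReal_ne_top
      obtain ⟨K, hK⟩ := hcauchy _ h2
      refine ⟨K, fun i hi j hj => (key _ _ _ (hK i hi j hj)).trans_lt ?_⟩
      have hC0 : ENNReal.ofReal C ≠ 0 := by simpa using hC
      have h3 : ENNReal.ofReal C * (ε / (2 * ENNReal.ofReal C)) = ε / 2 := by
        rw [mul_comm 2, ← mul_div_assoc,
          ENNReal.mul_div_mul_left _ _ hC0 ENNReal.ofReal_ne_top]
      rw [h3]
      exact ENNReal.half_lt_self hε.ne' hεt)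
  refine ⟨S.gauss p, ⟨p, rfl⟩, ?_⟩
  have h1 := (S.gauss_continuous.tendsto p).comp hp
  refine h1.congr fun k => ?_
  exact hσ.right_inv _ (hux k)

end OrientedHypersurface

end HypSurf

/-! ### The tensor P -/

namespace HypSurf

section RadialProjection

variable {n : ℕ}

/-- The radial projection to the sphere, with value `y` at the origin. -/
noncomputable def radialProj (y : Sph n) (z : Euc n) : Sph n :=
  if h : z = 0 then y else ⟨‖z‖⁻¹ • z, by simp [norm_smul, h]⟩

theorem coe_radialProj (y : Sph n) {z : Euc n} (hz : z ≠ 0) :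
    (radialProj y z : Euc n) = ‖z‖⁻¹ • z := by
  rw [radialProj, dif_neg hz]

theorem radialProj_coe (y : Sph n) : radialProj y (y : Euc n) = y := by
  refine Subtype.ext ?_
  rw [coe_radialProj y (ne_zero_of_mem_unit_sphere y), norm_eq_of_mem_sphere, inv_one, one_smul]

theorem radialExt_eq (ρ : Sph n → ℝ) (y : Sph n) {z : Euc n} (hz : z ≠ 0) :
    radialExt ρ z = ρ (radialProj y z) := by
  rw [radialExt, radialProj, dif_neg hz, dif_neg hz]

theorem coe_radialProj_eventuallyEq (y : Sph n) {z : Euc n} (hz : z ≠ 0) :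
    (fun z => (radialProj y z : Euc n)) =ᶠ[𝓝 z] fun z => ‖z‖⁻¹ • z := by
  filter_upwards [isOpen_ne.mem_nhds hz] with z' hz' using coe_radialProj y hz'

theorem contMDiffAt_radialProj (y : Sph n) {z : Euc n} (hz : z ≠ 0) :
    ContMDiffAt 𝓘(ℝ, Euc n) (𝓡 n) ∞ (radialProj y) z := by
  refine contMDiffAt_sphere (ContDiffAt.contMDiffAt ?_)
  refine ContDiffAt.congr_of_eventuallyEq ?_ (coe_radialProj_eventuallyEq y hz)
  exact ((contDiffAt_norm ℝ hz).inv (norm_ne_zero_iff.2 hz)).smul contDiffAt_id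

/-- Both formulas come from differentiating z = ‖z‖ p(z) and ⟨p, p⟩ = 1: the first gives the sum of
the two parts, the second separates them. -/
theorem fderiv_coe_radialProj (y : Sph n) {z : Euc n} (hz : z ≠ 0) (w : Euc n) :
    fderiv ℝ (fun z => (radialProj y z : Euc n)) z w =
      ‖z‖⁻¹ • (w - inner ℝ (radialProj y z : Euc n) w • (radialProj y z : Euc n)) ∧
    fderiv ℝ (fun z : Euc n => ‖z‖) z w = inner ℝ (radialProj y z : Euc n) w := by
  have hz' : ‖z‖ ≠ 0 := norm_ne_zero_iff.2 hz
  set p : Euc n → Euc n := fun z => (radialProj y z : Euc n) with hp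
  have h1 : DifferentiableAt ℝ (fun z : Euc n => ‖z‖) z :=
    (contDiffAt_norm ℝ hz (n := 1)).differentiableAt (by simp)
  have h2 : DifferentiableAt ℝ p z := by
    refine DifferentiableAt.congr_of_eventuallyEq ?_ (coe_radialProj_eventuallyEq y hz)
    exact (h1.inv hz').smul differentiableAt_id
  have h3 : HasFDerivAt (fun z => ‖z‖ • p z) _ z := h1.hasFDerivAt.smul h2.hasFDerivAt
  have h4 : (fun z => ‖z‖ • p z) =ᶠ[𝓝 z] id := by
    filter_upwards [isOpen_ne.mem_nhds hz] with z' hz'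
    simp only [hp, coe_radialProj y hz', id]
    rw [smul_inv_smul₀ (norm_ne_zero_iff.2 hz')]
  have h5 := congrArg (fun L => L w) ((h3.congr_of_eventuallyEq h4.symm).unique (hasFDerivAt_id z))
  have h6 : HasFDerivAt (fun z => inner ℝ (p z) (p z)) _ z := h2.hasFDerivAt.inner ℝ h2.hasFDerivAt
  have hnorm : ∀ z, ‖p z‖ = 1 := fun z => norm_eq_of_mem_sphere _
  have h7 : (fun z => inner ℝ (p z) (p z)) = fun _ => (1 : ℝ) := by
    funext z
    rw [real_inner_self_eq_norm_sq, hnorm, one_pow]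
  rw [h7] at h6
  have h8 := congrArg (fun L => L w) (h6.unique (hasFDerivAt_const 1 z))
  simp only [fderivInnerCLM_apply, ContinuousLinearMap.comp_apply, ContinuousLinearMap.prod_apply,
    _root_.zero_apply, real_inner_comm _ (p z), ← two_mul] at h8
  simp only [_root_.add_apply, _root_.smul_apply,
    ContinuousLinearMap.smulRight_apply, ContinuousLinearMap.id_apply] at h5
  have h8' : inner ℝ (p z) (fderiv ℝ p z w) = 0 := by rw [real_inner_comm]; linarith
  have h9 : fderiv ℝ (fun z : Euc n => ‖z‖) z w = inner ℝ (p z) w := by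
    have h10 := congrArg (inner ℝ (p z)) h5
    rw [inner_add_right, real_inner_smul_right, real_inner_smul_right,
      real_inner_self_eq_norm_sq, hnorm, h8'] at h10
    linarith
  refine ⟨?_, h9⟩
  rw [← h9, eq_inv_smul_iff₀ hz', eq_sub_iff_add_eq]
  exact h5

end RadialProjection

namespace OrientedHypersurface

variable {n : ℕ} {M : Type*} [TopologicalSpace M] [ChartedSpace (EuclideanSpace ℝ (Fin n)) M]
  {S : OrientedHypersurface n M} {x : Sph n} {σ : Sph n → M}

theorem hasFDerivAt_comp_euc {F : Type*} [NormedAddCommGroup F] [NormedSpace ℝ F] {f : M → F}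
    {θ : Euc n → M} {z : Euc n} (hf : MDifferentiableAt (𝓡 n) 𝓘(ℝ, F) f (θ z))
    (hθ : MDifferentiableAt 𝓘(ℝ, Euc n) (𝓡 n) θ z) :
    DifferentiableAt ℝ (fun z => f (θ z)) z ∧ ∀ w : Euc n, fderiv ℝ (fun z => f (θ z)) z w =
      dmap f (θ z) (mfderiv 𝓘(ℝ, Euc n) (𝓡 n) θ z w) := by
  have h := hf.hasMFDerivAt.comp z hθ.hasMFDerivAt
  let L : Euc n →L[ℝ] F :=
    (mfderiv (𝓡 n) 𝓘(ℝ, F) f (θ z)).comp (mfderiv 𝓘(ℝ, Euc n) (𝓡 n) θ z)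
  have h1 : HasFDerivAt (fun z => f (θ z)) L z := hasMFDerivAt_iff_hasFDerivAt.1 h
  refine ⟨h1.differentiableAt, fun w => ?_⟩
  rw [h1.fderiv]
  rfl

variable [IsManifold (𝓡 n) ∞ M] (hσ : S.IsGaussInverse x σ) {κ₀ : ℝ} (hκ₀ : -1 < κ₀)
  (hκ : ∀ (p : M) (κ : ℝ), S.IsPrincipalCurvature p κ → κ₀ ≤ κ)
include hσ hκ₀ hκ

/-- The tensor `P` is expressed by the first fundamental forms of `φ` and of the light cone map. -/
theorem IsGaussInverse.tensorP_eq {y : Sph n} (hy : y ≠ x) {v w : Euc n}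
    (hv : inner ℝ (y : Euc n) v = 0) (hw : inner ℝ (y : Euc n) w = 0) :
    ∃ v' w' : TangentSpace (𝓡 n) (σ y), dmap S.gaussVec (σ y) v' = v ∧
      dmap S.gaussVec (σ y) w' = w ∧
      tensorP (fun y => S.support (σ y)) y v w =
        1 / 2 * (S.lightCone (σ y)).1 ^ 2 * inner ℝ v w -
          mink (dmap S.φ (σ y) v') (dmap S.lightCone (σ y) w') := by
  set θ : Euc n → M := fun z => σ (radialProj y z) with hθ
  set r : Euc n → ℝ := radialExt fun y => S.support (σ y) with hr
  have hy0 : (y : Euc n) ≠ 0 := ne_zero_of_mem_unit_sphere y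
  have hny : ‖(y : Euc n)‖ = 1 := norm_eq_of_mem_sphere y
  have hgood : ∀ᶠ z in 𝓝 (y : Euc n), z ≠ 0 ∧ radialProj y z ≠ x := by
    refine Eventually.and (isOpen_ne.mem_nhds hy0) ?_
    refine (contMDiffAt_radialProj y hy0).continuousAt.eventually (isOpen_ne.mem_nhds ?_)
    rwa [radialProj_coe]
  have hθs : ∀ z, z ≠ 0 → radialProj y z ≠ x → ContMDiffAt 𝓘(ℝ, Euc n) (𝓡 n) ∞ θ z :=
    fun z h1 h2 => (hσ.contMDiffAt hκ₀ hκ h2).comp z (contMDiffAt_radialProj y h1)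
  have hθy : θ y = σ y := by simp only [hθ, radialProj_coe]
  have hreq : ∀ z, z ≠ 0 → r z = S.support (θ z) := fun z hz => radialExt_eq _ y hz
  have hΓ : ∀ z, radialProj y z ≠ x → S.gaussVec (θ z) = radialProj y z := fun z hz => by
    rw [gaussVec, hθ, hσ.right_inv _ hz]
  have hrev : ∀ z, z ≠ 0 → r =ᶠ[𝓝 z] fun z => S.support (θ z) := fun z hz => by
    filter_upwards [isOpen_ne.mem_nhds hz] with z' hz' using hreq z' hz'
  -- the first order identities at a point near the sphere
  have first : ∀ z, z ≠ 0 → radialProj y z ≠ x → ∀ w : Euc n,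
      dmap S.gaussVec (θ z) (mfderiv 𝓘(ℝ, Euc n) (𝓡 n) θ z w) =
        ‖z‖⁻¹ • (w - inner ℝ (radialProj y z : Euc n) w • (radialProj y z : Euc n)) ∧
      fderiv ℝ r z w = dmap S.support (θ z) (mfderiv 𝓘(ℝ, Euc n) (𝓡 n) θ z w) ∧
      inner ℝ (S.φ (θ z)).2 w = ‖z‖ * Real.exp (-r z) * fderiv ℝ r z w +
        inner ℝ (radialProj y z : Euc n) w * ((S.φ (θ z)).1 - Real.exp (-r z)) := by
    intro z hz hzx w
    have hd := (hθs z hz hzx).mdifferentiableAt (by simp)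
    have e1 : dmap S.gaussVec (θ z) (mfderiv 𝓘(ℝ, Euc n) (𝓡 n) θ z w) =
        ‖z‖⁻¹ • (w - inner ℝ (radialProj y z : Euc n) w • (radialProj y z : Euc n)) := by
      rw [← (hasFDerivAt_comp_euc (S.gaussVec_mdiff (θ z)) hd).2 w, ← (fderiv_coe_radialProj y hz w).1]
      refine congrArg (fun L : Euc n →L[ℝ] Euc n => L w) (EventuallyEq.fderiv_eq ?_)
      have h1 : ∀ᶠ z' in 𝓝 z, radialProj y z' ≠ x :=
        (contMDiffAt_radialProj y hz).continuousAt.eventually (isOpen_ne.mem_nhds hzx)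
      filter_upwards [h1] with z' hz' using hΓ z' hz'
    have e2 : fderiv ℝ r z w = dmap S.support (θ z) (mfderiv 𝓘(ℝ, Euc n) (𝓡 n) θ z w) := by
      rw [(hrev z hz).fderiv_eq, (hasFDerivAt_comp_euc (S.support_mdiff (θ z)) hd).2 w]
    refine ⟨e1, e2, ?_⟩
    have e3 := S.mink_φ_dmap_gaussVec (θ z) (mfderiv 𝓘(ℝ, Euc n) (𝓡 n) θ z w)
    have e4 := S.lightCone_fst_mul (θ z)
    have e5 := S.lightCone_pos (θ z)
    rw [e1, ← e2, real_inner_smul_right, inner_sub_right, real_inner_smul_right] at e3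
    rw [hΓ z hzx] at e4
    rw [← e3, hreq z hz, Real.exp_neg, exp_support]
    have hz' : ‖z‖ ≠ 0 := norm_ne_zero_iff.2 hz
    have e6 : (S.φ (θ z)).1 - (S.lightCone (θ z)).1⁻¹ =
        inner ℝ (S.φ (θ z)).2 (radialProj y z : Euc n) := by
      field_simp
      linarith
    rw [e6]
    field_simp
    ring
  have hyx : radialProj y (y : Euc n) ≠ x := by rwa [radialProj_coe]
  have hdy := (hθs y hy0 hyx).mdifferentiableAt (by simp)
  obtain ⟨dΦ, hΦ⟩ := hasFDerivAt_comp_euc (S.φ_mdiff (θ y)) hdy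
  -- second derivatives
  have hrs : ContDiffAt ℝ ∞ r y := by
    refine ContDiffAt.congr_of_eventuallyEq ?_ (hrev y hy0)
    exact ((S.support_smooth (θ y)).comp (y : Euc n) (hθs y hy0 hyx)).contDiffAt
  have hr1 : DifferentiableAt ℝ r y := hrs.differentiableAt (by simp)
  have hr2 : DifferentiableAt ℝ (fderiv ℝ r) y :=
    (hrs.fderiv_right (m := 1) (by norm_cast)).differentiableAt (by simp)
  have hl : HasDerivAt (fun s : ℝ => (y : Euc n) + s • v) v 0 := by
    simpa using ((hasDerivAt_id (0 : ℝ)).smul_const v).const_add (y : Euc n)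
  have e0 : (y : Euc n) + (0 : ℝ) • v = y := by simp
  have comp : ∀ {F : Type} [NormedAddCommGroup F] [NormedSpace ℝ F] {f : Euc n → F},
      DifferentiableAt ℝ f (y : Euc n) →
        HasDerivAt (fun s : ℝ => f ((y : Euc n) + s • v)) (fderiv ℝ f y v) 0 := by
    intro F _ _ f hf
    exact HasFDerivAt.comp_hasDerivAt (0 : ℝ) (by rw [e0]; exact hf.hasFDerivAt) hl
  have dnorm : DifferentiableAt ℝ (fun z : Euc n => ‖z‖) y :=
    (contDiffAt_norm ℝ hy0 (n := 1)).differentiableAt (by simp)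
  have dproj : DifferentiableAt ℝ (fun z => (radialProj y z : Euc n)) y :=
    ((dnorm.inv (norm_ne_zero_iff.2 hy0)).smul differentiableAt_id).congr_of_eventuallyEq
      (coe_radialProj_eventuallyEq y hy0)
  have cfst : HasDerivAt (fun s : ℝ => (S.φ (θ ((y : Euc n) + s • v))).1)
      (fderiv ℝ (fun z => S.φ (θ z)) y v).1 0 := (comp dΦ).fst
  have csnd : HasDerivAt (fun s : ℝ => (S.φ (θ ((y : Euc n) + s • v))).2)
      (fderiv ℝ (fun z => S.φ (θ z)) y v).2 0 := (comp dΦ).snd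
  have c1 := csnd.inner ℝ (hasDerivAt_const (0 : ℝ) w)
  have c2 := (((comp dnorm).mul (comp hr1).neg.exp).mul
    ((comp hr2).clm_apply (hasDerivAt_const (0 : ℝ) w))).add
    (((comp dproj).inner ℝ (hasDerivAt_const (0 : ℝ) w)).mul
      (cfst.sub (comp hr1).neg.exp))
  have hline : Tendsto (fun s : ℝ => (y : Euc n) + s • v) (𝓝 0) (𝓝 (y : Euc n)) := by
    simpa [e0] using hl.continuousAt.tendsto
  -- The formula for ⟨φ', w⟩ holds in a neighbourhood in ℝⁿ⁺¹, so it may be differentiated in the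
  -- direction v. This brings in the Hessian of the radial extension, and φ₀ through the derivative
  -- of the projection.
  have second := c1.unique (c2.congr_of_eventuallyEq <| by
    filter_upwards [hline.eventually hgood] with s hs using (first _ hs.1 hs.2 w).2.2)
  have fy := first y hy0 hyx
  simp only [hΦ, (fderiv_coe_radialProj y hy0 v).1, (fderiv_coe_radialProj y hy0 v).2,
    radialProj_coe, hny, hv, hw, inv_one, one_smul, zero_smul, sub_zero, inner_zero_right, map_zero,
    zero_add, add_zero, zero_mul, one_mul, Pi.neg_apply, Pi.sub_apply,
    Pi.mul_apply] at second fy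
  clear c1 c2 csnd cfst dproj dnorm comp hl hline
  -- the gradient
  set g := sphGrad (fun y => S.support (σ y)) y with hg
  have hgr : ∀ w, inner ℝ g w = fderiv ℝ r y w := fun w => by
    rw [hg, sphGrad, ← hr, gradient, InnerProductSpace.toDual_symm_apply]
  have hψ := S.lightCone_pos (θ y)
  have he : Real.exp (-r y) = (S.lightCone (θ y)).1⁻¹ := by
    rw [hreq y hy0, Real.exp_neg, exp_support]
  have hgy : inner ℝ g (y : Euc n) = 0 := by
    have h2 := S.lightCone_fst_mul (θ y)
    have h3 := (fy y).2.2
    rw [hΓ y hyx, radialProj_coe] at h2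
    rw [real_inner_self_eq_norm_sq, hny, he] at h3
    rw [hgr]
    have h4 : (S.lightCone (θ y)).1⁻¹ * fderiv ℝ r y y = 0 := by
      have : (S.φ (θ y)).1 - inner ℝ (S.φ (θ y)).2 (y : Euc n) = (S.lightCone (θ y)).1⁻¹ := by
        field_simp
        linarith
      linarith
    simpa [hψ.ne'] using h4
  -- The spatial part of φ is a combination of y and the tangential gradient. The hyperboloid
  -- equation then expresses |∇ρ|² through φ₀ and ψ₀, which eliminates φ₀ from the second-order
  -- identity.
  have hφg : (S.φ (θ y)).2 = ((S.φ (θ y)).1 - (S.lightCone (θ y)).1⁻¹) • (y : Euc n) +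
      (S.lightCone (θ y)).1⁻¹ • g := by
    refine ext_inner_right ℝ fun u => ?_
    rw [(fy u).2.2, inner_add_left, real_inner_smul_left, real_inner_smul_left, hgr, he]
    ring
  have hng := norm_snd_sq_of_mem_hyperboloid (S.φ_mem (θ y))
  have hng' : ‖(S.φ (θ y)).2‖ ^ 2 = ((S.φ (θ y)).1 - (S.lightCone (θ y)).1⁻¹) ^ 2 +
      (S.lightCone (θ y)).1⁻¹ ^ 2 * ‖g‖ ^ 2 := by
    rw [hφg, norm_add_sq_real, norm_smul, norm_smul, mul_pow, mul_pow, hny, real_inner_smul_left,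
      real_inner_smul_right, real_inner_comm, hgy]
    simp only [Real.norm_eq_abs, sq_abs]
    ring
  have hmink : mink (dmap S.φ (θ y) (mfderiv 𝓘(ℝ, Euc n) (𝓡 n) θ y v))
      (dmap S.lightCone (θ y) (mfderiv 𝓘(ℝ, Euc n) (𝓡 n) θ y w)) =
      (S.lightCone (θ y)).1 * inner ℝ
        (dmap S.φ (θ y) (mfderiv 𝓘(ℝ, Euc n) (𝓡 n) θ y v)).2 w := by
    rw [S.dmap_lightCone_eq, (fy w).1, hw, zero_smul, sub_zero, mink_add_right, mink_smul_right,
      mink_smul_right, lightCone, mink_sub_right, S.mink_dφ_φ, S.mink_dφ_η]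
    simp [mink]
  rw [← hθy]
  refine ⟨mfderiv 𝓘(ℝ, Euc n) (𝓡 n) θ y v, mfderiv 𝓘(ℝ, Euc n) (𝓡 n) θ y w, ?_, ?_, ?_⟩
  · rw [(fy v).1, hv, zero_smul, sub_zero]
  · rw [(fy w).1, hw, zero_smul, sub_zero]
  rw [hmink, second, tensorP, ← hg, hgr, hgr, sphHess, ← hr, he]
  change -fderiv ℝ (fderiv ℝ r) y v w + _ - _ = _
  have h5 : ‖g‖ ^ 2 = 2 * (S.lightCone (θ y)).1 * (S.φ (θ y)).1 - 1 - (S.lightCone (θ y)).1 ^ 2 := by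
    rw [hng] at hng'
    field_simp at hng'
    linarith
  rw [h5]
  field_simp
  ring

/-- The tensor `P` is bounded for the conformal metric of the hypersurface. -/
theorem IsGaussInverse.boundedP : BoundedP (range S.gauss) (fun y => S.support (σ y)) := by
  refine ⟨1 / 2 + (1 + κ₀)⁻¹, fun y hy v w hv hw => ?_⟩
  rw [hσ.range_eq] at hy
  obtain ⟨v', w', hv', hw', h⟩ := hσ.tensorP_eq hκ₀ hκ hy hv hw
  have hψ := S.lightCone_pos (σ y)
  rw [h, S.exp_support]
  have h1 := abs_mink_le_of_orthogonal (S.φ_mem (σ y)) (S.mink_dφ_φ (σ y) v')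
    (S.mink_dlightCone_φ (σ y) w')
  have h2 := S.norm_dφ_le_gauss hκ₀ hκ (σ y) v'
  have h3 := S.sqrt_mink_dlightCone (σ y) w'
  rw [hv'] at h2
  rw [hw'] at h3
  rw [h3] at h1
  have h4 : |1 / 2 * (S.lightCone (σ y)).1 ^ 2 * inner ℝ v w| ≤
      1 / 2 * ((S.lightCone (σ y)).1 * ‖v‖) * ((S.lightCone (σ y)).1 * ‖w‖) := by
    rw [abs_mul, abs_of_pos (by positivity)]
    calc _ ≤ 1 / 2 * (S.lightCone (σ y)).1 ^ 2 * (‖v‖ * ‖w‖) := by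
          gcongr
          exact abs_real_inner_le_norm v w
      _ = _ := by ring
  calc _ ≤ _ := abs_sub _ _
    _ ≤ 1 / 2 * ((S.lightCone (σ y)).1 * ‖v‖) * ((S.lightCone (σ y)).1 * ‖w‖) +
        (1 + κ₀)⁻¹ * ((S.lightCone (σ y)).1 * ‖v‖) * ((S.lightCone (σ y)).1 * ‖w‖) :=
      add_le_add h4 (h1.trans (mul_le_mul_of_nonneg_right h2 (by positivity)))
    _ = _ := by ring

end OrientedHypersurface

end HypSurf

/-! ### Great-circle arcs, the normal flow and growth near x -/

namespace HypSurf

section Arc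

variable {n : ℕ}

/-- The arc of a great circle from `y` to `z`, for `z ≠ -y`, as the radial projection of a
segment. -/
noncomputable def arc (y z : Sph n) (s : ℝ) : Sph n :=
  radialProj y ((y : Euc n) + s • ((z : Euc n) - y))

theorem arc_zero (y z : Sph n) : arc y z 0 = y := by
  rw [arc, zero_smul, add_zero, radialProj_coe]

theorem arc_one (y z : Sph n) : arc y z 1 = z := by
  refine Subtype.ext ?_
  rw [arc, one_smul, add_sub_cancel, coe_radialProj _ (ne_zero_of_mem_unit_sphere z),
    norm_eq_of_mem_sphere, inv_one, one_smul]

theorem norm_segment_sq (y z : Sph n) (s : ℝ) :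
    ‖(y : Euc n) + s • ((z : Euc n) - y)‖ ^ 2 =
      1 - 2 * s * (1 - s) * (1 - inner ℝ (y : Euc n) z) := by
  have e : (y : Euc n) + s • ((z : Euc n) - y) = (1 - s) • (y : Euc n) + s • (z : Euc n) := by
    module
  rw [e, norm_add_sq_real, norm_smul, norm_smul, mul_pow, mul_pow, norm_eq_of_mem_sphere,
    norm_eq_of_mem_sphere, real_inner_smul_left, real_inner_smul_right, Real.norm_eq_abs,
    Real.norm_eq_abs, sq_abs, sq_abs]
  ring

theorem inner_le_one_of_sphere (y z : Sph n) : inner ℝ (y : Euc n) (z : Euc n) ≤ 1 := by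
  have := real_inner_le_norm (y : Euc n) z
  rwa [norm_eq_of_mem_sphere, norm_eq_of_mem_sphere, mul_one] at this

theorem inner_lt_one_of_sphere {y z : Sph n} (h : y ≠ z) :
    inner ℝ (y : Euc n) (z : Euc n) < 1 :=
  (inner_le_one_of_sphere y z).lt_of_ne fun h' => h <| Subtype.ext <|
    (inner_eq_one_iff_of_norm_eq_one (norm_eq_of_mem_sphere y) (norm_eq_of_mem_sphere z)).1 h'

variable {y z : Sph n} (hyz : 1 / 8 ≤ 1 + inner ℝ (y : Euc n) (z : Euc n)) {s : ℝ}
include hyz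

/-- Since 2s(1 - s) ≤ 1/2, the squared norm is at least (1 + ⟨y, z⟩)/2 ≥ 1/16. The margin 1/8 keeps
chords between nearly antipodal points out. -/
theorem le_norm_segment : 1 / 4 ≤ ‖(y : Euc n) + s • ((z : Euc n) - y)‖ := by
  refine abs_le_of_sq_le_sq' ?_ (norm_nonneg _) |>.2
  rw [norm_segment_sq]
  have := inner_le_one_of_sphere y z
  nlinarith [mul_nonneg (sq_nonneg (2 * s - 1)) (sub_nonneg.2 this)]

theorem segment_ne_zero : (y : Euc n) + s • ((z : Euc n) - y) ≠ 0 := by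
  have := le_norm_segment hyz (s := s)
  rw [← norm_pos_iff]
  linarith

theorem norm_segment_smul_arc :
    ‖(y : Euc n) + s • ((z : Euc n) - y)‖ • (arc y z s : Euc n) =
      (y : Euc n) + s • ((z : Euc n) - y) := by
  have h := segment_ne_zero hyz (s := s)
  rw [arc, coe_radialProj _ h, smul_inv_smul₀ (norm_ne_zero_iff.2 h)]

theorem contMDiffAt_arc : ContMDiffAt 𝓘(ℝ, ℝ) (𝓡 n) ∞ (arc y z) s := by
  have h : ContDiff ℝ ∞ fun s : ℝ => (y : Euc n) + s • ((z : Euc n) - y) := by fun_prop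
  exact (contMDiffAt_radialProj y (segment_ne_zero hyz)).comp s h.contMDiff.contMDiffAt

theorem hasDerivAt_arc : ∃ c' : Euc n, HasDerivAt (fun s => (arc y z s : Euc n)) c' s ∧
    ‖c'‖ ≤ 8 * ‖(z : Euc n) - y‖ := by
  have h := segment_ne_zero hyz (s := s)
  have hl : HasDerivAt (fun s : ℝ => (y : Euc n) + s • ((z : Euc n) - y)) ((z : Euc n) - y) s := by
    simpa using ((hasDerivAt_id s).smul_const ((z : Euc n) - y)).const_add (y : Euc n)
  have hd : DifferentiableAt ℝ (fun z => (radialProj y z : Euc n))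
      ((y : Euc n) + s • ((z : Euc n) - y)) := by
    refine DifferentiableAt.congr_of_eventuallyEq ?_ (coe_radialProj_eventuallyEq y h)
    exact (((contDiffAt_norm ℝ h (n := 1)).differentiableAt (by simp)).inv
      (norm_ne_zero_iff.2 h)).smul differentiableAt_id
  have hh := hd.hasFDerivAt.comp_hasDerivAt s hl
  refine ⟨_, hh, ?_⟩
  rw [(fderiv_coe_radialProj y h _).1, norm_smul, norm_inv, norm_norm]
  set p : Euc n := (radialProj y ((y : Euc n) + s • ((z : Euc n) - y)) : Euc n) with hp
  have h1 : ‖p‖ = 1 := norm_eq_of_mem_sphere _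
  set w : Euc n := (z : Euc n) - y with hw
  have h2 : ‖w - inner ℝ p w • p‖ ≤ 2 * ‖w‖ := by
    refine (norm_sub_le _ _).trans ?_
    rw [norm_smul, h1, mul_one]
    have := norm_inner_le_norm (𝕜 := ℝ) p w
    rw [h1] at this
    linarith
  have h3 : ‖(y : Euc n) + s • w‖⁻¹ ≤ 4 := by
    have := inv_anti₀ (by norm_num) (le_norm_segment hyz (s := s))
    norm_num at this
    exact this
  calc _ ≤ 4 * (2 * ‖w‖) := by gcongr
    _ = _ := by ring

theorem inner_le_inner_arc (hs : s ∈ Icc (0 : ℝ) 1) :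
    inner ℝ (y : Euc n) (z : Euc n) ≤ inner ℝ (y : Euc n) (arc y z s) := by
  have h0 := norm_segment_smul_arc hyz (s := s)
  set c : Euc n := (arc y z s : Euc n) with hc
  set m : Euc n := (y : Euc n) + s • ((z : Euc n) - y) with hm
  have hy : inner ℝ (y : Euc n) y = (1 : ℝ) := by
    rw [real_inner_self_eq_norm_sq, norm_eq_of_mem_sphere, one_pow]
  have hz : inner ℝ (z : Euc n) z = (1 : ℝ) := by
    rw [real_inner_self_eq_norm_sq, norm_eq_of_mem_sphere, one_pow]
  have h1 : ‖m‖ ≤ 1 := by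
    refine (sq_le_one_iff₀ (norm_nonneg _)).1 ?_
    rw [hm, norm_segment_sq]
    have := inner_le_one_of_sphere y z
    have h2 := mul_nonneg (mul_nonneg hs.1 (sub_nonneg.2 hs.2)) (sub_nonneg.2 this)
    linarith
  have h2 : ‖m‖ * inner ℝ (y : Euc n) c = 1 - s + s * inner ℝ (y : Euc n) (z : Euc n) := by
    rw [← real_inner_smul_right, h0, hm, inner_add_right, real_inner_smul_right, inner_sub_right,
      hy]
    ring
  have h3 : (1 - s) * inner ℝ (y : Euc n) (z : Euc n) + s ≤ ‖m‖ := by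
    have := real_inner_le_norm (z : Euc n) m
    rw [norm_eq_of_mem_sphere, one_mul, hm, inner_add_right, real_inner_smul_right,
      inner_sub_right, hz, real_inner_comm] at this
    linarith
  have h4 : -1 ≤ inner ℝ (y : Euc n) c := by
    have := neg_le_of_abs_le (abs_real_inner_le_norm (y : Euc n) c)
    rwa [hc, norm_eq_of_mem_sphere, norm_eq_of_mem_sphere, mul_one] at this
  -- Expanding (1 - ‖m‖)(1 + ⟨y, c⟩) ≥ 0 and inserting the bounds for ‖m‖⟨y, c⟩ and ‖m‖ leaves
  -- exactly ⟨y, z⟩ ≤ ⟨y, c⟩.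
  nlinarith [mul_nonneg (sub_nonneg.2 h1) (by linarith : 0 ≤ 1 + inner ℝ (y : Euc n) c)]

/-- A coincidence would give equality in Cauchy–Schwarz between z and the chord point, whose defect
is (1 - s)²(1 - ⟨y, z⟩²) > 0. -/
theorem arc_ne (hne : y ≠ z) (hs : s < 1) : arc y z s ≠ z := by
  intro h
  have h0 := norm_segment_smul_arc hyz (s := s)
  rw [h] at h0
  have hz : inner ℝ (z : Euc n) z = (1 : ℝ) := by
    rw [real_inner_self_eq_norm_sq, norm_eq_of_mem_sphere, one_pow]
  have h1 := congrArg (inner ℝ (z : Euc n)) h0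
  rw [real_inner_smul_right, inner_add_right, real_inner_smul_right, inner_sub_right, hz,
    real_inner_comm, mul_one] at h1
  have h2 := norm_segment_sq y z s
  rw [h1] at h2
  have h3 := inner_lt_one_of_sphere hne
  have h4 : (1 - s) ^ 2 * ((1 - inner ℝ (y : Euc n) (z : Euc n)) *
    (1 + inner ℝ (y : Euc n) (z : Euc n))) = 0 := by linarith
  have h5 : 0 < (1 - s) ^ 2 * ((1 - inner ℝ (y : Euc n) (z : Euc n)) *
    (1 + inner ℝ (y : Euc n) (z : Euc n))) :=
    mul_pos (pow_pos (by linarith) 2) (mul_pos (by linarith) (by linarith))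
  linarith

end Arc

namespace OrientedHypersurface

variable {n : ℕ} {M : Type*} [TopologicalSpace M] [ChartedSpace (EuclideanSpace ℝ (Fin n)) M]
  (S : OrientedHypersurface n M)

theorem abs_η_fst_le (p : M) : |(S.η p).1| ≤ (S.φ p).1 := by
  have h := norm_le_of_orthogonal (S.φ_mem p) (S.η_tangent p)
  rw [S.η_unit, Real.sqrt_one, mul_one] at h
  exact (norm_fst_le (S.η p)).trans h

theorem flow_fst (t : ℝ) (p : M) : (S.flow t p).1 =
    1 / 2 * (Real.exp t * ((S.φ p).1 - (S.η p).1) + Real.exp (-t) * ((S.φ p).1 + (S.η p).1)) := by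
  rw [flow, Prod.fst_sub, Prod.smul_fst, Prod.smul_fst, Real.cosh_eq, Real.sinh_eq, smul_eq_mul,
    smul_eq_mul]
  ring

theorem flow_mem (t : ℝ) (p : M) : S.flow t p ∈ hyperboloid n := by
  constructor
  · rw [flow]
    simp only [mink_sub_left, mink_sub_right, mink_smul_left, mink_smul_right, S.mink_φ_η,
      S.η_tangent, S.η_unit, (S.φ_mem p).1]
    linarith [Real.cosh_sq t]
  · rw [flow_fst]
    have h1 := S.lightCone_pos p
    have h2 := abs_le.1 (S.abs_η_fst_le p)
    rw [lightCone, Prod.fst_sub] at h1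
    have h3 := mul_pos (Real.exp_pos t) h1
    have h4 := mul_nonneg (Real.exp_pos (-t)).le (by linarith [h2.1] : 0 ≤ (S.φ p).1 + (S.η p).1)
    linarith

/-- Here 2eᵗφᵗ₀ = e²ᵗ(φ₀ - η₀) + (φ₀ + η₀), and φ₀ - η₀ = ψ₀ > 0. This transfers the growth of φ to
each φᵗ. -/
theorem φ_fst_le_flow {t : ℝ} (ht : 0 ≤ t) (p : M) :
    (S.φ p).1 ≤ Real.exp t * (S.flow t p).1 := by
  have h1 := S.lightCone_pos p
  rw [lightCone, Prod.fst_sub] at h1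
  have h2 : Real.exp t * Real.exp (-t) = 1 := by rw [← Real.exp_add, add_neg_cancel, Real.exp_zero]
  have h3 : Real.exp t * (S.flow t p).1 = 1 / 2 * (Real.exp t ^ 2 * ((S.φ p).1 - (S.η p).1) +
      ((S.φ p).1 + (S.η p).1)) := by
    rw [flow_fst]
    linear_combination 1 / 2 * ((S.φ p).1 + (S.η p).1) * h2
  have h4 : 1 ≤ Real.exp t ^ 2 := one_le_pow₀ (Real.one_le_exp ht)
  rw [h3]
  nlinarith [mul_nonneg (sub_nonneg.2 h4) h1.le]

theorem flow_smooth (t : ℝ) : ContMDiff (𝓡 n) 𝓘(ℝ, Mink n) ∞ (S.flow t) :=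
  ((contDiff_const_smul (𝕜 := ℝ) (Real.cosh t)).contMDiff.comp S.φ_smooth).sub
    ((contDiff_const_smul (𝕜 := ℝ) (Real.sinh t)).contMDiff.comp S.η_smooth)

theorem dmap_flow (t : ℝ) (p : M) (v : TangentSpace (𝓡 n) p) :
    dmap (S.flow t) p v = Real.cosh t • dmap S.φ p v - Real.sinh t • dmap S.η p v :=
  dmap_eq_of_hasDerivAt ((S.flow_smooth t).mdifferentiable (by simp) p)
    (((hasDerivAt_chartCurve (S.φ_mdiff p) v).const_smul (Real.cosh t)).sub
      ((hasDerivAt_chartCurve (S.η_mdiff p) v).const_smul (Real.sinh t)))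

variable [IsManifold (𝓡 n) ∞ M] {κ₀ : ℝ} (hκ₀ : -1 < κ₀)
  (hκ : ∀ (p : M) (κ : ℝ), S.IsPrincipalCurvature p κ → κ₀ ≤ κ)
include hκ₀ hκ

/-- Pairing dφᵗ(v) with dφ(v) gives at least (cosh t + κ₀ sinh t) |dφ(v)|², which is positive
because κ₀ > -1 and t ≥ 0. -/
theorem isImmersed_flow {t : ℝ} (ht : 0 ≤ t) : IsImmersed (n := n) (S.flow t) := by
  refine ⟨S.flow_smooth t, fun p => ?_⟩
  have hker : ∀ v : TangentSpace (𝓡 n) p, dmap (S.flow t) p v = 0 → v = 0 := by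
    intro v hv
    rw [dmap_flow] at hv
    by_contra hv0
    have h1 := S.mink_dφ_self_pos p hv0
    have h2 := S.le_neg_mink_dη_dφ p (hκ p) v
    have h3 := congrArg (fun a => mink a (dmap S.φ p v)) hv
    simp only [mink_sub_left, mink_smul_left, mink_zero_left] at h3
    have h4 := Real.sinh_nonneg_iff.2 ht
    have h5 := Real.sinh_lt_cosh t
    nlinarith [mul_le_mul_of_nonneg_left h2 h4, mul_pos (sub_pos.2 h5) h1,
      mul_nonneg (mul_nonneg h4 (by linarith : 0 ≤ 1 + κ₀)) h1.le]
  have hinj : Function.Injective (dmapLinear (n := n) (S.flow t) p) :=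
    (injective_iff_map_eq_zero _).2 hker
  exact hinj

variable {S} {x : Sph n} {σ : Sph n → M} (hσ : S.IsGaussInverse x σ)
include hσ

theorem IsGaussInverse.mdifferentiableAt_arc {y z : Sph n}
    (hyz : 1 / 8 ≤ 1 + inner ℝ (y : Euc n) (z : Euc n)) {s : ℝ} (h : arc y z s ≠ x) :
    MDifferentiableAt 𝓘(ℝ, ℝ) (𝓡 n) (fun s => σ (arc y z s)) s :=
  ((hσ.contMDiffAt hκ₀ hκ h).comp s (contMDiffAt_arc hyz)).mdifferentiableAt (by simp)

theorem IsGaussInverse.dmap_gaussVec_arc {y z : Sph n}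
    (hyz : 1 / 8 ≤ 1 + inner ℝ (y : Euc n) (z : Euc n)) {s : ℝ} (h : arc y z s ≠ x) :
    ‖dmap S.gaussVec (σ (arc y z s))
      (mfderiv 𝓘(ℝ, ℝ) (𝓡 n) (fun s => σ (arc y z s)) s (1 : ℝ))‖ ≤ 8 * ‖(z : Euc n) - y‖ := by
  obtain ⟨c', hc', hle⟩ := hasDerivAt_arc hyz (s := s)
  have h1 := hasDerivAt_comp_curve (S.gaussVec_mdiff (σ (arc y z s)))
    (hσ.mdifferentiableAt_arc hκ₀ hκ hyz h)
  have h2 : (fun s => S.gaussVec (σ (arc y z s))) =ᶠ[𝓝 s] fun s => (arc y z s : Euc n) := by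
    have : ∀ᶠ s' in 𝓝 s, arc y z s' ≠ x :=
      (contMDiffAt_arc hyz).continuousAt.eventually (isOpen_ne.mem_nhds h)
    filter_upwards [this] with s' hs'
    rw [gaussVec, hσ.right_inv _ hs']
  rw [h1.unique (hc'.congr_of_eventuallyEq h2)]
  exact hle

/-- The support function is unbounded along the arcs that end at the missing point. -/
theorem IsGaussInverse.exists_lightCone_gt (hcomplete : S.IsComplete) {y : Sph n} (hy : y ≠ x)
    (hyx : 1 / 8 ≤ 1 + inner ℝ (y : Euc n) (x : Euc n)) (B : ℝ) :
    ∃ s ∈ Ioo (0 : ℝ) 1, B < (S.lightCone (σ (arc y x s))).1 := by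
  by_contra! hB
  have hne : ∀ s ∈ Ioo (0 : ℝ) 1, arc y x s ≠ x := fun s hs => arc_ne hyx hy hs.2
  obtain ⟨p, -, -, -, -, hp⟩ := S.exists_tendsto_of_lift hκ₀ hκ hcomplete (zero_lt_one' ℝ)
    (γ := fun s => σ (arc y x s)) (c := arc y x)
    (fun s hs => (hσ.mdifferentiableAt_arc hκ₀ hκ hyx (hne s hs)).continuousAt)
    (fun s _ => (contMDiffAt_arc hyx).of_le (by simp)) (contMDiffAt_arc hyx).continuousAt
    (fun s hs => hσ.right_inv _ (hne s hs)) (K := 8 * ‖(x : Euc n) - y‖)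
    (fun s _ => by
      obtain ⟨c', hc', hle⟩ := hasDerivAt_arc hyx (s := s)
      rwa [hc'.deriv]) hB
  rw [arc_one] at hp
  exact hσ.ne p hp

/-- The hypersurface leaves every compact set at the missing point. -/
theorem IsGaussInverse.one_le_mul_φ_fst (hcomplete : S.IsComplete) {y : Sph n} (hy : y ≠ x)
    (hyx : 1 / 8 ≤ 1 + inner ℝ (y : Euc n) (x : Euc n)) :
    1 ≤ 16 * (1 + κ₀)⁻¹ * ‖(x : Euc n) - y‖ * (S.φ (σ y)).1 := by
  set K := 16 * (1 + κ₀)⁻¹ * ‖(x : Euc n) - y‖ with hK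
  have hpos : ∀ p, 0 < (S.φ p).1 := fun p => (S.φ_mem p).2
  -- Along the arc to x, 1/φ₀ is Lipschitz: |φ₀'| ≤ φ₀ |dφ|, |dφ| ≤ (1 + κ₀)⁻¹ ψ₀ · 8‖x - y‖ and ψ₀
  -- ≤ 2φ₀ make the quotient by φ₀² at most K. It also becomes arbitrarily small along the arc, so
  -- its initial value is at most K.
  set f : ℝ → ℝ := fun s => ((S.φ (σ (arc y x s))).1)⁻¹ with hf
  have hC : 0 ≤ (1 + κ₀)⁻¹ := inv_nonneg.2 (by linarith)
  have hderiv : ∀ s < 1, ∃ f', HasDerivAt f f' s ∧ ‖f'‖ ≤ K := by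
    intro s hs
    have hne := arc_ne hyx hy hs
    set v := mfderiv 𝓘(ℝ, ℝ) (𝓡 n) (fun s => σ (arc y x s)) s (1 : ℝ) with hv
    have h1 := hasDerivAt_comp_curve (S.φ_mdiff (σ (arc y x s)))
      (hσ.mdifferentiableAt_arc hκ₀ hκ hyx hne)
    have h2 : HasDerivAt (fun s => (S.φ (σ (arc y x s))).1) (dmap S.φ (σ (arc y x s)) v).1 s :=
      h1.fst
    refine ⟨_, h2.inv (hpos _).ne', ?_⟩
    have h3 := norm_le_of_orthogonal (S.φ_mem (σ (arc y x s))) (S.mink_dφ_φ _ v)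
    have h4 := S.norm_dφ_le_gauss hκ₀ hκ (σ (arc y x s)) v
    have h5 := hσ.dmap_gaussVec_arc hκ₀ hκ hyx hne
    have h6 := S.lightCone_fst_le (σ (arc y x s))
    have h0 := hpos (σ (arc y x s))
    rw [norm_div, norm_neg, norm_pow, Real.norm_of_nonneg h0.le, div_le_iff₀ (by positivity)]
    calc _ ≤ ‖dmap S.φ (σ (arc y x s)) v‖ := norm_fst_le _
      _ ≤ _ := h3
      _ ≤ (S.φ (σ (arc y x s))).1 * ((1 + κ₀)⁻¹ *
          (2 * (S.φ (σ (arc y x s))).1 * (8 * ‖(x : Euc n) - y‖))) := by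
        refine mul_le_mul_of_nonneg_left (h4.trans ?_) h0.le
        gcongr
      _ = _ := by rw [hK]; ring
  by_contra! hlt
  have hf0 : K < f 0 := by
    simp only [hf, arc_zero]
    rwa [← one_div, lt_div_iff₀ (hpos _)]
  obtain ⟨s, hs, hsB⟩ := hσ.exists_lightCone_gt hκ₀ hκ hcomplete hy hyx (2 * (f 0 - K)⁻¹)
  have h1 : f s < f 0 - K := by
    refine inv_lt_of_inv_lt₀ (sub_pos.2 hf0) ?_
    linarith [S.lightCone_fst_le (σ (arc y x s))]
  choose! f' hf' hle using hderiv
  have h2 := norm_image_sub_le_of_norm_deriv_le_segment' (a := 0) (b := s)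
    (fun τ hτ => (hf' τ (hτ.2.trans_lt hs.2)).hasDerivWithinAt)
    (fun τ hτ => hle τ (hτ.2.trans hs.2)) s (right_mem_Icc.2 hs.1.le)
  have h3 : K * (s - 0) ≤ K := by
    have : 0 ≤ K := by positivity
    nlinarith [hs.2]
  have h4 := neg_le_of_abs_le (h2.trans h3)
  linarith

end OrientedHypersurface

end HypSurf

/-! ### The dual light cone map and double points at the origin -/

namespace HypSurf

namespace OrientedHypersurface

variable {n : ℕ} {M : Type*} [TopologicalSpace M] [ChartedSpace (EuclideanSpace ℝ (Fin n)) M]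
  (S : OrientedHypersurface n M)

/-- The light cone map of the opposite orientation, normalised along the normal flow. -/
noncomputable def dualCone (t : ℝ) (p : M) : Mink n := Real.exp (-t) • (S.φ p + S.η p)

theorem two_smul_flow (t : ℝ) (p : M) :
    (2 : ℝ) • S.flow t p = Real.exp t • S.lightCone p + S.dualCone t p := by
  rw [flow, dualCone, lightCone, Real.cosh_eq, Real.sinh_eq]
  module

theorem mink_dualCone_self (t : ℝ) (p : M) : mink (S.dualCone t p) (S.dualCone t p) = 0 := by
  rw [dualCone]
  simp only [mink_smul_left, mink_smul_right, mink_add_left, mink_add_right, S.mink_φ_η,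
    S.η_tangent, S.η_unit, (S.φ_mem p).1]
  ring

theorem mink_dualCone_lightCone (t : ℝ) (p : M) :
    Real.exp t * mink (S.dualCone t p) (S.lightCone p) = -2 := by
  have h2 : Real.exp t * Real.exp (-t) = 1 := by rw [← Real.exp_add, add_neg_cancel, Real.exp_zero]
  rw [dualCone, lightCone]
  simp only [mink_smul_left, mink_add_left, mink_sub_right, S.mink_φ_η,
    S.η_tangent, S.η_unit, (S.φ_mem p).1]
  linear_combination -2 * h2

theorem dualCone_mdiff (t : ℝ) (p : M) :
    MDifferentiableAt (𝓡 n) 𝓘(ℝ, Mink n) (S.dualCone t) p :=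
  ((contDiff_const_smul (𝕜 := ℝ) (Real.exp (-t))).contMDiff.comp
    (S.φ_smooth.add S.η_smooth)).mdifferentiable (n := ∞) (by simp) p

theorem dmap_dualCone (t : ℝ) (p : M) (v : TangentSpace (𝓡 n) p) :
    dmap (S.dualCone t) p v = Real.exp (-t) • (dmap S.φ p v + dmap S.η p v) :=
  dmap_eq_of_hasDerivAt (S.dualCone_mdiff t p)
    (((hasDerivAt_chartCurve (S.φ_mdiff p) v).add
      (hasDerivAt_chartCurve (S.η_mdiff p) v)).const_smul (Real.exp (-t)))

/-- With k = eᵗψ₀, the relation 2(1, 0) = k(1, G) + D and the nullity of D give (2 - k)² = k², so k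
= 1. -/
theorem dualCone_of_flow_eq_origin {t : ℝ} {p : M} (h : S.flow t p = origin n) :
    S.dualCone t p = (1, -S.gaussVec p) := by
  set k := Real.exp t * (S.lightCone p).1 with hk
  have hk0 : 0 < k := mul_pos (Real.exp_pos t) (S.lightCone_pos p)
  have h1 := S.two_smul_flow t p
  have h2 : Real.exp t • S.lightCone p = k • ((1 : ℝ), S.gaussVec p) := by
    rw [S.lightCone_eq p, smul_smul]
  have h3 : S.dualCone t p = (2 - k, -(k • S.gaussVec p)) := by
    rw [h, h2] at h1
    rw [eq_sub_of_add_eq' h1.symm]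
    refine Prod.ext ?_ ?_ <;> simp [origin]
  have h4 := S.mink_dualCone_self t p
  rw [h3] at h4
  simp only [mink, inner_neg_neg, real_inner_self_eq_norm_sq, norm_smul, S.norm_gaussVec,
    Real.norm_of_nonneg hk0.le] at h4
  have h5 : k = 1 := by nlinarith
  rw [h3, h5, one_smul]
  norm_num

/-- Near a dual light cone vector, the light cone vectors of close directions are bounded. -/
theorem bounds_of_dualCone_near {t : ℝ} {q : M} {y : Sph n}
    (h : ‖S.dualCone t q - (1, -(y : Euc n))‖ ≤ 1 / 32)
    (hy : 1 / 8 ≤ 1 + inner ℝ (y : Euc n) (S.gaussVec q)) :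
    Real.exp t * (S.lightCone q).1 ≤ 32 ∧ (S.flow t q).1 ≤ 17 := by
  set k := Real.exp t * (S.lightCone q).1 with hk
  have hk0 : 0 < k := mul_pos (Real.exp_pos t) (S.lightCone_pos q)
  have h1 : |(S.dualCone t q).1 - 1| ≤ 1 / 32 := (norm_fst_le _).trans h
  have h2 : ‖(S.dualCone t q).2 + (y : Euc n)‖ ≤ 1 / 32 := by
    simpa using (norm_snd_le _).trans h
  have h3 := S.mink_dualCone_lightCone t q
  rw [S.lightCone_eq q, mink_smul_right, ← mul_assoc, ← hk, mink] at h3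
  simp only [mul_one] at h3
  have h4 := (real_inner_le_norm ((S.dualCone t q).2 + (y : Euc n)) (S.gaussVec q)).trans
    (mul_le_mul_of_nonneg_right h2 (norm_nonneg _))
  rw [S.norm_gaussVec, inner_add_left] at h4
  have h5 := abs_le.1 h1
  -- Here k (D₀ - ⟨D', G⟩) = 2, and the bracket is at least 31/32 - 1/32 + ⟨y, G⟩ ≥ 15/16 - 7/8 =
  -- 1/16.
  have h6 : k ≤ 32 := by nlinarith
  refine ⟨h6, ?_⟩
  have h7 := congrArg Prod.fst (S.two_smul_flow t q)
  simp only [Prod.smul_fst, Prod.fst_add, smul_eq_mul] at h7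
  linarith

variable [IsManifold (𝓡 n) ∞ M] {κ₀ : ℝ} (hκ₀ : -1 < κ₀)
  (hκ : ∀ (p : M) (κ : ℝ), S.IsPrincipalCurvature p κ → κ₀ ≤ κ)
include hκ₀ hκ

/-- The derivative of D is orthogonal to φᵗ as well as to φ; using φᵗ makes the conversion factor
φᵗ₀, which stays bounded in the bootstrap. -/
theorem norm_dmap_dualCone_le (t : ℝ) (p : M) (v : TangentSpace (𝓡 n) p) :
    ‖dmap (S.dualCone t) p v‖ ≤ (S.flow t p).1 * (Real.exp (-t) *
      ((2 * (1 + κ₀)⁻¹ + 1) * ((S.lightCone p).1 * ‖dmap S.gaussVec p v‖))) := by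
  have h1 : mink (dmap (S.dualCone t) p v) (S.flow t p) = 0 := by
    rw [dmap_dualCone, flow]
    simp only [mink_smul_left, mink_smul_right, mink_add_left, mink_sub_right, S.mink_dφ_φ,
      S.mink_dη_φ, S.mink_dφ_η, S.mink_dη_η]
    ring
  refine (norm_le_of_orthogonal (S.flow_mem t p) h1).trans ?_
  refine mul_le_mul_of_nonneg_left ?_ (S.flow_mem t p).2.le
  rw [dmap_dualCone, sqrt_mink_smul, abs_of_pos (Real.exp_pos _), ← sqrt_mink_dlightCone]
  exact mul_le_mul_of_nonneg_left (S.norm_dφ_add_dη_le hκ₀ hκ p v) (Real.exp_pos _).le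

variable {S} {x : Sph n} {σ : Sph n → M} (hσ : S.IsGaussInverse x σ)
include hσ

/-- Along an arc of Gauss images, the dual light cone map of a late parallel hypersurface
hardly moves. -/
theorem IsGaussInverse.dualCone_drift {t : ℝ}
    (ht : 2 ^ 20 * (2 * (1 + κ₀)⁻¹ + 1) ≤ Real.exp (2 * t)) {p : M} (hp : S.flow t p = origin n)
    {z : Sph n} (hz : 1 / 8 ≤ 1 + inner ℝ (S.gauss p : Euc n) (z : Euc n)) (hne : S.gauss p ≠ z)
    {b : ℝ} (hb : b ≤ 1) (havoid : ∀ s ∈ Icc 0 b, arc (S.gauss p) z s ≠ x) :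
    ∀ s ∈ Icc 0 b, Real.exp t * (S.lightCone (σ (arc (S.gauss p) z s))).1 ≤ 32 ∧
      ‖S.dualCone t (σ (arc (S.gauss p) z s)) - S.dualCone t p‖ ≤
        1 / 64 * ‖(z : Euc n) - S.gauss p‖ := by
  set y := S.gauss p with hy
  set d := ‖(z : Euc n) - y‖ with hd
  have hd0 : 0 < d := norm_pos_iff.2 (sub_ne_zero.2 fun h => hne (Subtype.ext h.symm))
  have hd2 : d ≤ 2 := by
    refine (norm_sub_le _ _).trans ?_
    rw [norm_eq_of_mem_sphere, norm_eq_of_mem_sphere]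
    norm_num
  set γ : ℝ → M := fun s => σ (arc y z s) with hγ
  have hq : S.dualCone t p = (1, -(y : Euc n)) := S.dualCone_of_flow_eq_origin hp
  have key : ∀ s ∈ Icc 0 b, ‖S.dualCone t (γ s) - S.dualCone t p‖ ≤ 1 / 32 →
      Real.exp t * (S.lightCone (γ s)).1 ≤ 32 ∧ (S.flow t (γ s)).1 ≤ 17 := by
    intro s hs h
    rw [hq] at h
    refine S.bounds_of_dualCone_near h ?_
    rw [gaussVec, hσ.right_inv _ (havoid s hs)]
    exact hz.trans (by gcongr; exact inner_le_inner_arc hz ⟨hs.1, hs.2.trans hb⟩)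
  have hderiv : ∀ s ∈ Icc 0 b, ∃ f', HasDerivAt (fun s => S.dualCone t (γ s) - S.dualCone t p) f' s ∧
      (‖S.dualCone t (γ s) - S.dualCone t p‖ ≤ 1 / 32 → ‖f'‖ < 1 / 64 * d) := by
    intro s hs
    have hne' := havoid s hs
    have h1 := hasDerivAt_comp_curve (S.dualCone_mdiff t (γ s))
      (hσ.mdifferentiableAt_arc hκ₀ hκ hz hne')
    refine ⟨_, h1.sub_const _, fun h => ?_⟩
    obtain ⟨k1, k2⟩ := key s hs h
    have h2 := S.norm_dmap_dualCone_le hκ₀ hκ t (γ s) (mfderiv 𝓘(ℝ, ℝ) (𝓡 n) γ s (1 : ℝ))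
    have h3 := hσ.dmap_gaussVec_arc hκ₀ hκ hz hne'
    have hC : 0 < 2 * (1 + κ₀)⁻¹ + 1 := by
      have : 0 ≤ (1 + κ₀)⁻¹ := inv_nonneg.2 (by linarith)
      linarith
    set C := 2 * (1 + κ₀)⁻¹ + 1 with hCdef
    have e1 : Real.exp (2 * t) = Real.exp t * Real.exp t := by rw [← Real.exp_add, two_mul]
    have e2 : Real.exp t * Real.exp (-t) = 1 := by
      rw [← Real.exp_add, add_neg_cancel, Real.exp_zero]
    have hE := Real.exp_pos t
    have hE' := Real.exp_pos (-t)
    have h4 : (S.lightCone (γ s)).1 ≤ 32 * Real.exp (-t) := by nlinarith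
    have h5 : C * (Real.exp (-t) * Real.exp (-t)) ≤ (2 ^ 20)⁻¹ := by
      have e3 : Real.exp (2 * t) * (Real.exp (-t) * Real.exp (-t)) = 1 := by
        rw [e1]; linear_combination (Real.exp t * Real.exp (-t) + 1) * e2
      have := mul_le_mul_of_nonneg_right ht (mul_pos hE' hE').le
      rw [e3] at this
      linarith
    have h6 := (S.flow_mem t (γ s)).2
    have h7 := S.lightCone_pos (γ s)
    calc _ ≤ _ := h2
      _ ≤ 17 * (Real.exp (-t) * (C * ((32 * Real.exp (-t)) * (8 * d)))) := by gcongr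
      _ = 4352 * d * (C * (Real.exp (-t) * Real.exp (-t))) := by ring
      _ ≤ 4352 * d * (2 ^ 20)⁻¹ := by gcongr
      _ < 1 / 64 * d := by linarith
  choose! f' hf' hle using hderiv
  have hB : ∀ s ∈ Icc 0 b, 1 / 64 * d * s ≤ 1 / 32 := fun s hs => by
    have := hs.2.trans hb
    nlinarith [hs.1]
  -- Bootstrap: the strict speed bound is needed only where the drift equals the barrier d·s/64,
  -- which is at most 1/32 as d ≤ 2. There the speed is at most 4352·d/2²⁰ < d/64, whence the
  -- constant 2²⁰.
  have main : ∀ ⦃s⦄, s ∈ Icc 0 b → ‖S.dualCone t (γ s) - S.dualCone t p‖ ≤ 1 / 64 * d * s := by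
    refine image_norm_le_of_norm_deriv_right_lt_deriv_boundary (f' := f')
      (B' := fun _ => 1 / 64 * d) (fun s hs => (hf' s hs).continuousAt.continuousWithinAt)
      (fun s hs => (hf' s (Ico_subset_Icc_self hs)).hasDerivWithinAt) ?_
      (fun s => by simpa using (hasDerivAt_id s).const_mul (1 / 64 * d)) ?_
    · simp only [hγ, arc_zero, hy, hσ.left_inv, sub_self, norm_zero, mul_zero, le_refl]
    · intro s hs h
      refine hle s (Ico_subset_Icc_self hs) ?_
      rw [h]
      exact hB s (Ico_subset_Icc_self hs)
  intro s hs
  refine ⟨(key s hs ((main hs).trans (hB s hs))).1, (main hs).trans ?_⟩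
  have := hs.2.trans hb
  nlinarith

/-- Otherwise the drift estimate along the arc to x keeps eᵗψ₀ ≤ 32 all the way, against the
unboundedness of ψ₀ there. -/
theorem IsGaussInverse.inner_gauss_lt (hcomplete : S.IsComplete) {t : ℝ}
    (ht : 2 ^ 20 * (2 * (1 + κ₀)⁻¹ + 1) ≤ Real.exp (2 * t)) {p : M}
    (hp : S.flow t p = origin n) :
    1 + inner ℝ (S.gauss p : Euc n) (x : Euc n) < 1 / 8 := by
  by_contra! h
  have hne : S.gauss p ≠ x := hσ.ne p
  obtain ⟨s, hs, hB⟩ := hσ.exists_lightCone_gt hκ₀ hκ hcomplete hne h (32 * (Real.exp t)⁻¹)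
  have h1 := (hσ.dualCone_drift hκ₀ hκ ht hp h hne hs.2.le
    (fun τ hτ => arc_ne h hne (hτ.2.trans_lt hs.2)) s (right_mem_Icc.2 hs.1.le)).1
  rw [← div_eq_mul_inv, div_lt_iff₀ (Real.exp_pos t)] at hB
  linarith

theorem IsGaussInverse.eq_of_flow_eq_origin (hcomplete : S.IsComplete) {t : ℝ}
    (ht : 2 ^ 20 * (2 * (1 + κ₀)⁻¹ + 1) ≤ Real.exp (2 * t)) {p q : M}
    (hp : S.flow t p = origin n) (hq : S.flow t q = origin n) : p = q := by
  refine hσ.injective ?_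
  by_contra hne
  have h1 := hσ.inner_gauss_lt hκ₀ hκ hcomplete ht hp
  have h2 := hσ.inner_gauss_lt hκ₀ hκ hcomplete ht hq
  have n1 : ‖(S.gauss p : Euc n)‖ = 1 := norm_eq_of_mem_sphere _
  have n2 : ‖(S.gauss q : Euc n)‖ = 1 := norm_eq_of_mem_sphere _
  have n3 : ‖(x : Euc n)‖ = 1 := norm_eq_of_mem_sphere _
  -- Both Gauss images lie within 1/2 of -x, hence at distance less than 1 from each other. Along
  -- their arc the product with G(p) stays above 1/2, while at x it is below -7/8, so the arc misses
  -- x.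
  have h3 : 1 / 2 < inner ℝ (S.gauss p : Euc n) (S.gauss q : Euc n) := by
    have e1 := norm_add_sq_real (S.gauss p : Euc n) x
    have e2 := norm_add_sq_real (S.gauss q : Euc n) x
    have e3 := norm_sub_sq_real (S.gauss p : Euc n) (S.gauss q)
    have e4 := norm_sub_le ((S.gauss p : Euc n) + x) ((S.gauss q : Euc n) + x)
    rw [add_sub_add_right_eq_sub] at e4
    rw [n1, n3] at e1
    rw [n2, n3] at e2
    rw [n1, n2] at e3
    have e5 : ‖(S.gauss p : Euc n) + x‖ < 1 / 2 := by
      refine lt_of_pow_lt_pow_left₀ 2 (by norm_num) ?_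
      rw [e1]; linarith
    have e6 : ‖(S.gauss q : Euc n) + x‖ < 1 / 2 := by
      refine lt_of_pow_lt_pow_left₀ 2 (by norm_num) ?_
      rw [e2]; linarith
    nlinarith [norm_nonneg ((S.gauss p : Euc n) - S.gauss q)]
  have hz : 1 / 8 ≤ 1 + inner ℝ (S.gauss p : Euc n) (S.gauss q : Euc n) := by linarith
  have h4 := (hσ.dualCone_drift hκ₀ hκ ht hp hz hne le_rfl (fun s hs h => by
    have := inner_le_inner_arc hz hs
    rw [h] at this
    linarith) 1 (right_mem_Icc.2 zero_le_one)).2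
  -- At the endpoints D is (1, -G), so the drift bound reads d ≤ d/64 with d > 0.
  rw [arc_one, hσ.left_inv, S.dualCone_of_flow_eq_origin hp, S.dualCone_of_flow_eq_origin hq] at h4
  have h5 := (norm_snd_le _).trans h4
  have h6 : 0 < ‖(S.gauss q : Euc n) - S.gauss p‖ :=
    norm_pos_iff.2 (sub_ne_zero.2 fun h => hne (Subtype.ext h.symm))
  rw [Prod.snd_sub, neg_sub_neg, norm_sub_rev] at h5
  change ‖(S.gauss q : Euc n) - S.gauss p‖ ≤ _ at h5
  linarith

end OrientedHypersurface

end HypSurf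

/-! ### Transport by point reflections, properness and embeddedness -/

namespace HypSurf

section Reflection

variable {n : ℕ}

theorem mink_neg_of_mem_hyperboloid {a b : Mink n} (ha : ‖a.2‖ ≤ a.1) (ha0 : 0 < a.1)
    (hb : b ∈ hyperboloid n) : mink a b < 0 := by
  have h1 := real_inner_le_norm a.2 b.2
  have h2 := mul_le_mul ha le_rfl (norm_nonneg b.2) ha0.le
  have h3 := mul_lt_mul_of_pos_left (norm_snd_lt_of_mem_hyperboloid hb) ha0
  rw [mink]
  linarith

variable {b : Mink n} (hb : b ∈ hyperboloid n)

include hb in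
theorem pointReflection_fst_pos {a : Mink n} (ha : ‖a.2‖ ≤ a.1) (ha0 : 0 < a.1) :
    0 < (pointReflection b a).1 := by
  rw [pointReflection_fst hb]
  exact neg_pos.2 (mink_neg_of_mem_hyperboloid ha ha0 hb)

include hb in
theorem pointReflection_sphere_fst_pos (y : Sph n) :
    0 < (pointReflection b ((1 : ℝ), (y : Euc n))).1 :=
  pointReflection_fst_pos hb (by simp) one_pos

/-- The action of a point reflection on the ideal boundary. -/
noncomputable def sphReflection (y : Sph n) : Sph n :=
  ⟨(pointReflection b ((1 : ℝ), (y : Euc n))).1⁻¹ • (pointReflection b ((1 : ℝ), (y : Euc n))).2, by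
    have h0 := pointReflection_sphere_fst_pos hb y
    have h := mink_pointReflection hb ((1 : ℝ), (y : Euc n)) ((1 : ℝ), (y : Euc n))
    simp only [mink, real_inner_self_eq_norm_sq, norm_eq_of_mem_sphere] at h
    have h1 : ‖(pointReflection b ((1 : ℝ), (y : Euc n))).2‖ =
        (pointReflection b ((1 : ℝ), (y : Euc n))).1 :=
      (sq_eq_sq₀ (norm_nonneg _) h0.le).1 (by linarith)
    rw [mem_sphere_zero_iff_norm, norm_smul, norm_inv, h1, Real.norm_of_nonneg h0.le,
      inv_mul_cancel₀ h0.ne']⟩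

theorem sphReflection_eq (y : Sph n) : ((1 : ℝ), (sphReflection hb y : Euc n)) =
    (pointReflection b ((1 : ℝ), (y : Euc n))).1⁻¹ • pointReflection b ((1 : ℝ), (y : Euc n)) :=
  Prod.ext (inv_mul_cancel₀ (pointReflection_sphere_fst_pos hb y).ne').symm rfl

theorem sphReflection_sphReflection (y : Sph n) : sphReflection hb (sphReflection hb y) = y := by
  have h0 := pointReflection_sphere_fst_pos hb y
  refine Subtype.ext ?_
  rw [sphReflection]
  simp only [sphReflection_eq hb y, map_smul, pointReflection_pointReflection hb]
  simp [h0.ne']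

theorem continuous_sphReflection : Continuous (sphReflection hb) := by
  refine Continuous.subtype_mk ?_ _
  have h : Continuous fun y : Sph n => pointReflection b ((1 : ℝ), (y : Euc n)) := by fun_prop
  exact (h.fst.inv₀ fun y => (pointReflection_sphere_fst_pos hb y).ne').smul h.snd

end Reflection

namespace OrientedHypersurface

variable {n : ℕ} {M : Type*} [TopologicalSpace M] [ChartedSpace (EuclideanSpace ℝ (Fin n)) M]
  (S : OrientedHypersurface n M) {b : Mink n} (hb : b ∈ hyperboloid n)

theorem dmap_clm_comp {F F' : Type*} [NormedAddCommGroup F] [NormedSpace ℝ F]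
    [NormedAddCommGroup F'] [NormedSpace ℝ F'] (A : F →L[ℝ] F') {f : M → F} {p : M}
    (hf : MDifferentiableAt (𝓡 n) 𝓘(ℝ, F) f p) (v : TangentSpace (𝓡 n) p) :
    dmap (fun q => A (f q)) p v = A (dmap f p v) :=
  dmap_eq_of_hasDerivAt (A.differentiableAt.mdifferentiableAt.comp p hf)
    (A.hasFDerivAt.comp_hasDerivAt (0 : ℝ) (hasDerivAt_chartCurve hf v))

/-- The image of a hypersurface under a point reflection of hyperbolic space. -/
noncomputable def reflect : OrientedHypersurface n M where
  φ p := pointReflection b (S.φ p)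
  η p := pointReflection b (S.η p)
  φ_mem p := ⟨(mink_pointReflection hb _ _).trans (S.φ_mem p).1,
    pointReflection_fst_pos hb (norm_snd_lt_of_mem_hyperboloid (S.φ_mem p)).le (S.φ_mem p).2⟩
  φ_immersed := by
    refine ⟨(pointReflection b).contDiff.contMDiff.comp S.φ_smooth, fun p v w h => ?_⟩
    rw [dmap_clm_comp _ (S.φ_mdiff p), dmap_clm_comp _ (S.φ_mdiff p)] at h
    exact S.φ_immersed.2 p ((Function.LeftInverse.injective
      (pointReflection_pointReflection hb)) h)
  η_smooth := (pointReflection b).contDiff.contMDiff.comp S.η_smooth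
  η_unit p := (mink_pointReflection hb _ _).trans (S.η_unit p)
  η_tangent p := (mink_pointReflection hb _ _).trans (S.η_tangent p)
  η_normal p v := by
    rw [dmap_clm_comp _ (S.φ_mdiff p), mink_pointReflection hb, S.η_normal]

theorem reflect_flow (t : ℝ) (p : M) : (S.reflect hb).flow t p = pointReflection b (S.flow t p) := by
  simp only [flow, reflect, map_sub, map_smul]

theorem reflect_gauss (p : M) : (S.reflect hb).gauss p = sphReflection hb (S.gauss p) := by
  have h : (S.reflect hb).lightCone p =
      (S.lightCone p).1 • pointReflection b ((1 : ℝ), (S.gauss p : Euc n)) := by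
    rw [← map_smul]
    change _ = pointReflection b ((S.lightCone p).1 • ((1 : ℝ), S.gaussVec p))
    rw [← S.lightCone_eq, lightCone, lightCone, map_sub]
    rfl
  have h0 := (S.lightCone_pos p).ne'
  refine Subtype.ext ?_
  rw [gauss, sphReflection]
  simp only [h, Prod.smul_fst, Prod.smul_snd, smul_eq_mul, mul_inv, smul_smul]
  congr 1
  field_simp

theorem reflect_isPrincipalCurvature {p : M} {κ : ℝ}
    (h : (S.reflect hb).IsPrincipalCurvature p κ) : S.IsPrincipalCurvature p κ := by
  obtain ⟨e, he, h⟩ := h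
  refine ⟨e, he, Function.LeftInverse.injective (pointReflection_pointReflection hb) ?_⟩
  rw [map_smul, ← dmap_clm_comp _ (S.φ_mdiff p), ← dmap_clm_comp _ (S.η_mdiff p)]
  exact h

theorem reflect_isComplete (h : S.IsComplete) : (S.reflect hb).IsComplete := by
  have e : (S.reflect hb).inducedNorm = S.inducedNorm := by
    funext p v
    have e' : dmap (S.reflect hb).φ p v = pointReflection b (dmap S.φ p v) :=
      dmap_clm_comp _ (S.φ_mdiff p) v
    rw [inducedNorm, inducedNorm, e', mink_pointReflection hb]
  rwa [IsComplete, e]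

variable {S} {x : Sph n} {σ : Sph n → M} (hσ : S.IsGaussInverse x σ)
include hσ

theorem IsGaussInverse.reflect : (S.reflect hb).IsGaussInverse (sphReflection hb x)
    fun y => σ (sphReflection hb y) := by
  have hinv := sphReflection_sphReflection hb
  have hne : ∀ {y}, y ≠ sphReflection hb x → sphReflection hb y ≠ x := fun hy h =>
    hy (by rw [← h, hinv])
  refine ⟨fun y hy => ?_, fun y hy => ?_, fun q h => ?_, fun q => ?_⟩
  · exact (hσ.continuousAt _ (hne hy)).comp (continuous_sphReflection hb).continuousAt
  · rw [reflect_gauss, hσ.right_inv _ (hne hy), hinv]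
  · rw [reflect_gauss] at h
    exact hσ.ne q (by rw [← hinv (S.gauss q), h, hinv])
  · rw [reflect_gauss, hinv, hσ.left_inv]

variable [IsManifold (𝓡 n) ∞ M] {κ₀ : ℝ} (hκ₀ : -1 < κ₀)
  (hκ : ∀ (p : M) (κ : ℝ), S.IsPrincipalCurvature p κ → κ₀ ≤ κ)
include hκ₀ hκ

/-- The reflection exchanging the double point with the origin preserves completeness, the curvature
bound and the Gauss inverse. The threshold on t depends only on κ₀, so it serves every double point.
-/
theorem IsGaussInverse.injective_flow (hcomplete : S.IsComplete) {t : ℝ}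
    (ht : 2 ^ 20 * (2 * (1 + κ₀)⁻¹ + 1) ≤ Real.exp (2 * t)) : Function.Injective (S.flow t) := by
  intro p q h
  have hb := S.flow_mem t p
  refine (hσ.reflect hb).eq_of_flow_eq_origin hκ₀
    (fun p κ h => hκ p κ (S.reflect_isPrincipalCurvature hb h)) (S.reflect_isComplete hb hcomplete)
    ht ?_ ?_
  · rw [reflect_flow, pointReflection_self hb]
  · rw [reflect_flow, ← h, pointReflection_self hb]

theorem IsGaussInverse.isProperMap_flow (hcomplete : S.IsComplete) {t : ℝ} (ht : 0 ≤ t) :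
    IsProperMap (S.flow t) := by
  have hcont : Continuous (S.flow t) := (S.flow_smooth t).continuous
  refine isProperMap_iff_isCompact_preimage.2 ⟨hcont, fun K hK => ?_⟩
  obtain ⟨B, hB⟩ := hK.isBounded.exists_norm_le
  set D := 16 * (1 + κ₀)⁻¹ * (Real.exp t * B) with hD
  -- A closed set of Gauss images that misses x and contains those of all points with φᵗ in K:
  -- either φ₀ ≤ eᵗB keeps G away from x, or G is already close to -x.
  set L : Set (Sph n) := {y | 1 ≤ D * ‖(x : Euc n) - y‖} ∪
    {y | 1 + inner ℝ (y : Euc n) (x : Euc n) ≤ 1 / 8} with hL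
  have hLc : IsClosed L := by
    refine IsClosed.union (isClosed_le ?_ ?_) (isClosed_le ?_ ?_) <;> fun_prop
  have hxL : ∀ y ∈ L, y ≠ x := by
    rintro y hy rfl
    have h1 : inner ℝ (y : Euc n) (y : Euc n) = (1 : ℝ) := by
      rw [real_inner_self_eq_norm_sq, norm_eq_of_mem_sphere, one_pow]
    rcases hy with hy | hy <;> norm_num [h1] at hy
  have hσL : IsCompact (σ '' L) := hLc.isCompact.image_of_continuousOn fun y hy =>
    (hσ.continuousAt y (hxL y hy)).continuousWithinAt
  refine hσL.of_isClosed_subset (hK.isClosed.preimage hcont) fun p hp => ?_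
  refine ⟨S.gauss p, ?_, hσ.left_inv p⟩
  by_cases hc : 1 / 8 ≤ 1 + inner ℝ (S.gauss p : Euc n) (x : Euc n)
  · left
    have h1 := hσ.one_le_mul_φ_fst hκ₀ hκ hcomplete (hσ.ne p) hc
    rw [hσ.left_inv] at h1
    have h2 : (S.flow t p).1 ≤ B :=
      (le_abs_self _).trans ((norm_fst_le (S.flow t p)).trans (hB _ hp))
    have h3 : (S.φ p).1 ≤ Real.exp t * B :=
      (S.φ_fst_le_flow ht p).trans (mul_le_mul_of_nonneg_left h2 (Real.exp_pos t).le)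
    have hC : 0 ≤ (1 + κ₀)⁻¹ := inv_nonneg.2 (by linarith)
    calc (1 : ℝ) ≤ _ := h1
      _ ≤ 16 * (1 + κ₀)⁻¹ * ‖(x : Euc n) - S.gauss p‖ * (Real.exp t * B) := by gcongr
      _ = _ := by rw [hD]; ring
  · right
    exact (not_le.1 hc).le

/-- A proper injective map is a closed embedding. Requiring t ≥ 0 and t ≥ log of the drift threshold
gives 2t ≥ log as well. -/
theorem IsGaussInverse.isEmbedding_flow (hcomplete : S.IsComplete) :
    ∃ t₀ : ℝ, ∀ t : ℝ, t₀ ≤ t → IsImmersed (n := n) (S.flow t) ∧ IsEmbedding (S.flow t) := by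
  have hC : 0 ≤ (1 + κ₀)⁻¹ := inv_nonneg.2 (by linarith)
  have hpos : 0 < 2 ^ 20 * (2 * (1 + κ₀)⁻¹ + 1) := by positivity
  refine ⟨max 0 (Real.log (2 ^ 20 * (2 * (1 + κ₀)⁻¹ + 1))), fun t ht => ?_⟩
  have ht0 : 0 ≤ t := (le_max_left _ _).trans ht
  have ht1 : 2 ^ 20 * (2 * (1 + κ₀)⁻¹ + 1) ≤ Real.exp (2 * t) := by
    rw [← Real.log_le_iff_le_exp hpos]
    linarith [(le_max_right _ _).trans ht]
  have hp := hσ.isProperMap_flow hκ₀ hκ hcomplete ht0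
  exact ⟨S.isImmersed_flow hκ₀ hκ ht0, (IsClosedEmbedding.of_continuous_injective_isClosedMap
    hp.continuous (hσ.injective_flow hκ₀ hκ hcomplete ht1) hp.isClosedMap).isEmbedding⟩

end OrientedHypersurface

end HypSurf

/-! ### The main theorem -/

theorem theorem1p4 (n : ℕ) (hn : 2 ≤ n) {M : Type*} [TopologicalSpace M] [T2Space M]
    [SecondCountableTopology M] [ConnectedSpace M] [ChartedSpace (EuclideanSpace ℝ (Fin n)) M]
    [IsManifold (𝓡 n) ∞ M] (S : HypSurf.OrientedHypersurface n M)
    (hcomplete : S.IsComplete) (hconvex : S.UniformlyWeaklyHorosphericallyConvex)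
    (x : HypSurf.Sph n) (hx : S.idealBoundary = {x}) :
    -- the horospherical support function descends to `G(M)`, and gives a smooth conformal metric
    Function.Injective S.gauss ∧ IsOpen (range S.gauss) ∧
    (∃ ρ : HypSurf.Sph n → ℝ,
      (∀ p : M, ρ (S.gauss p) = S.support p) ∧
      ContMDiffOn (𝓡 n) 𝓘(ℝ, ℝ) ∞ ρ (range S.gauss) ∧
      -- `G` pulls the metric `e^{2ρ} g` back to the horospherical metric of `φ`
      (∀ (p : M) (v w : TangentSpace (𝓡 n) p), S.horosphericalMetric p v w =
        Real.exp (2 * ρ (S.gauss p)) *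
          inner ℝ (HypSurf.dmap (fun q : M => (S.gauss q : HypSurf.Euc n)) p v)
            (HypSurf.dmap (fun q : M => (S.gauss q : HypSurf.Euc n)) p w)) ∧
      HypSurf.IsCompleteMetricOn (𝓡 n) (range S.gauss) (HypSurf.conformalNorm ρ) ∧
      HypSurf.BoundedP (range S.gauss) ρ) ∧
    S.idealBoundary = frontier (range S.gauss) ∧
    -- the normal flow runs through immersions into hyperbolic space and is eventually embedded
    (∀ t : ℝ, 0 ≤ t → HypSurf.IsImmersed (n := n) (S.flow t)) ∧
    (∃ t₀ : ℝ, ∀ t : ℝ, t₀ ≤ t →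
      HypSurf.IsImmersed (n := n) (S.flow t) ∧ IsEmbedding (S.flow t)) := by
  obtain ⟨κ₀, hκ₀, hκ⟩ := hconvex
  obtain ⟨σ, hσ₁, hσ₂⟩ := S.exists_inverse hκ₀ hκ hn hcomplete hx
  have hσ : S.IsGaussInverse x σ := ⟨fun y hy => (hσ₁ y hy).1, fun y hy => (hσ₁ y hy).2,
    fun q => (hσ₂ q).1, fun q => (hσ₂ q).2⟩
  refine ⟨hσ.injective, ?_, ⟨fun y => S.support (σ y), fun p => ?_, fun y hy => ?_,
    fun p v w => ?_, hσ.isCompleteMetricOn hκ₀ hκ hcomplete, hσ.boundedP hκ₀ hκ⟩, ?_,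
    fun t ht => S.isImmersed_flow hκ₀ hκ ht, hσ.isEmbedding_flow hκ₀ hκ hcomplete⟩
  · rw [hσ.range_eq]
    exact isOpen_compl_singleton
  · exact congrArg S.support (hσ.left_inv p)
  · rw [hσ.range_eq] at hy
    exact ((S.support_smooth _).comp y (hσ.contMDiffAt hκ₀ hκ hy)).contMDiffWithinAt
  · change HypSurf.mink _ _ = Real.exp (2 * S.support (σ (S.gauss p))) * _
    rw [hσ.left_inv, two_mul, Real.exp_add, S.exp_support, S.mink_dlightCone, pow_two]
  -- The frontier of the complement of x is {x} because x is not isolated: the sphere is connected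
  -- and has more than one point.
  · have hne : x ≠ -x := ne_neg_of_mem_unit_sphere ℝ x
    have hrank : 1 < Module.rank ℝ (HypSurf.Euc n) := by
      rw [← Module.finrank_eq_rank, finrank_euclideanSpace_fin]
      exact_mod_cast (by omega : 1 < n + 1)
    have : ConnectedSpace (HypSurf.Sph n) :=
      Subtype.connectedSpace (isConnected_sphere hrank 0 zero_le_one)
    have : Nontrivial (HypSurf.Sph n) := ⟨x, -x, hne⟩
    rw [hx, hσ.range_eq, frontier_compl, frontier, closure_singleton, interior_singleton, sdiff_empty]
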